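/- **Setting.** Let $Y\subseteq\mathbb R^m$, $W\subseteq\mathbb R^\ell$ be nonempty, closed and convex, and let $\phi:\mathbb R^n\times\mathbb R^m\to\mathbb R$, $\psi:\mathbb R^n\times\mathbb R^\ell\to\mathbb R$ be continuously differentiable. Assume, for $\phi$ on $\mathbb R^n\times Y$ (with constants $L^\phi_{xx},L^\phi_{yy}\ge0$, $L^\phi_{xy},C_\phi,\eta_\phi,c_\phi>0$) and likewise for $\psi$ on $\mathbb R^n\times W$: $\|\nabla_x\phi(x,y)-\nabla_x\phi(\bar x,\bar y)\|\le L^\phi_{xx}\|x-\bar x\|+L^\phi_{xy}\|y-\bar y\|$, $\|\nabla_y\phi(x,y)-\nabla_y\phi(\bar x,\bar y)\|\le L^\phi_{xy}\|x-\bar x\|+L^\phi_{yy}\|y-\bar y\|$, $\|\nabla_x\phi\|\le C_\phi$, and for every $x$ either $\phi(x,\cdot)$ is $\eta_\phi$-strongly concave on $Y$, or $Y=\mathbb R^m$, $\phi(x,\cdot)$ attains its maximum and $c_\phi(\max\phi(x,\cdot)-\phi(x,y))^{1/2}\le\|\nabla_y\phi(x,y)\|$ for all $y$ (PL). Assume that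 there are $\mu>0$, $\theta\in(0,1)$ with $[\psi(x,w)]_+^{2\theta}\le\mu\,\|[\psi(x,w)]_+\nabla_x\psi(x,w)\|$ for all $w\in W$, $x\in\mathbb R^n$. Put $f(x)=\max_{y\in Y}\phi(x,y)$, $g(x)=\max_{w\in W}\psi(x,w)$, and assume that $f$ is bounded below. **Algorithm.** Given $T\ge1$, $(x_0,y_0,w_0)\in\mathbb R^n\times Y\times W$, weights $\alpha_k=T^{1/3}/(k+2)^{1+\omega}$ and a constant step $\gamma>0$, for $k=0,\dots,T-1$ put $\zeta_k=[\psi(x_k,w_k)]_+\|\nabla_x\psi(x_k,w_k)\|$, $$\lambda_k=\frac{\big[-\nabla_x\psi(x_k,w_k)^\top\nabla_x\phi(x_k,y_k)+\alpha_k\|\nabla_x\psi(x_k,w_k)\|\big]_+}{\|\nabla_x\psi(x_k,w_k)\|^2}\ \text{ if }\zeta_k>0,\qquad \lambda_k=0\ \text{ otherwise},$$ $x_{k+1}=x_k-\gamma\big(\nabla_x\phi(x_k,y_k)+\lambda_k\nabla_x\psi(x_k,w_k)\big)$; then $y_{k+1}$ is obtained from $y_k$ by $N_{k+1}\ge1$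 steps of projected gradient ascent on $\phi(x_{k+1},\cdot)$ over $Y$, and $w_{k+1}$ from $w_k$ by $M_{k+1}\ge1$ steps of projected gradient ascent on $\psi(x_{k+1},\cdot)$ over $W$. The inner step sizes $s_y,s_w>0$ satisfy $s_yL^\phi_{yy}\le1$, $s_wL^\psi_{ww}\le1$; under strong concavity for every $x$, Nesterov's accelerated projected ascent (with $\eta_\phi s_y\le1$, resp. $\eta_\psi s_w\le1$) may be used instead. Put $$R_k=\max\Big\{\max\{1,\tfrac1{2\theta}\}\log T,\ \log\big(T[\psi(x_k,w_k)]_+^{2-4\theta}\big)\Big\}\ \text{ if }\zeta_k>0,\qquad R_k=\max\{1,\tfrac1{2\theta}\}\log T\ \text{ otherwise}.$$ **Theorem.** The maxima defining $f,g$ are attained and $f,g$ are continuously differentiable. There are $c_N,c_M>0$, depending only on the problem data and the inner solvers, such that for every starting point $(x_0,y_0,w_0)\in\mathbb R^n\times Y\times W$ and all $0<c_1\le c_2$ the following holds for all sufficiently small $\omega>0$. There is a constant $C>0$, independent of $T$, $\gamma$, $N_k$, $M_k$ and $\epsilon$, such that for every $T\ge1$ and every $\gamma\in[c_1T^{-1/3},c_2T^{-1/3}]$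 (for instance $\gamma=\min\{cT^{-1/3},\Gamma\}$ with fixed $c,\Gamma>0$, where $c_1=\min\{c,\Gamma\}$, $c_2=c$): (a) there are runs of the algorithm with $c_N\log(k+1)\le N_k\le C(1+\log(k+1))$ and $c_MR_k\le M_k\le C(1+R_k)$ for $1\le k\le T$; (b) for every run with $N_k\ge c_N\log(k+1)$ and $M_k\ge c_MR_k$ for $1\le k\le T$ there is one $t\in\{0,\dots,T-1\}$ with $\lambda_t\ge0$ such that for every $\epsilon>0$: 1. (stationarity) $\|\nabla f(x_t)+\lambda_t\nabla g(x_t)\|\le\epsilon$ if $T\ge C\epsilon^{-3}$; 2. (feasibility) $[g(x_t)]_+\le\epsilon$ if $T\ge C\epsilon^{-6\theta}$; 3. (complementary slackness) $|\lambda_tg(x_t)|\le\epsilon$ if $T\ge C\epsilon^{-3\theta/(1-\theta)}$. -/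

import Mathlib

open scoped RealInnerProductSpace

noncomputable section

namespace SemiInfMinMax

/-- `ℝⁿ` with the Euclidean norm. -/
abbrev E (n : ℕ) := EuclideanSpace ℝ (Fin n)

/-- Partial gradient of `h (x, u)` in the first variable. -/
def gradX {n m : ℕ} (h : E n → E m → ℝ) (x : E n) (u : E m) : E n :=
  gradient (fun x' => h x' u) x

/-- Partial gradient of `h (x, u)` in the second variable. -/
def gradU {n m : ℕ} (h : E n → E m → ℝ) (x : E n) (u : E m) : E m :=
  gradient (fun u' => h x u') u

/-- The value function `x ↦ max_{u ∈ U} h (x, u)`. -/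
def maxValue {n m : ℕ} (h : E n → E m → ℝ) (U : Set (E m)) (x : E n) : ℝ :=
  sSup (h x '' U)

/-- The Polyak-Łojasiewicz inequality (Łojasiewicz exponent `1/2`) for the maximization of `h`
over the whole space: `h` attains its maximum and `c (max h - h u)^{1/2} ≤ ‖∇ h u‖`. -/
def IsPL {m : ℕ} (c : ℝ) (h : E m → ℝ) : Prop :=
  ∃ us : E m, (∀ u, h u ≤ h us) ∧ ∀ u, c * Real.sqrt (h us - h u) ≤ ‖gradient h u‖

/-- The standing assumptions on a coupling function `h (x, u)`, `x ∈ ℝⁿ`, `u ∈ U ⊆ ℝᵐ`: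
smoothness with Lipschitz partial gradients, a bounded gradient in `x`, and strong concavity on `U`
or the PL inequality with `U = ℝᵐ` in the second variable. -/
structure CouplingAssumption {n m : ℕ} (h : E n → E m → ℝ) (U : Set (E m))
    (Lxx Lxu Luu C η c : ℝ) : Prop where
  nonempty : U.Nonempty
  isClosed : IsClosed U
  convex : Convex ℝ U
  Lxx_nonneg : 0 ≤ Lxx
  Lxu_pos : 0 < Lxu
  Luu_nonneg : 0 ≤ Luu
  C_pos : 0 < C
  η_pos : 0 < η
  c_pos : 0 < c
  contDiff : ContDiff ℝ 1 (fun p : E n × E m => h p.1 p.2)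
  lipschitz_gradX : ∀ x x' : E n, ∀ u ∈ U, ∀ u' ∈ U,
    ‖gradX h x u - gradX h x' u'‖ ≤ Lxx * ‖x - x'‖ + Lxu * ‖u - u'‖
  lipschitz_gradU : ∀ x x' : E n, ∀ u ∈ U, ∀ u' ∈ U,
    ‖gradU h x u - gradU h x' u'‖ ≤ Lxu * ‖x - x'‖ + Luu * ‖u - u'‖
  bounded_gradX : ∀ x : E n, ∀ u ∈ U, ‖gradX h x u‖ ≤ C
  concave_or_PL : ∀ x : E n, StrongConcaveOn U η (h x) ∨ (U = Set.univ ∧ IsPL c (h x))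

/-- The Łojasiewicz regularity of the squared residuals `[ψ (·, w)]₊²`, uniformly in `w ∈ W`. -/
structure LojasiewiczRegularity {n l : ℕ} (ψ : E n → E l → ℝ) (W : Set (E l))
    (μ θ : ℝ) : Prop where
  μ_pos : 0 < μ
  θ_pos : 0 < θ
  θ_lt_one : θ < 1
  ineq : ∀ w ∈ W, ∀ x : E n,
    (max (ψ x w) 0) ^ (2 * θ) ≤ μ * ‖(max (ψ x w) 0) • gradX ψ x w‖

/-- The Euclidean projection onto `U` (unique when `U` is closed, convex and nonempty). -/
def proj {m : ℕ} (U : Set (E m)) (z : E m) : E m :=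
  Classical.epsilon fun p => p ∈ U ∧ ∀ q ∈ U, dist z p ≤ dist z q

/-- One step of projected gradient ascent for `max_{u ∈ U} h (x, u)` with step size `s`. -/
def ascentStep {n m : ℕ} (h : E n → E m → ℝ) (U : Set (E m)) (s : ℝ) (x : E n) (u : E m) : E m :=
  proj U (u + s • gradU h x u)

/-- One step of Nesterov's accelerated projected gradient ascent for an `η`-strongly concave
function, with step size `s`, in the form that keeps all points in `U`. When `U` is the whole space
it is `u⁺ = v + s ∇h(v)`, `v⁺ = u⁺ + ((1 - q) / (1 + q)) (u⁺ - u)` with `q = √(η s)`. -/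
def accStep {n m : ℕ} (h : E n → E m → ℝ) (U : Set (E m)) (s η : ℝ) (x : E n)
    (p : E m × E m) : E m × E m :=
  let q := Real.sqrt (η * s)
  let v := (1 / (1 + q)) • (p.1 + q • p.2)
  let z := proj U ((1 - q) • p.2 + q • v + (q / η) • gradU h x v)
  ((1 - q) • p.1 + q • z, z)

/-- The two inner solvers. -/
inductive AscentMethod
  | plain
  | accelerated

/-- The point reached from `u` after `N` steps of the inner solver for `max_{u ∈ U} h (x, u)`. -/
def AscentMethod.run {n m : ℕ} (a : AscentMethod) (h : E n → E m → ℝ) (U : Set (E m))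
    (s η : ℝ) (N : ℕ) (x : E n) (u : E m) : E m :=
  match a with
  | .plain => (ascentStep h U s x)^[N] u
  | .accelerated => ((accStep h U s η x)^[N] (u, u)).1

/-- Admissible inner solvers: a step size `s ∈ (0, 1 / Luu]`; the accelerated solver is used only
for functions that are strongly concave, and with `η s ≤ 1` (which follows from `s ≤ 1 / Luu`
unless `U` is a single point). -/
def AscentMethod.Admissible {n m : ℕ} (a : AscentMethod) (h : E n → E m → ℝ) (U : Set (E m))
    (Luu η s : ℝ) : Prop :=
  0 < s ∧ s * Luu ≤ 1 ∧
    (a = .accelerated → (∀ x, StrongConcaveOn U η (h x)) ∧ η * s ≤ 1)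

/-- The indicator `ζ (x, w) = [ψ (x, w)]₊ ‖∇ₓψ (x, w)‖`. -/
def zeta {n l : ℕ} (ψ : E n → E l → ℝ) (x : E n) (w : E l) : ℝ :=
  max (ψ x w) 0 * ‖gradX ψ x w‖

/-- The modified dual multiplier, with barrier `ρ (x, w) = ‖∇ₓψ (x, w)‖` and weight `a`. -/
def multiplier {n m l : ℕ} (φ : E n → E m → ℝ) (ψ : E n → E l → ℝ) (a : ℝ)
    (x : E n) (y : E m) (w : E l) : ℝ :=
  open Classical in
  if 0 < zeta ψ x w then
    1 / ‖gradX ψ x w‖ ^ 2 *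
      max (-⟪gradX ψ x w, gradX φ x y⟫ + a * ‖gradX ψ x w‖) 0
  else 0

/-- The search direction. -/
def direction {n m l : ℕ} (φ : E n → E m → ℝ) (ψ : E n → E l → ℝ) (a : ℝ)
    (x : E n) (y : E m) (w : E l) : E n :=
  -gradX φ x y - multiplier φ ψ a x y w • gradX ψ x w

/-- The barrier weights `α_k = T^{1/3} / (k + 2)^{1 + ω}`. -/
def weight (ω : ℝ) (T k : ℕ) : ℝ :=
  (T : ℝ) ^ (1 / 3 : ℝ) / ((k : ℝ) + 2) ^ (1 + ω)

/-- The iterates `(x_k, y_k, w_k)`, `0 ≤ k ≤ T`, of `T` iterations of the inexact dynamic barrier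
primal-dual method with constant step `γ` and weights `α`, started at `(x₀, y₀, w₀)`. The points
`y_k` and `w_k` (`k ≥ 1`) are obtained by `N_k` and `M_k` steps of the inner solvers at `x_k`,
started at `y_{k-1}` and `w_{k-1}`. -/
structure IsRun {n m l : ℕ} (φ : E n → E m → ℝ) (ψ : E n → E l → ℝ)
    (Y : Set (E m)) (W : Set (E l)) (ay aw : AscentMethod) (sy sw ηφ ηψ : ℝ)
    (α : ℕ → ℝ) (γ : ℝ) (T : ℕ) (N M : ℕ → ℕ) (x₀ : E n) (y₀ : E m) (w₀ : E l)
    (x : ℕ → E n) (y : ℕ → E m) (w : ℕ → E l) : Prop where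
  x_zero : x 0 = x₀
  y_zero : y 0 = y₀
  w_zero : w 0 = w₀
  x_succ : ∀ k < T, x (k + 1) = x k + γ • direction φ ψ (α k) (x k) (y k) (w k)
  y_succ : ∀ k < T, y (k + 1) = ay.run φ Y sy ηφ (N (k + 1)) (x (k + 1)) (y k)
  w_succ : ∀ k < T, w (k + 1) = aw.run ψ W sw ηψ (M (k + 1)) (x (k + 1)) (w k)

/-- The order of the number of inner steps for `w`: logarithmic in `T` and, when the constraint is
treated as active, in the current residual `[ψ (x, w)]₊`. -/
def ascentBudget {n l : ℕ} (ψ : E n → E l → ℝ) (θ : ℝ) (T : ℕ) (x : E n) (w : E l) : ℝ :=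
  open Classical in
  if 0 < zeta ψ x w then
    max (max 1 (1 / (2 * θ)) * Real.log T)
      (Real.log (T * (max (ψ x w) 0) ^ (2 - 4 * θ)))
  else max 1 (1 / (2 * θ)) * Real.log T

end SemiInfMinMax

end

/-!
# Complexity of an inexact dynamic barrier method for min-max constrained problems

**Value functions.** Strong concavity, or the Polyak-Łojasiewicz inequality, gives quadratic growth
of the inner problems around their solution sets (`exists_isMax_near`; under the
Polyak-Łojasiewicz inequality a gradient ascent path of length `O(√gap)` ends at a maximizer) and
maximizers that are Lipschitz in `x`. Hence Danskin's formula holds and the gradients of `f` and `g`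
are Lipschitz; the partial gradients at inexact inner solutions are off by `O(√gap)`, and `√gap`
changes by `O(‖x' - x‖)` with `x` (`ValueRegularity`). The inner solvers contract the gap linearly
(`exists_linear_rate`; a Lyapunov function in the accelerated case). As the outer steps are
bounded, warm-started inner solves of logarithmic length keep the errors below `O(k⁻⁴)` for `φ` and
`O(T⁻⁴)` for `ψ` (`MethodData.controlledRun`).

**Objective.** The direction `d` satisfies `⟪∇φ, d⟫ ≤ -(‖d‖² - α²)₊ + ‖∇φ‖ α`, and `γ α_k` is of
order `(k + 2) ^ (-(1 + ω))`, which is summable. As `f` is bounded below, the sum of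
`γ (‖d_k‖² - α_k²)₊` is bounded independently of `T` (`MethodData.exists_sum_excess_le`). In the
second half of the run `α_k = O(T ^ (-2/3))`, so some `t` there has `‖d_t‖ = O(T ^ (-1/3))`.

**Constraint.** If `θ < 1/2`, the regularity condition forces `ψ ≤ 0` everywhere. Otherwise put
`σ = 2 θ - 1 ∈ [0, 1)`. While `ψ > 0`, the barrier and the regularity condition decrease `g` by
`c (k + 2) ^ (-(1 + ω)) ψ ^ σ` per step. The second order terms are `O((k + 2) ^ (-2 (1 + ω)))`, up
to the excess, whose total contribution is `γ O(1) = O(T ^ (-1/3))`. Since `σ < 1`, such a recursion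
drives `g` below `O(k ^ (-1/3) + T ^ (-1/3))` provided that `ω` is small (`exists_decay`). Thus
`[g]₊ = O(T ^ (-1/3))` throughout the second half, in particular at the iterate `t` above. There the
multiplier is `O(ψ ^ (1 - 2 θ))`, so `λ ψ = O(ψ ^ (2 - 2 θ))`, and the budget for the inner steps
makes `λ √gap = O(T ^ (-1/3))`.
-/

namespace SemiInfMinMax

/-! ### First-order estimates along segments -/

section Calculus

variable {V : Type*} [NormedAddCommGroup V] [InnerProductSpace ℝ V] [CompleteSpace V]

theorem hasDerivAt_comp_line {F : V → ℝ} {g a d : V} {t : ℝ}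
    (hF : HasGradientAt F g (a + t • d)) :
    HasDerivAt (fun s : ℝ => F (a + s • d)) ⟪g, d⟫ t := by
  have hl : HasDerivAt (fun s : ℝ => a + s • d) d t := by
    simpa using ((hasDerivAt_id t).smul_const d).const_add a
  exact (hF.hasFDerivAt.comp_hasDerivAt t hl).congr_deriv (by simp)

/-- A lower bound on the increments of `F` along a ray bounds its directional derivative. -/
theorem le_inner_of_forall_increment {F : V → ℝ} {g a d : V} (hF : HasGradientAt F g a) {A B : ℝ}
    (h : ∀ t : ℝ, 0 < t → t ≤ 1 → t * (A - t * B) ≤ F (a + t • d) - F a) : A ≤ ⟪g, d⟫ := by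
  have hF' : HasGradientAt F g (a + (0 : ℝ) • d) := by simpa using hF
  have hd := (hasDerivAt_comp_line hF').hasDerivWithinAt (s := Set.Ioi 0)
  rw [hasDerivWithinAt_iff_tendsto_slope' (by simp)] at hd
  have h1 : Filter.Tendsto (fun t : ℝ => A - t * B) (nhdsWithin 0 (Set.Ioi 0)) (nhds A) := by
    have : Filter.Tendsto (fun t : ℝ => A - t * B) (nhds 0) (nhds (A - 0 * B)) := by
      apply Continuous.tendsto; fun_prop
    simpa using this.mono_left nhdsWithin_le_nhds
  refine le_of_tendsto_of_tendsto h1 hd ?_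
  have : Set.Ioc (0 : ℝ) 1 ∈ nhdsWithin (0 : ℝ) (Set.Ioi 0) := Ioc_mem_nhdsGT one_pos
  filter_upwards [this] with t ht
  have := h t ht.1 ht.2
  simp only [slope, vsub_eq_sub, sub_zero, zero_smul, add_zero, smul_eq_mul]
  rw [inv_mul_eq_div, le_div_iff₀ ht.1]
  linarith

/-- The quadratic upper bound for a function whose gradient is Lipschitz along a segment. -/
theorem le_of_lipschitz_gradient {F : V → ℝ} {G : V → V} (hF : ∀ z, HasGradientAt F (G z) z)
    {a b : V} {L : ℝ} (hL : ∀ z ∈ segment ℝ a b, ‖G z - G a‖ ≤ L * ‖z - a‖) :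
    F b ≤ F a + ⟪G a, b - a⟫ + L / 2 * ‖b - a‖ ^ 2 := by
  set d := b - a with hd
  let q : ℝ → ℝ := fun t => F (a + t • d) - t * ⟪G a, d⟫ - L / 2 * ‖d‖ ^ 2 * t ^ 2
  have hq : ∀ t, HasDerivAt q (⟪G (a + t • d), d⟫ - ⟪G a, d⟫ - L / 2 * ‖d‖ ^ 2 * (2 * t)) t := by
    intro t
    have h1 := hasDerivAt_comp_line (hF (a + t • d))
    have h2 : HasDerivAt (fun t : ℝ => t * ⟪G a, d⟫) ⟪G a, d⟫ t := by
      simpa using (hasDerivAt_id t).mul_const ⟪G a, d⟫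
    have h3 : HasDerivAt (fun t : ℝ => L / 2 * ‖d‖ ^ 2 * t ^ 2) (L / 2 * ‖d‖ ^ 2 * (2 * t)) t := by
      simpa using (hasDerivAt_pow 2 t).const_mul (L / 2 * ‖d‖ ^ 2)
    exact (h1.sub h2).sub h3
  have hanti : AntitoneOn q (Set.Icc 0 1) := by
    refine antitoneOn_of_deriv_nonpos (convex_Icc 0 1)
      (fun t _ => (hq t).continuousAt.continuousWithinAt)
      (fun t _ => (hq t).differentiableAt.differentiableWithinAt) ?_
    intro t ht
    rw [interior_Icc] at ht
    rw [(hq t).deriv, ← inner_sub_left]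
    have hz : a + t • d ∈ segment ℝ a b :=
      ⟨1 - t, t, by linarith [ht.2], ht.1.le, by ring, by rw [hd]; module⟩
    have h1 := hL _ hz
    have h2 := real_inner_le_norm (G (a + t • d) - G a) d
    have h3 : ‖a + t • d - a‖ = t * ‖d‖ := by
      rw [add_sub_cancel_left, norm_smul, Real.norm_of_nonneg ht.1.le]
    rw [h3] at h1
    nlinarith [norm_nonneg d, mul_le_mul_of_nonneg_right h1 (norm_nonneg d)]
  have := hanti (Set.left_mem_Icc.2 zero_le_one) (Set.right_mem_Icc.2 zero_le_one) zero_le_one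
  simp only [q, one_smul, zero_smul, add_zero, hd, add_sub_cancel] at this
  rw [hd]
  linarith

theorem hasGradientAt_neg {F : V → ℝ} {g a : V} (h : HasGradientAt F g a) :
    HasGradientAt (fun z => -F z) (-g) a := by
  rw [hasGradientAt_iff_hasFDerivAt] at h ⊢
  rw [map_neg]
  exact h.neg

theorem ge_of_lipschitz_gradient {F : V → ℝ} {G : V → V} (hF : ∀ z, HasGradientAt F (G z) z)
    {a b : V} {L : ℝ} (hL : ∀ z ∈ segment ℝ a b, ‖G z - G a‖ ≤ L * ‖z - a‖) :
    F a + ⟪G a, b - a⟫ - L / 2 * ‖b - a‖ ^ 2 ≤ F b := by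
  have := le_of_lipschitz_gradient (F := fun z => -F z) (G := fun z => -G z) (L := L) (a := a)
    (b := b) (fun z => hasGradientAt_neg (hF z)) (fun z hz => by
      rw [← neg_sub', norm_neg]; exact hL z hz)
  simp only [inner_neg_left] at this
  linarith

theorem strongConcaveOn_le_tangent {U : Set V} {η : ℝ} {F : V → ℝ} (hs : StrongConcaveOn U η F)
    {u v g : V} (hu : u ∈ U) (hv : v ∈ U) (hF : HasGradientAt F g u) :
    F v ≤ F u + ⟪g, v - u⟫ - η / 2 * ‖v - u‖ ^ 2 := by
  have key : F v - F u + η / 2 * ‖v - u‖ ^ 2 ≤ ⟪g, v - u⟫ := by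
    refine le_inner_of_forall_increment hF (B := η / 2 * ‖v - u‖ ^ 2) fun t ht ht1 => ?_
    have h := hs.2 hu hv (sub_nonneg.2 ht1) ht.le (by ring)
    have e : (1 - t) • u + t • v = u + t • (v - u) := by module
    rw [e, norm_sub_rev u v] at h
    simp only [smul_eq_mul] at h
    nlinarith
  linarith

theorem inner_nonpos_of_isMax {U : Set V} (hU : Convex ℝ U) {F : V → ℝ} {us v g : V} (hu : us ∈ U)
    (hv : v ∈ U) (hmax : ∀ u ∈ U, F u ≤ F us) (hF : HasGradientAt F g us) : ⟪g, v - us⟫ ≤ 0 := by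
  have := le_inner_of_forall_increment (hasGradientAt_neg hF) (A := 0) (B := 0) (d := v - us)
    fun t ht ht1 => by
      have hm : us + t • (v - us) ∈ U := by
        have := hU hu hv (a := 1 - t) (b := t) (by linarith) ht.le (by ring)
        convert this using 1; module
      have := hmax _ hm
      simp only [mul_zero, sub_zero]; linarith
  rw [inner_neg_left] at this; linarith

end Calculus

/-! ### The Euclidean projection -/

section Projection

variable {m : ℕ} {U : Set (E m)}

theorem proj_spec (hne : U.Nonempty) (hcl : IsClosed U) (z : E m) :
    proj U z ∈ U ∧ ∀ q ∈ U, dist z (proj U z) ≤ dist z q := by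
  unfold proj
  apply Classical.epsilon_spec (p := fun p => p ∈ U ∧ ∀ q ∈ U, dist z p ≤ dist z q)
  obtain ⟨p, hp, hd⟩ := hcl.exists_infDist_eq_dist hne z
  exact ⟨p, hp, fun q hq => hd ▸ Metric.infDist_le_dist_of_mem hq⟩

theorem proj_univ (z : E m) : proj Set.univ z = z := by
  have := (proj_spec Set.univ_nonempty isClosed_univ z).2 z trivial
  rw [dist_self] at this
  exact (dist_le_zero.1 this).symm

theorem inner_proj_le_zero (hne : U.Nonempty) (hcl : IsClosed U) (hc : Convex ℝ U) (z : E m)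
    {v : E m} (hv : v ∈ U) : ⟪z - proj U z, v - proj U z⟫ ≤ 0 := by
  obtain ⟨hp, hmin⟩ := proj_spec hne hcl z
  set p := proj U z
  by_contra! hpos
  -- moving from `p` towards `v` by a small fraction `t` would come closer to `z`
  set A := ⟪z - p, v - p⟫
  set D := ‖v - p‖ ^ 2
  have hD : 0 ≤ D := sq_nonneg _
  set t := min 1 (A / (D + 1))
  have ht0 : 0 < t := lt_min one_pos (by positivity)
  have ht1 : t ≤ 1 := min_le_left _ _
  have ht2 : t * (D + 1) ≤ A := by
    rw [← le_div_iff₀ (by positivity)]; exact min_le_right _ _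
  have hm : p + t • (v - p) ∈ U := by
    have := hc hp hv (a := 1 - t) (b := t) (by linarith) ht0.le (by ring)
    convert this using 1; module
  have h := hmin _ hm
  rw [dist_eq_norm, dist_eq_norm] at h
  have h2 : ‖z - p‖ ^ 2 ≤ ‖z - (p + t • (v - p))‖ ^ 2 := by gcongr
  rw [show z - (p + t • (v - p)) = (z - p) - t • (v - p) by abel, norm_sub_sq_real (z - p),
    inner_smul_right, norm_smul, Real.norm_of_nonneg ht0.le, mul_pow] at h2
  change _ ≤ _ - 2 * (t * A) + t ^ 2 * D at h2
  nlinarith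

end Projection

/-! ### The value function -/

/-- The optimality gap `max_{u' ∈ U} h (x, u') - h (x, u)` of the inner maximization problem. -/
noncomputable def gap {n m : ℕ} (h : E n → E m → ℝ) (U : Set (E m)) (x : E n) (u : E m) : ℝ :=
  maxValue h U x - h x u

theorem maxValue_eq {n m : ℕ} {h : E n → E m → ℝ} {U : Set (E m)} {x : E n} {us : E m}
    (hus : us ∈ U) (hmax : ∀ u ∈ U, h x u ≤ h x us) : maxValue h U x = h x us :=
  IsGreatest.csSup_eq ⟨⟨us, hus, rfl⟩, by rintro _ ⟨u, hu, rfl⟩; exact hmax u hu⟩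

namespace CouplingAssumption

variable {n m : ℕ} {h : E n → E m → ℝ} {U : Set (E m)} {Lxx Lxu Luu C η c : ℝ}

theorem hasGradientAt_gradX (A : CouplingAssumption h U Lxx Lxu Luu C η c) (x : E n) (u : E m) :
    HasGradientAt (fun x' => h x' u) (gradX h x u) x := by
  apply DifferentiableAt.hasGradientAt
  have : ContDiff ℝ 1 (fun x' => h x' u) :=
    A.contDiff.comp (contDiff_id.prodMk contDiff_const)
  exact this.differentiable one_ne_zero x

theorem contDiff_right (A : CouplingAssumption h U Lxx Lxu Luu C η c) (x : E n) :
    ContDiff ℝ 1 (h x) :=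
  A.contDiff.comp (contDiff_const.prodMk contDiff_id)

theorem hasGradientAt_gradU (A : CouplingAssumption h U Lxx Lxu Luu C η c) (x : E n) (u : E m) :
    HasGradientAt (h x) (gradU h x u) u :=
  ((A.contDiff_right x).differentiable one_ne_zero u).hasGradientAt

theorem le_add_inner_gradX (A : CouplingAssumption h U Lxx Lxu Luu C η c) (x x' : E n) {u : E m}
    (hu : u ∈ U) : h x' u ≤ h x u + ⟪gradX h x u, x' - x⟫ + Lxx / 2 * ‖x' - x‖ ^ 2 :=
  le_of_lipschitz_gradient (fun z => A.hasGradientAt_gradX z u) fun z _ => by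
    simpa using A.lipschitz_gradX z x u hu u hu

theorem add_inner_gradX_le (A : CouplingAssumption h U Lxx Lxu Luu C η c) (x x' : E n) {u : E m}
    (hu : u ∈ U) : h x u + ⟪gradX h x u, x' - x⟫ - Lxx / 2 * ‖x' - x‖ ^ 2 ≤ h x' u :=
  ge_of_lipschitz_gradient (fun z => A.hasGradientAt_gradX z u) fun z _ => by
    simpa using A.lipschitz_gradX z x u hu u hu

theorem add_inner_gradU_le (A : CouplingAssumption h U Lxx Lxu Luu C η c) (x : E n) {u v : E m}
    (hu : u ∈ U) (hv : v ∈ U) {s : ℝ} (hs : 0 < s) (hsL : s * Luu ≤ 1) :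
    h x u + ⟪gradU h x u, v - u⟫ - 1 / (2 * s) * ‖v - u‖ ^ 2 ≤ h x v := by
  have h1 := ge_of_lipschitz_gradient (a := u) (b := v) (L := Luu)
    (fun z => A.hasGradientAt_gradU x z) fun z hz => by
      simpa using A.lipschitz_gradU x x z (A.convex.segment_subset hu hv hz) u hu
  have h2 : Luu / 2 ≤ 1 / (2 * s) := by
    rw [le_div_iff₀ (by positivity)]; linarith
  nlinarith [mul_le_mul_of_nonneg_right h2 (sq_nonneg ‖v - u‖)]

theorem exists_isMax (A : CouplingAssumption h U Lxx Lxu Luu C η c) (x : E n) :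
    ∃ us ∈ U, ∀ u ∈ U, h x u ≤ h x us := by
  rcases A.concave_or_PL x with hs | ⟨hU, us, hus, -⟩
  · obtain ⟨u₀, hu₀⟩ := A.nonempty
    set g := gradU h x u₀
    -- outside a large ball the quadratic term of strong concavity dominates
    set R := 2 * ‖g‖ / η
    have hR : 0 ≤ R := by have := A.η_pos; positivity
    have hK : IsCompact (Metric.closedBall u₀ R ∩ U) :=
      (isCompact_closedBall u₀ R).inter_right A.isClosed
    obtain ⟨us, ⟨-, husU⟩, hmax⟩ := hK.exists_isMaxOn ⟨u₀, by simp [hR], hu₀⟩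
      (A.contDiff_right x).continuous.continuousOn
    refine ⟨us, husU, fun u hu => ?_⟩
    by_cases hb : u ∈ Metric.closedBall u₀ R
    · exact hmax ⟨hb, hu⟩
    · have h0 : h x u₀ ≤ h x us := hmax ⟨by simp [hR], hu₀⟩
      have h1 := strongConcaveOn_le_tangent hs hu₀ hu (A.hasGradientAt_gradU x u₀)
      rw [Metric.mem_closedBall, dist_eq_norm, not_le, div_lt_iff₀ A.η_pos] at hb
      have h2 := real_inner_le_norm g (u - u₀)
      nlinarith [norm_nonneg (u - u₀), mul_le_mul_of_nonneg_right hb.le (norm_nonneg (u - u₀))]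
  · exact ⟨us, hU ▸ trivial, fun u _ => hus u⟩

theorem isGreatest_maxValue (A : CouplingAssumption h U Lxx Lxu Luu C η c) (x : E n) :
    IsGreatest (h x '' U) (maxValue h U x) := by
  obtain ⟨us, hus, hmax⟩ := A.exists_isMax x
  rw [maxValue_eq hus hmax]
  exact ⟨⟨us, hus, rfl⟩, by rintro _ ⟨u, hu, rfl⟩; exact hmax u hu⟩

theorem gap_nonneg (A : CouplingAssumption h U Lxx Lxu Luu C η c) (x : E n) {u : E m}
    (hu : u ∈ U) : 0 ≤ gap h U x u :=
  sub_nonneg.2 ((A.isGreatest_maxValue x).2 ⟨u, hu, rfl⟩)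

theorem gap_ascent_le (A : CouplingAssumption h U Lxx Lxu Luu C η c) (hU : U = Set.univ) (x : E n)
    (u : E m) {s : ℝ} (hs : 0 < s) (hsL : s * Luu ≤ 1) :
    gap h U x (u + s • gradU h x u) ≤ gap h U x u - s / 2 * ‖gradU h x u‖ ^ 2 := by
  have h1 := A.add_inner_gradU_le x (u := u) (v := u + s • gradU h x u) (hU ▸ trivial)
    (hU ▸ trivial) hs hsL
  rw [add_sub_cancel_left, inner_smul_right, real_inner_self_eq_norm_sq, norm_smul,
    Real.norm_of_nonneg hs.le, mul_pow] at h1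
  have h2 : 1 / (2 * s) * (s ^ 2 * ‖gradU h x u‖ ^ 2) = s / 2 * ‖gradU h x u‖ ^ 2 := by
    field_simp
  unfold gap
  linarith

theorem PL_ineq (hU : U = Set.univ) {x : E n} (hPL : IsPL c (h x)) (u : E m) :
    c * √(gap h U x u) ≤ ‖gradU h x u‖ := by
  obtain ⟨us, hus, hi⟩ := hPL
  have : maxValue h U x = h x us := maxValue_eq (hU ▸ trivial) fun u _ => hus u
  unfold gap
  rw [this]
  exact hi u

/-- Quadratic growth from the Polyak-Łojasiewicz inequality: the gradient ascent path started at
`u` has length at most `(4 / c) √(gap u)` and ends at a maximizer. -/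
theorem exists_isMax_near_of_PL (A : CouplingAssumption h U Lxx Lxu Luu C η c)
    (hU : U = Set.univ) {x : E n} (hPL : IsPL c (h x)) (u : E m) :
    ∃ us ∈ U, (∀ v ∈ U, h x v ≤ h x us) ∧ ‖u - us‖ ≤ 4 / c * √(gap h U x u) := by
  have hmem : ∀ v : E m, v ∈ U := fun v => hU ▸ trivial
  have hc := A.c_pos
  have hL := A.Luu_nonneg
  set s := 1 / (Luu + 1) with hsdef
  have hs : 0 < s := by positivity
  have hsL : s * Luu ≤ 1 := by
    rw [hsdef, div_mul_eq_mul_div, div_le_one (by positivity)]; linarith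
  let p : ℕ → E m := fun k => (fun v => v + s • gradU h x v)^[k] u
  have hp : ∀ k, p (k + 1) = p k + s • gradU h x (p k) := fun k =>
    Function.iterate_succ_apply' _ _ _
  let a : ℕ → ℝ := fun k => √(gap h U x (p k))
  have ha : ∀ k, 0 ≤ a k := fun k => Real.sqrt_nonneg _
  have hasq : ∀ k, a k ^ 2 = gap h U x (p k) := fun k => Real.sq_sqrt (A.gap_nonneg x (hmem _))
  have hstep : ∀ k, ‖p k - p (k + 1)‖ ≤ 4 / c * (a k - a (k + 1)) := by
    intro k
    set N := ‖gradU h x (p k)‖ with hN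
    have hd := A.gap_ascent_le hU x (p k) hs hsL
    rw [← hp, ← hasq, ← hasq, ← hN] at hd
    have hpl : c * a k ≤ N := PL_ineq hU hPL (p k)
    have hN0 : 0 ≤ N := norm_nonneg _
    have e : ‖p k - p (k + 1)‖ = s * N := by
      rw [hp, sub_add_cancel_left, norm_neg, norm_smul, Real.norm_of_nonneg hs.le]
    have hle : a (k + 1) ≤ a k := by
      refine abs_le_of_sq_le_sq' ?_ (ha k) |>.2
      nlinarith [mul_nonneg hs.le (sq_nonneg N)]
    rw [e, div_mul_eq_mul_div 4 c, le_div_iff₀ hc]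
    rcases hN0.eq_or_lt with h0 | h0
    · rw [← h0]; nlinarith
    · have h1 : (a k - a (k + 1)) * (a k + a (k + 1)) * c ≤ (a k - a (k + 1)) * (2 * N) := by
        rw [mul_assoc]
        exact mul_le_mul_of_nonneg_left (by nlinarith) (by linarith)
      have h2 : s / 2 * N ^ 2 * c ≤ (a k - a (k + 1)) * (a k + a (k + 1)) * c :=
        mul_le_mul_of_nonneg_right (by nlinarith) hc.le
      have h3 : N * (s * N * c) ≤ N * (4 * (a k - a (k + 1))) := by nlinarith
      exact le_of_mul_le_mul_left h3 h0
  have htel : ∀ K, ∑ k ∈ Finset.range K, 4 / c * (a k - a (k + 1)) ≤ 4 / c * a 0 := by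
    intro K
    rw [← Finset.mul_sum, Finset.sum_range_sub']
    exact mul_le_mul_of_nonneg_left (by linarith [ha K]) (by positivity)
  have hnn : ∀ k, 0 ≤ 4 / c * (a k - a (k + 1)) := fun k => (norm_nonneg _).trans (hstep k)
  have hsum : Summable fun k => 4 / c * (a k - a (k + 1)) :=
    summable_of_sum_range_le hnn htel
  have hdist : ∀ k, dist (p k) (p k.succ) ≤ 4 / c * (a k - a (k + 1)) := fun k => by
    rw [dist_eq_norm]; exact hstep k
  obtain ⟨us, hus⟩ := cauchySeq_tendsto_of_complete (cauchySeq_of_dist_le_of_summable _ hdist hsum)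
  refine ⟨us, hmem _, ?_, ?_⟩
  · -- the gradients tend to `0` along the path, so `us` is critical, hence maximal by PL
    have hcont : Continuous fun v => gradU h x v := by
      have hlip : ∀ v v' : E m, ‖gradU h x v - gradU h x v'‖ ≤ Luu * ‖v - v'‖ := fun v v' => by
        simpa using A.lipschitz_gradU x x v (hmem _) v' (hmem _)
      refine (LipschitzWith.of_dist_le_mul (K := ⟨Luu, hL⟩) fun v v' => ?_).continuous
      rw [dist_eq_norm, dist_eq_norm]; exact hlip v v'
    have h1 : Filter.Tendsto (fun k => p (k + 1) - p k) Filter.atTop (nhds (s • gradU h x us)) := by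
      have : (fun k => p (k + 1) - p k) = fun k => s • gradU h x (p k) := by
        ext1 k; rw [hp, add_sub_cancel_left]
      rw [this]
      exact ((hcont.tendsto us).comp hus).const_smul s
    have h2 : Filter.Tendsto (fun k => p (k + 1) - p k) Filter.atTop (nhds 0) := by
      simpa using (hus.comp (Filter.tendsto_add_atTop_nat 1)).sub hus
    have h3 : s • gradU h x us = 0 := tendsto_nhds_unique h1 h2
    have h4 : gradU h x us = 0 := (smul_eq_zero.1 h3).resolve_left hs.ne'
    have h5 := PL_ineq hU hPL us
    rw [h4, norm_zero] at h5
    have h6 : √(gap h U x us) ≤ 0 := by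
      by_contra! h'; nlinarith
    have h7 : gap h U x us ≤ 0 := Real.sqrt_eq_zero'.1 (le_antisymm h6 (Real.sqrt_nonneg _))
    intro v hv
    have := A.gap_nonneg x hv
    unfold gap at this h7
    linarith
  · have := dist_le_tsum_of_dist_le_of_tendsto₀ _ hdist hsum hus
    rw [dist_eq_norm] at this
    exact this.trans (hsum.tsum_le_of_sum_range_le htel)

/-- Quadratic growth of the inner problem around its solution set. -/
theorem exists_isMax_near (A : CouplingAssumption h U Lxx Lxu Luu C η c) (x : E n) {u : E m}
    (hu : u ∈ U) : ∃ us ∈ U, (∀ v ∈ U, h x v ≤ h x us) ∧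
      ‖u - us‖ ≤ (4 / c + √(2 / η)) * √(gap h U x u) := by
  have hc := A.c_pos
  have hη := A.η_pos
  rcases A.concave_or_PL x with hs | ⟨hU, hPL⟩
  · obtain ⟨us, hus, hmax⟩ := A.exists_isMax x
    refine ⟨us, hus, hmax, ?_⟩
    have h1 := strongConcaveOn_le_tangent hs hus hu (A.hasGradientAt_gradU x us)
    have h2 := inner_nonpos_of_isMax A.convex hus hu hmax (A.hasGradientAt_gradU x us)
    have h3 : ‖u - us‖ ^ 2 ≤ 2 / η * gap h U x u := by
      rw [gap, maxValue_eq hus hmax, div_mul_eq_mul_div, le_div_iff₀ hη]; linarith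
    have h4 := Real.le_sqrt_of_sq_le h3
    rw [Real.sqrt_mul (by positivity)] at h4
    refine h4.trans (mul_le_mul_of_nonneg_right ?_ (Real.sqrt_nonneg _))
    have : 0 < 4 / c := by positivity
    linarith
  · obtain ⟨us, hus, hmax, hd⟩ := A.exists_isMax_near_of_PL hU hPL u
    refine ⟨us, hus, hmax, hd.trans (mul_le_mul_of_nonneg_right ?_ (Real.sqrt_nonneg _))⟩
    have := Real.sqrt_nonneg (2 / η)
    linarith

/-- A maximizer at `x` is nearly optimal at nearby points. -/
theorem sqrt_gap_le_of_isMax (A : CouplingAssumption h U Lxx Lxu Luu C η c) {x : E n} (x' : E n)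
    {us : E m} (hus : us ∈ U) (hmax : ∀ v ∈ U, h x v ≤ h x us) :
    √(gap h U x' us) ≤ Lxu * (1 / c + √(1 / (2 * η))) * ‖x' - x‖ := by
  have hc := A.c_pos
  have hη := A.η_pos
  have hL := A.Lxu_pos
  have hlip := A.lipschitz_gradU x' x us hus us hus
  rw [sub_self, norm_zero, mul_zero, add_zero] at hlip
  have hn := norm_nonneg (x' - x)
  rcases A.concave_or_PL x' with hs | ⟨hU, hPL⟩
  · obtain ⟨u', hu', hmax'⟩ := A.exists_isMax x'
    have h1 := strongConcaveOn_le_tangent hs hus hu' (A.hasGradientAt_gradU x' us)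
    have h2 := inner_nonpos_of_isMax A.convex hus hu' hmax (A.hasGradientAt_gradU x us)
    have h3 := real_inner_le_norm (gradU h x' us - gradU h x us) (u' - us)
    rw [inner_sub_left] at h3
    have h4 := mul_le_mul_of_nonneg_right hlip (norm_nonneg (u' - us))
    have hsq : √(1 / (2 * η)) ^ 2 = 1 / (2 * η) := Real.sq_sqrt (by positivity)
    have h5 : gap h U x' us ≤ (Lxu * √(1 / (2 * η)) * ‖x' - x‖) ^ 2 := by
      rw [gap, maxValue_eq hu' hmax', mul_pow, mul_pow, hsq]
      have : Lxu ^ 2 * (1 / (2 * η)) * ‖x' - x‖ ^ 2 = (Lxu * ‖x' - x‖) ^ 2 / (2 * η) := by ring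
      rw [this, le_div_iff₀ (by positivity)]
      nlinarith [sq_nonneg (Lxu * ‖x' - x‖ - η * ‖u' - us‖)]
    have h6 := Real.sqrt_le_sqrt h5
    rw [Real.sqrt_sq (by positivity)] at h6
    refine h6.trans (mul_le_mul_of_nonneg_right (mul_le_mul_of_nonneg_left ?_ hL.le) hn)
    have : 0 < 1 / c := by positivity
    linarith
  · have h0 : gradU h x us = 0 := by
      have := inner_nonpos_of_isMax A.convex hus (v := us + gradU h x us) (hU ▸ trivial) hmax
        (A.hasGradientAt_gradU x us)
      rw [add_sub_cancel_left, real_inner_self_eq_norm_sq] at this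
      exact norm_eq_zero.1 (pow_eq_zero_iff two_ne_zero |>.1 (le_antisymm this (sq_nonneg _)))
    rw [h0, sub_zero] at hlip
    have h1 := (PL_ineq hU hPL us).trans hlip
    have h2 : √(gap h U x' us) ≤ Lxu * (1 / c) * ‖x' - x‖ := by
      rw [mul_one_div, div_mul_eq_mul_div, le_div_iff₀ hc]; linarith
    refine h2.trans (mul_le_mul_of_nonneg_right (mul_le_mul_of_nonneg_left ?_ hL.le) hn)
    have := Real.sqrt_nonneg (1 / (2 * η))
    linarith

/-- The maximizers depend on `x` in a Lipschitz way. -/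
theorem exists_lipschitz_argmax (A : CouplingAssumption h U Lxx Lxu Luu C η c) :
    ∃ K > 0, ∀ (x x' : E n) (us : E m), us ∈ U → (∀ v ∈ U, h x v ≤ h x us) →
      ∃ us' ∈ U, (∀ v ∈ U, h x' v ≤ h x' us') ∧ ‖us' - us‖ ≤ K * ‖x' - x‖ := by
  have hc := A.c_pos
  have hη := A.η_pos
  have hL := A.Lxu_pos
  refine ⟨(4 / c + √(2 / η)) * (Lxu * (1 / c + √(1 / (2 * η)))), by positivity, ?_⟩
  intro x x' us hus hmax
  obtain ⟨us', hus', hmax', hd⟩ := A.exists_isMax_near x' hus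
  refine ⟨us', hus', hmax', ?_⟩
  rw [norm_sub_rev, mul_assoc]
  exact hd.trans (mul_le_mul_of_nonneg_left (A.sqrt_gap_le_of_isMax x' hus hmax) (by positivity))

/-- Danskin's formula: the gradient of the value function is the partial gradient at any
maximizer. -/
theorem hasGradientAt_maxValue (A : CouplingAssumption h U Lxx Lxu Luu C η c) {x : E n} {us : E m}
    (hus : us ∈ U) (hmax : ∀ v ∈ U, h x v ≤ h x us) :
    HasGradientAt (maxValue h U) (gradX h x us) x := by
  obtain ⟨K, hK, hlip⟩ := A.exists_lipschitz_argmax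
  have hL := A.Lxu_pos
  have hLx := A.Lxx_nonneg
  have key : ∀ x' : E n, |maxValue h U x' - maxValue h U x - ⟪gradX h x us, x' - x⟫| ≤
      (Lxx / 2 + Lxu * K) * ‖x' - x‖ ^ 2 := by
    intro x'
    obtain ⟨u', hu', hmax', hd⟩ := hlip x x' us hus hmax
    have hn := norm_nonneg (x' - x)
    have h1 := A.add_inner_gradX_le x x' hus
    have h2 := A.le_add_inner_gradX x x' hu'
    have h3 := hmax u' hu'
    have h4 := hmax' us hus
    have h5 := A.lipschitz_gradX x x u' hu' us hus
    rw [sub_self, norm_zero, mul_zero, zero_add] at h5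
    have h6 := real_inner_le_norm (gradX h x u' - gradX h x us) (x' - x)
    rw [inner_sub_left] at h6
    have h7 : ‖gradX h x u' - gradX h x us‖ * ‖x' - x‖ ≤ Lxu * (K * ‖x' - x‖) * ‖x' - x‖ :=
      mul_le_mul_of_nonneg_right (h5.trans (mul_le_mul_of_nonneg_left hd hL.le)) hn
    have h8 : 0 ≤ Lxu * K * ‖x' - x‖ ^ 2 := by positivity
    rw [maxValue_eq hus hmax, maxValue_eq hu' hmax', abs_le]
    constructor <;> nlinarith
  rw [hasGradientAt_iff_hasFDerivAt]
  refine .of_isLittleO ?_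
  refine Asymptotics.IsBigO.trans_isLittleO ?_ (Asymptotics.isLittleO_pow_sub_sub x one_lt_two)
  refine Asymptotics.IsBigO.of_bound (Lxx / 2 + Lxu * K) (Filter.Eventually.of_forall fun x' => ?_)
  simpa using key x'

end CouplingAssumption

/-- What the outer analysis uses about the value function of a coupling function: it is
differentiable with an `L`-Lipschitz gradient, and the error of the partial gradient at an
approximate maximizer, as well as the change of the optimality gap with `x`, are controlled by the
square root of the gap. -/
structure ValueRegularity {n m : ℕ} (h : E n → E m → ℝ) (U : Set (E m)) (L : ℝ) : Prop where
  L_pos : 0 < L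
  gap_nonneg : ∀ x, ∀ u ∈ U, 0 ≤ gap h U x u
  hasGradientAt : ∀ x, HasGradientAt (maxValue h U) (gradient (maxValue h U) x) x
  lipschitz : ∀ x x', ‖gradient (maxValue h U) x - gradient (maxValue h U) x'‖ ≤ L * ‖x - x'‖
  gradient_error : ∀ x, ∀ u ∈ U, ‖gradient (maxValue h U) x - gradX h x u‖ ≤ L * √(gap h U x u)
  sqrt_gap_le : ∀ x x', ∀ u ∈ U, √(gap h U x' u) ≤ √(gap h U x u) + L * ‖x' - x‖

theorem CouplingAssumption.exists_valueRegularity {n m : ℕ} {h : E n → E m → ℝ} {U : Set (E m)}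
    {Lxx Lxu Luu C η c : ℝ} (A : CouplingAssumption h U Lxx Lxu Luu C η c) :
    ∃ L, ValueRegularity h U L := by
  obtain ⟨K, hK, hlip⟩ := A.exists_lipschitz_argmax
  have hL := A.Lxu_pos
  have hLx := A.Lxx_nonneg
  have hc := A.c_pos
  have hη := A.η_pos
  set κ := 4 / c + √(2 / η) with hκ
  have hκ0 : 0 < κ := by positivity
  set LF := Lxx + Lxu * K with hLF
  have hLF0 : 0 < LF := by positivity
  set L := Lxu * κ + LF + Lxx + 1 with hLdef
  have hgrad : ∀ {x us}, us ∈ U → (∀ v ∈ U, h x v ≤ h x us) →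
      gradient (maxValue h U) x = gradX h x us := fun hus hmax =>
    (A.hasGradientAt_maxValue hus hmax).gradient
  have hG : ∀ x, HasGradientAt (maxValue h U) (gradient (maxValue h U) x) x := fun x => by
    obtain ⟨us, hus, hmax⟩ := A.exists_isMax x
    rw [hgrad hus hmax]
    exact A.hasGradientAt_maxValue hus hmax
  have hlipF : ∀ x x', ‖gradient (maxValue h U) x - gradient (maxValue h U) x'‖ ≤
      LF * ‖x - x'‖ := fun x x' => by
    obtain ⟨us, hus, hmax⟩ := A.exists_isMax x'
    obtain ⟨us', hus', hmax', hd⟩ := hlip x' x us hus hmax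
    rw [hgrad hus hmax, hgrad hus' hmax']
    have := A.lipschitz_gradX x x' us' hus' us hus
    nlinarith [mul_le_mul_of_nonneg_left hd hL.le]
  have herr : ∀ x, ∀ u ∈ U, ‖gradient (maxValue h U) x - gradX h x u‖ ≤
      Lxu * κ * √(gap h U x u) := fun x u hu => by
    obtain ⟨us, hus, hmax, hd⟩ := A.exists_isMax_near x hu
    rw [hgrad hus hmax]
    have := A.lipschitz_gradX x x us hus u hu
    rw [sub_self, norm_zero, mul_zero, zero_add, norm_sub_rev us u] at this
    rw [mul_assoc]
    exact this.trans (mul_le_mul_of_nonneg_left hd hL.le)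
  have hLκ : 0 < Lxu * κ := by positivity
  refine ⟨L, by positivity, fun x u hu => A.gap_nonneg x hu, hG, fun x x' => ?_, fun x u hu => ?_,
    fun x x' u hu => ?_⟩
  · exact (hlipF x x').trans (mul_le_mul_of_nonneg_right (by linarith) (norm_nonneg _))
  · exact (herr x u hu).trans (mul_le_mul_of_nonneg_right (by linarith) (Real.sqrt_nonneg _))
  · -- `x ↦ gap x u` has a Lipschitz gradient of size `O(√gap)`
    have hr := Real.sqrt_nonneg (gap h U x u)
    have hsq := Real.sq_sqrt (A.gap_nonneg x hu)
    have hn := norm_nonneg (x' - x)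
    refine Real.sqrt_le_iff.2 ⟨by positivity, ?_⟩
    have h1 := le_of_lipschitz_gradient (a := x) (b := x') hG fun z _ => hlipF z x
    have h2 := A.add_inner_gradX_le x x' hu
    have h3 := (real_inner_le_norm (gradient (maxValue h U) x - gradX h x u) (x' - x)).trans
      (mul_le_mul_of_nonneg_right (herr x u hu) hn)
    rw [inner_sub_left] at h3
    have h4 : gap h U x' u ≤ gap h U x u + Lxu * κ * √(gap h U x u) * ‖x' - x‖ +
        (LF + Lxx) / 2 * ‖x' - x‖ ^ 2 := by
      unfold gap at h3 ⊢; linarith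
    have h5 : (LF + Lxx) / 2 * ‖x' - x‖ ^ 2 ≤ L ^ 2 * ‖x' - x‖ ^ 2 :=
      mul_le_mul_of_nonneg_right (by nlinarith) (sq_nonneg _)
    have h6 : Lxu * κ * (√(gap h U x u) * ‖x' - x‖) ≤ 2 * L * (√(gap h U x u) * ‖x' - x‖) :=
      mul_le_mul_of_nonneg_right (by linarith) (by positivity)
    nlinarith

namespace ValueRegularity

variable {n m : ℕ} {h : E n → E m → ℝ} {U : Set (E m)} {L : ℝ}

theorem contDiff (R : ValueRegularity h U L) : ContDiff ℝ 1 (maxValue h U) := by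
  rw [contDiff_one_iff_fderiv]
  refine ⟨fun x => (R.hasGradientAt x).differentiableAt, ?_⟩
  have hc : Continuous (gradient (maxValue h U)) :=
    (LipschitzWith.of_dist_le_mul (K := ⟨L, R.L_pos.le⟩) fun v v' => by
      rw [dist_eq_norm, dist_eq_norm]; exact R.lipschitz v v').continuous
  have : fderiv ℝ (maxValue h U) = fun x =>
      InnerProductSpace.toDual ℝ (E n) (gradient (maxValue h U) x) := by
    ext1 x
    exact (R.hasGradientAt x).hasFDerivAt.fderiv
  rw [this]
  exact (InnerProductSpace.toDual ℝ (E n)).continuous.comp hc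

theorem descent (R : ValueRegularity h U L) (x x' : E n) :
    maxValue h U x' ≤ maxValue h U x + ⟪gradient (maxValue h U) x, x' - x⟫ +
      L / 2 * ‖x' - x‖ ^ 2 :=
  le_of_lipschitz_gradient R.hasGradientAt fun z _ => R.lipschitz z x

end ValueRegularity

theorem CouplingAssumption.maxValue_le {n m : ℕ} {h : E n → E m → ℝ} {U : Set (E m)}
    {Lxx Lxu Luu C η c : ℝ} (A : CouplingAssumption h U Lxx Lxu Luu C η c) (x x' : E n) :
    maxValue h U x' ≤ maxValue h U x + C * ‖x' - x‖ := by
  obtain ⟨u', hu', hmax'⟩ := A.exists_isMax x'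
  have h1 : h x u' ≤ maxValue h U x := (A.isGreatest_maxValue x).2 ⟨u', hu', rfl⟩
  have h2 := Convex.norm_image_sub_le_of_norm_hasFDerivWithin_le (s := Set.univ)
    (fun z _ => (A.hasGradientAt_gradX z u').hasFDerivAt.hasFDerivWithinAt) (C := C)
    (fun z _ => by rw [LinearIsometryEquiv.norm_map]; exact A.bounded_gradX z u' hu')
    convex_univ (Set.mem_univ x) (Set.mem_univ x')
  have h3 := (le_abs_self _).trans h2
  rw [maxValue_eq hu' hmax']
  linarith

/-! ### Linear convergence of the inner solvers -/

namespace CouplingAssumption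

variable {n m : ℕ} {h : E n → E m → ℝ} {U : Set (E m)} {Lxx Lxu Luu C η c : ℝ}

theorem ascentStep_mem (A : CouplingAssumption h U Lxx Lxu Luu C η c) (s : ℝ) (x : E n) (u : E m) :
    ascentStep h U s x u ∈ U :=
  (proj_spec A.nonempty A.isClosed _).1

theorem le_ascentStep (A : CouplingAssumption h U Lxx Lxu Luu C η c) {s : ℝ} (hs : 0 < s)
    (hsL : s * Luu ≤ 1) (x : E n) {u v : E m} (hu : u ∈ U) (hv : v ∈ U) :
    h x u + ⟪gradU h x u, v - u⟫ - 1 / (2 * s) * ‖v - u‖ ^ 2 ≤ h x (ascentStep h U s x u) := by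
  have hm := A.ascentStep_mem s x u
  refine le_trans ?_ (A.add_inner_gradU_le x hu hm hs hsL)
  -- the projection maximizes the quadratic lower model over `U`
  have h1 := (proj_spec A.nonempty A.isClosed (u + s • gradU h x u)).2 v hv
  change dist _ (ascentStep h U s x u) ≤ _ at h1
  set p := ascentStep h U s x u
  set g := gradU h x u
  rw [dist_eq_norm, dist_eq_norm] at h1
  have h2 : ‖u + s • g - p‖ ^ 2 ≤ ‖u + s • g - v‖ ^ 2 := by gcongr
  rw [show u + s • g - p = s • g - (p - u) by abel, show u + s • g - v = s • g - (v - u) by abel,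
    norm_sub_sq_real (s • g), norm_sub_sq_real (s • g), real_inner_smul_left,
    real_inner_smul_left] at h2
  have h3 : 1 / (2 * s) * (‖p - u‖ ^ 2 - 2 * (s * ⟪g, p - u⟫)) ≤
      1 / (2 * s) * (‖v - u‖ ^ 2 - 2 * (s * ⟪g, v - u⟫)) :=
    mul_le_mul_of_nonneg_left (by linarith) (by positivity)
  have e : ∀ a b : ℝ, 1 / (2 * s) * (a - 2 * (s * b)) = 1 / (2 * s) * a - b := by
    intro a b; field_simp
  rw [e, e] at h3
  linarith

theorem gap_ascentStep_le (A : CouplingAssumption h U Lxx Lxu Luu C η c) {s t : ℝ} (hs : 0 < s)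
    (hsL : s * Luu ≤ 1) (ht0 : 0 < t) (ht1 : t ≤ 1) (htη : t ≤ η * s) (htc : t ≤ s * c ^ 2 / 2)
    (x : E n) {u : E m} (hu : u ∈ U) :
    gap h U x (ascentStep h U s x u) ≤ (1 - t) * gap h U x u := by
  have hη := A.η_pos
  rcases A.concave_or_PL x with hsc | ⟨hU, hPL⟩
  · obtain ⟨us, hus, hmax⟩ := A.exists_isMax x
    have hv : u + t • (us - u) ∈ U := by
      have := A.convex hu hus (sub_nonneg.2 ht1) ht0.le (by ring)
      convert this using 1; module
    have h1 := A.le_ascentStep hs hsL x hu hv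
    have h2 := strongConcaveOn_le_tangent hsc hu hus (A.hasGradientAt_gradU x u)
    rw [add_sub_cancel_left, inner_smul_right, norm_smul, Real.norm_of_nonneg ht0.le,
      mul_pow] at h1
    have h3 : 1 / (2 * s) * (t ^ 2 * ‖us - u‖ ^ 2) ≤ t * (η / 2 * ‖us - u‖ ^ 2) := by
      have : 1 / (2 * s) * t ≤ η / 2 := by
        rw [div_mul_eq_mul_div, one_mul, div_le_iff₀ (by positivity)]; linarith
      nlinarith [mul_le_mul_of_nonneg_right this (mul_nonneg ht0.le (sq_nonneg ‖us - u‖))]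
    have h4 := mul_le_mul_of_nonneg_left h2 ht0.le
    rw [gap, gap, maxValue_eq hus hmax]
    nlinarith
  · have e : ascentStep h U s x u = u + s • gradU h x u := by
      unfold ascentStep; rw [hU, proj_univ]
    rw [e]
    have h1 := A.gap_ascent_le hU x u hs hsL
    have h2 := PL_ineq hU hPL u
    have h3 := A.gap_nonneg x hu
    have hc := A.c_pos
    have h4 : c ^ 2 * gap h U x u ≤ ‖gradU h x u‖ ^ 2 := by
      have : (c * √(gap h U x u)) ^ 2 ≤ ‖gradU h x u‖ ^ 2 := by gcongr
      rwa [mul_pow, Real.sq_sqrt h3] at this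
    nlinarith [mul_le_mul_of_nonneg_right htc h3]

theorem accStep_mem (A : CouplingAssumption h U Lxx Lxu Luu C η c) {s : ℝ} (hηs : η * s ≤ 1)
    (x : E n) {p : E m × E m} (hp : p.1 ∈ U) :
    (accStep h U s η x p).1 ∈ U ∧ (accStep h U s η x p).2 ∈ U := by
  have hz : (accStep h U s η x p).2 ∈ U := (proj_spec A.nonempty A.isClosed _).1
  refine ⟨?_, hz⟩
  exact A.convex hp hz (sub_nonneg.2 (Real.sqrt_le_one.2 hηs)) (Real.sqrt_nonneg _) (by ring)

/-- The Lyapunov function `gap u + (η / 2) ‖z - us‖²` of the accelerated solver contracts by the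
factor `1 - √(η s)` in each step. -/
theorem accStep_lyapunov (A : CouplingAssumption h U Lxx Lxu Luu C η c) {s : ℝ} (hs : 0 < s)
    (hsL : s * Luu ≤ 1) (hηs : η * s ≤ 1) {x : E n} (hsc : StrongConcaveOn U η (h x))
    {us : E m} (hus : us ∈ U) {p : E m × E m} (hp1 : p.1 ∈ U) (hp2 : p.2 ∈ U) :
    h x us - h x (accStep h U s η x p).1 + η / 2 * ‖(accStep h U s η x p).2 - us‖ ^ 2 ≤
      (1 - √(η * s)) * (h x us - h x p.1 + η / 2 * ‖p.2 - us‖ ^ 2) := by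
  have hη := A.η_pos
  obtain ⟨u, z⟩ := p
  have hm := A.accStep_mem (s := s) hηs x (p := (u, z)) hp1
  set q := √(η * s) with hq
  have hq0 : 0 < q := Real.sqrt_pos.2 (by positivity)
  have hq1 : q ≤ 1 := Real.sqrt_le_one.2 hηs
  have hqsq : q ^ 2 = η * s := Real.sq_sqrt (by positivity)
  set v := (1 / (1 + q)) • (u + q • z) with hv
  set g := gradU h x v with hg
  set e := (1 - q) • z + q • v with he
  set z' := proj U (e + (q / η) • g) with hz'
  have e1 : (accStep h U s η x (u, z)).1 = (1 - q) • u + q • z' := rfl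
  have e2 : (accStep h U s η x (u, z)).2 = z' := rfl
  rw [e1] at hm ⊢
  rw [e2] at hm ⊢
  simp only at hp1 hp2 ⊢
  obtain ⟨hm1, hm2⟩ := hm
  have hvU : v ∈ U := by
    have := A.convex hp1 hp2 (a := 1 / (1 + q)) (b := q / (1 + q)) (by positivity) (by positivity)
      (by field_simp)
    convert this using 1
    rw [hv, smul_add, smul_smul, one_div_mul_eq_div]
  have hvq : u = (1 + q) • v - q • z := by
    rw [hv, smul_smul, mul_one_div_cancel (by positivity), one_smul, add_sub_cancel_right]
  have hu' : (1 - q) • u + q • z' - v = q • (z' - e) := by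
    rw [he, hvq]; module
  have h1 := A.add_inner_gradU_le x hvU hm1 hs hsL
  have h2 := strongConcaveOn_le_tangent hsc hvU hp1 (A.hasGradientAt_gradU x v)
  have h3 := strongConcaveOn_le_tangent hsc hvU hus (A.hasGradientAt_gradU x v)
  have h4 := inner_proj_le_zero A.nonempty A.isClosed A.convex (e + (q / η) • g) hus
  rw [← hz', show e + (q / η) • g - z' = (q / η) • g - (z' - e) by abel, inner_sub_left,
    real_inner_smul_left] at h4
  rw [← hg] at h1 h2 h3
  -- the quadratic error of the gradient step in terms of `z' - e`
  have h5 : 1 / (2 * s) * ‖(1 - q) • u + q • z' - v‖ ^ 2 = η / 2 * ‖z' - e‖ ^ 2 := by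
    rw [hu', norm_smul, Real.norm_of_nonneg hq0.le, mul_pow, hqsq]; field_simp
  have h6 : ⟪g, (1 - q) • u + q • z' - v⟫ =
      (1 - q) * ⟪g, u - v⟫ + q * ⟪g, us - v⟫ - q * ⟪g, us - z'⟫ := by
    rw [show (1 - q) • u + q • z' - v =
      (1 - q) • (u - v) + q • (us - v) - q • (us - z') by module, inner_sub_right, inner_add_right,
      inner_smul_right, inner_smul_right, inner_smul_right]
  have h7 : q * ⟪g, us - z'⟫ ≤ η * ⟪z' - e, us - z'⟫ := by
    have := mul_le_mul_of_nonneg_left h4 hη.le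
    rw [mul_sub, ← mul_assoc, mul_div_cancel₀ _ hη.ne'] at this
    linarith
  have h8 : ‖us - e‖ ^ 2 = ‖us - z'‖ ^ 2 + 2 * ⟪z' - e, us - z'⟫ + ‖z' - e‖ ^ 2 := by
    rw [show us - e = (us - z') + (z' - e) by abel, norm_add_sq_real, real_inner_comm]
  have h9 : ‖us - e‖ ^ 2 ≤ (1 - q) * ‖z - us‖ ^ 2 + q * ‖v - us‖ ^ 2 := by
    have hh : ‖us - e‖ ^ 2 = (1 - q) * ‖z - us‖ ^ 2 + q * ‖v - us‖ ^ 2 -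
        q * (1 - q) * ‖(z - us) - (v - us)‖ ^ 2 := by
      rw [show us - e = -((1 - q) • (z - us) + q • (v - us)) by rw [he]; module, norm_neg,
        norm_add_sq_real, norm_sub_sq_real (z - us) (v - us), norm_smul, norm_smul, real_inner_smul_left,
        inner_smul_right, Real.norm_of_nonneg hq0.le, Real.norm_of_nonneg (sub_nonneg.2 hq1)]
      ring
    have : 0 ≤ q * (1 - q) * ‖(z - us) - (v - us)‖ ^ 2 :=
      mul_nonneg (mul_nonneg hq0.le (sub_nonneg.2 hq1)) (sq_nonneg _)
    linarith
  have h10 : 0 ≤ (1 - q) * (η / 2 * ‖u - v‖ ^ 2) :=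
    mul_nonneg (sub_nonneg.2 hq1) (by positivity)
  have h11 := mul_le_mul_of_nonneg_left h2 (sub_nonneg.2 hq1)
  have h12 := mul_le_mul_of_nonneg_left h3 hq0.le
  have h13 := mul_le_mul_of_nonneg_left h9 (by positivity : 0 ≤ η / 2)
  rw [h5, h6] at h1
  rw [norm_sub_rev z' us]
  rw [norm_sub_rev us v] at h12
  nlinarith

/-- Both inner solvers stay feasible and converge linearly in the optimality gap. -/
theorem exists_linear_rate (A : CouplingAssumption h U Lxx Lxu Luu C η c) {a : AscentMethod}
    {s : ℝ} (ha : a.Admissible h U Luu η s) : ∃ ρ : ℝ, 0 < ρ ∧ ρ < 1 ∧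
      ∀ (N : ℕ) (x : E n), ∀ u ∈ U, a.run h U s η N x u ∈ U ∧
        gap h U x (a.run h U s η N x u) ≤ 2 * ρ ^ N * gap h U x u := by
  obtain ⟨hs, hsL, hacc⟩ := ha
  have hη := A.η_pos
  have hc := A.c_pos
  cases a with
  | plain =>
    set t := min (1 / 2) (min (η * s) (s * c ^ 2 / 2))
    have ht0 : 0 < t := by
      refine lt_min (by norm_num) (lt_min ?_ ?_) <;> positivity
    have ht1 : t ≤ 1 / 2 := min_le_left _ _
    have htη : t ≤ η * s := (min_le_right _ _).trans (min_le_left _ _)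
    have htc : t ≤ s * c ^ 2 / 2 := (min_le_right _ _).trans (min_le_right _ _)
    refine ⟨1 - t, by linarith, by linarith, fun N x u hu => ?_⟩
    have key : (ascentStep h U s x)^[N] u ∈ U ∧
        gap h U x ((ascentStep h U s x)^[N] u) ≤ (1 - t) ^ N * gap h U x u := by
      induction N with
      | zero => simpa using hu
      | succ N ih =>
        rw [Function.iterate_succ_apply']
        refine ⟨A.ascentStep_mem s x _, ?_⟩
        refine (A.gap_ascentStep_le hs hsL ht0 (by linarith) htη htc x ih.1).trans ?_
        rw [pow_succ']
        nlinarith [mul_le_mul_of_nonneg_left ih.2 (by linarith : 0 ≤ 1 - t)]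
    refine ⟨key.1, key.2.trans ?_⟩
    have : 0 ≤ (1 - t) ^ N * gap h U x u :=
      mul_nonneg (pow_nonneg (by linarith) _) (A.gap_nonneg x hu)
    linarith
  | accelerated =>
    obtain ⟨hsc, hηs⟩ := hacc rfl
    set q := √(η * s) with hq
    have hq0 : 0 < q := Real.sqrt_pos.2 (by positivity)
    have hq1 : q ≤ 1 := Real.sqrt_le_one.2 hηs
    refine ⟨1 - q / 2, by linarith, by linarith, fun N x u hu => ?_⟩
    obtain ⟨us, hus, hmax⟩ := A.exists_isMax x
    have key : ((accStep h U s η x)^[N] (u, u)).1 ∈ U ∧ ((accStep h U s η x)^[N] (u, u)).2 ∈ U ∧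
        h x us - h x ((accStep h U s η x)^[N] (u, u)).1 +
          η / 2 * ‖((accStep h U s η x)^[N] (u, u)).2 - us‖ ^ 2 ≤
          (1 - q / 2) ^ N * (h x us - h x u + η / 2 * ‖u - us‖ ^ 2) := by
      induction N with
      | zero => simpa using hu
      | succ N ih =>
        rw [Function.iterate_succ_apply']
        obtain ⟨i1, i2, i3⟩ := ih
        obtain ⟨j1, j2⟩ := A.accStep_mem (s := s) hηs x i1
        refine ⟨j1, j2, (A.accStep_lyapunov hs hsL hηs (hsc x) hus i1 i2).trans ?_⟩
        have hnn : 0 ≤ h x us - h x ((accStep h U s η x)^[N] (u, u)).1 +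
            η / 2 * ‖((accStep h U s η x)^[N] (u, u)).2 - us‖ ^ 2 :=
          add_nonneg (sub_nonneg.2 (hmax _ i1)) (by positivity)
        rw [pow_succ' (1 - q / 2), mul_assoc]
        exact (mul_le_mul_of_nonneg_right (by linarith) hnn).trans
          (mul_le_mul_of_nonneg_left i3 (by linarith))
    obtain ⟨k1, -, k3⟩ := key
    refine ⟨k1, ?_⟩
    have h1 := strongConcaveOn_le_tangent (hsc x) hus hu (A.hasGradientAt_gradU x us)
    have h2 := inner_nonpos_of_isMax A.convex hus hu hmax (A.hasGradientAt_gradU x us)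
    rw [gap, gap, maxValue_eq hus hmax]
    have h3 : 0 ≤ η / 2 * ‖((accStep h U s η x)^[N] (u, u)).2 - us‖ ^ 2 := by positivity
    have h4 : (1 - q / 2) ^ N * (h x us - h x u + η / 2 * ‖u - us‖ ^ 2) ≤
        (1 - q / 2) ^ N * (2 * (h x us - h x u)) :=
      mul_le_mul_of_nonneg_left (by linarith) (pow_nonneg (by linarith) _)
    change h x us - h x ((accStep h U s η x)^[N] (u, u)).1 ≤ _
    linarith

end CouplingAssumption

/-! ### The multiplier and the search direction -/

section Direction

variable {n m l : ℕ} {φ : E n → E m → ℝ} {ψ : E n → E l → ℝ} {a : ℝ} {x : E n} {y : E m} {w : E l}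

theorem multiplier_of_zeta_nonpos (h : ¬ 0 < zeta ψ x w) : multiplier φ ψ a x y w = 0 := by
  unfold multiplier; rw [if_neg h]

theorem multiplier_nonneg : 0 ≤ multiplier φ ψ a x y w := by
  unfold multiplier; split_ifs
  · exact mul_nonneg (by positivity) (le_max_right _ _)
  · exact le_rfl

theorem norm_gradX_pos_of_zeta_pos (h : 0 < zeta ψ x w) : 0 < ‖gradX ψ x w‖ := by
  rcases (norm_nonneg (gradX ψ x w)).eq_or_lt with h0 | h0
  · rw [zeta, ← h0, mul_zero] at h; exact absurd h (lt_irrefl _)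
  · exact h0

theorem multiplier_mul_norm_sq (h : 0 < zeta ψ x w) :
    multiplier φ ψ a x y w * ‖gradX ψ x w‖ ^ 2 =
      max (-⟪gradX ψ x w, gradX φ x y⟫ + a * ‖gradX ψ x w‖) 0 := by
  have := norm_gradX_pos_of_zeta_pos h
  unfold multiplier; rw [if_pos h]; field_simp

theorem multiplier_mul_norm_le (ha : 0 ≤ a) :
    multiplier φ ψ a x y w * ‖gradX ψ x w‖ ≤ ‖gradX φ x y‖ + a := by
  by_cases h : 0 < zeta ψ x w
  · have hq := norm_gradX_pos_of_zeta_pos h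
    refine le_of_mul_le_mul_right ?_ hq
    rw [mul_assoc, ← sq, multiplier_mul_norm_sq h]
    have := neg_le_of_abs_le (abs_real_inner_le_norm (gradX ψ x w) (gradX φ x y))
    exact max_le (by linarith) (by positivity)
  · rw [multiplier_of_zeta_nonpos h]; simp; positivity

theorem norm_direction_le (ha : 0 ≤ a) :
    ‖direction φ ψ a x y w‖ ≤ 2 * ‖gradX φ x y‖ + a := by
  have h := multiplier_mul_norm_le (φ := φ) (ψ := ψ) (x := x) (y := y) (w := w) ha
  have h2 := norm_sub_le (-gradX φ x y) (multiplier φ ψ a x y w • gradX ψ x w)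
  rw [norm_neg, norm_smul, Real.norm_of_nonneg multiplier_nonneg] at h2
  unfold direction
  linarith

/-- The dynamic barrier: where the constraint is treated as active, the search direction decreases
it at the rate prescribed by the weight. -/
theorem inner_gradX_direction_le (h : 0 < zeta ψ x w) :
    ⟪gradX ψ x w, direction φ ψ a x y w⟫ ≤ -(a * ‖gradX ψ x w‖) := by
  unfold direction
  rw [inner_sub_right, inner_neg_right, inner_smul_right, real_inner_self_eq_norm_sq,
    multiplier_mul_norm_sq h]
  linarith [le_max_left (-⟪gradX ψ x w, gradX φ x y⟫ + a * ‖gradX ψ x w‖) 0]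

/-- The barrier costs at most `O(a)` in the decrease of the objective. -/
theorem inner_gradX_objective_direction_le (ha : 0 ≤ a) :
    ⟪gradX φ x y, direction φ ψ a x y w⟫ ≤
      -max (‖direction φ ψ a x y w‖ ^ 2 - a ^ 2) 0 + ‖gradX φ x y‖ * a := by
  have hP := norm_nonneg (gradX φ x y)
  have hle := multiplier_mul_norm_le (φ := φ) (ψ := ψ) (x := x) (y := y) (w := w) ha
  have hnn : 0 ≤ multiplier φ ψ a x y w := multiplier_nonneg
  have key : ∀ z : ℝ, z ≤ -(‖direction φ ψ a x y w‖ ^ 2 - a ^ 2) + ‖gradX φ x y‖ * a →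
      z ≤ ‖gradX φ x y‖ * a →
      z ≤ -max (‖direction φ ψ a x y w‖ ^ 2 - a ^ 2) 0 + ‖gradX φ x y‖ * a := by
    intro z h1 h2
    rcases max_cases (‖direction φ ψ a x y w‖ ^ 2 - a ^ 2) 0 with ⟨e, -⟩ | ⟨e, -⟩ <;> rw [e] <;>
      linarith
  set p := gradX φ x y
  set q := gradX ψ x w
  set lam := multiplier φ ψ a x y w with hlam
  have hd : direction φ ψ a x y w = -p - lam • q := rfl
  have e1 : ⟪p, direction φ ψ a x y w⟫ = -‖p‖ ^ 2 - lam * ⟪q, p⟫ := by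
    rw [hd, inner_sub_right, inner_neg_right, inner_smul_right, real_inner_self_eq_norm_sq,
      real_inner_comm]
  have e2 : ‖direction φ ψ a x y w‖ ^ 2 = ‖p‖ ^ 2 + 2 * (lam * ⟪q, p⟫) + (lam * ‖q‖) ^ 2 := by
    rw [hd, ← neg_add', norm_neg, norm_add_sq_real, inner_smul_right, norm_smul,
      Real.norm_of_nonneg hnn, real_inner_comm]
  have hinner : lam = 0 ∨ lam * ⟪q, p⟫ = lam * ‖q‖ * (a - lam * ‖q‖) := by
    by_cases h : 0 < zeta ψ x w
    · have hm := multiplier_mul_norm_sq (φ := φ) (y := y) (a := a) h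
      rw [← hlam] at hm
      rcases max_cases (-⟪q, p⟫ + a * ‖q‖) 0 with ⟨e, -⟩ | ⟨e, -⟩
      · right
        rw [e] at hm
        have : ⟪q, p⟫ = a * ‖q‖ - lam * ‖q‖ ^ 2 := by linarith
        rw [this]; ring
      · left
        rw [e] at hm
        exact (mul_eq_zero.1 hm).resolve_right (pow_pos (norm_gradX_pos_of_zeta_pos h) 2).ne'
    · exact Or.inl (multiplier_of_zeta_nonpos h)
  refine key _ ?_ ?_ <;> rw [e1] <;> try rw [e2]
  · rcases hinner with h | h
    · rw [h]; nlinarith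
    · rw [h]; nlinarith [mul_le_mul_of_nonneg_left hle ha]
  · rcases hinner with h | h
    · rw [h]; nlinarith [mul_nonneg hP ha]
    · rw [h]
      have hΛ : 0 ≤ lam * ‖q‖ := by positivity
      rcases le_total (lam * ‖q‖) a with h' | h'
      · nlinarith [mul_nonneg hΛ (sub_nonneg.2 h'), mul_nonneg hP ha]
      · nlinarith [mul_le_mul hle (by linarith : lam * ‖q‖ - a ≤ ‖p‖) (by linarith)
          (by linarith : 0 ≤ ‖p‖ + a)]

end Direction

/-! ### Consequences of the Łojasiewicz regularity -/

namespace LojasiewiczRegularity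

variable {n l : ℕ} {ψ : E n → E l → ℝ} {W : Set (E l)} {μ θ : ℝ}

/-- The regularity condition divided by the residual. -/
theorem rpow_le (H : LojasiewiczRegularity ψ W μ θ) {x : E n} {w : E l} (hw : w ∈ W)
    (hpos : 0 < ψ x w) : ψ x w ^ (2 * θ - 1) ≤ μ * ‖gradX ψ x w‖ := by
  have h := H.ineq w hw x
  rw [max_eq_left hpos.le, norm_smul, Real.norm_of_nonneg hpos.le] at h
  rw [Real.rpow_sub_one hpos.ne', div_le_iff₀ hpos]
  linarith

theorem zeta_pos_iff (H : LojasiewiczRegularity ψ W μ θ) {x : E n} {w : E l} (hw : w ∈ W) :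
    0 < zeta ψ x w ↔ 0 < ψ x w := by
  constructor
  · intro h
    by_contra! h'
    rw [zeta, max_eq_right h', zero_mul] at h
    exact lt_irrefl _ h
  · intro h
    have h1 := (Real.rpow_pos_of_pos h (2 * θ - 1)).trans_le (H.rpow_le hw h)
    have h2 : 0 < ‖gradX ψ x w‖ := pos_of_mul_pos_right h1 H.μ_pos.le
    rw [zeta, max_eq_left h.le]
    positivity

/-- For exponents below `1/2` the regularity forces feasibility everywhere: the gradient is bounded
away from `0` where `0 < ψ ≤ V`, so descent makes `ψ (·, w)` nonpositive somewhere, whereas the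
boundedness of the gradient excludes small positive values. -/
theorem nonpos_of_theta_lt (H : LojasiewiczRegularity ψ W μ θ) {Lxx Lxu Luu C η c : ℝ}
    (A : CouplingAssumption ψ W Lxx Lxu Luu C η c) (hθ : θ < 1 / 2) (x : E n) {w : E l}
    (hw : w ∈ W) : ψ x w ≤ 0 := by
  by_contra! hpos
  have hμ := H.μ_pos
  have hC := A.C_pos
  have hL := A.Lxx_nonneg
  set V := ψ x w with hV
  have hr : 2 * θ - 1 < 0 := by linarith
  set r := 2 * θ - 1
  set s := 1 / (Lxx + 1) with hs
  have hs0 : 0 < s := by positivity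
  have hsL : s * Lxx ≤ 1 := by
    rw [hs, div_mul_eq_mul_div, div_le_one (by positivity)]; linarith
  set δ := s / 2 * (V ^ r / μ) ^ 2
  have hδ : 0 < δ := by
    have := Real.rpow_pos_of_pos hpos r
    positivity
  have hstep : ∀ z, 0 < ψ z w → ψ z w ≤ V → ψ (z - s • gradX ψ z w) w ≤ ψ z w - δ := by
    intro z hz hzV
    have h1 := A.le_add_inner_gradX z (z - s • gradX ψ z w) hw
    rw [sub_sub_cancel_left, inner_neg_right, inner_smul_right, real_inner_self_eq_norm_sq,
      norm_neg, norm_smul, Real.norm_of_nonneg hs0.le, mul_pow] at h1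
    have h2 : V ^ r / μ ≤ ‖gradX ψ z w‖ := by
      rw [div_le_iff₀' hμ]
      exact (Real.rpow_le_rpow_of_nonpos hz hzV hr.le).trans (H.rpow_le hw hz)
    have h3 : (V ^ r / μ) ^ 2 ≤ ‖gradX ψ z w‖ ^ 2 := by
      have := Real.rpow_pos_of_pos hpos r
      gcongr
    have h4 : δ ≤ s / 2 * ‖gradX ψ z w‖ ^ 2 :=
      mul_le_mul_of_nonneg_left h3 (by positivity : 0 ≤ s / 2)
    nlinarith [mul_le_mul_of_nonneg_right hsL (mul_nonneg hs0.le (sq_nonneg ‖gradX ψ z w‖))]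
  have hex : ∃ z, ψ z w ≤ 0 := by
    by_contra! hall
    have hk : ∀ k : ℕ, ∃ z, ψ z w ≤ V - k * δ := by
      intro k
      induction k with
      | zero => exact ⟨x, by simp [hV]⟩
      | succ k ih =>
        obtain ⟨z, hz⟩ := ih
        refine ⟨_, (hstep z (hall z) (hz.trans ?_)).trans ?_⟩
        · have : 0 ≤ k * δ := by positivity
          linarith
        · push_cast; linarith
    obtain ⟨k, hk'⟩ := exists_nat_gt (V / δ)
    obtain ⟨z, hz⟩ := hk k
    rw [div_lt_iff₀ hδ] at hk'
    linarith [hall z]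
  set b := (μ * C) ^ (1 / r)
  have hb : 0 < b := Real.rpow_pos_of_pos (by positivity) _
  have hcont : Continuous fun z => ψ z w :=
    A.contDiff.continuous.comp (continuous_id.prodMk continuous_const)
  obtain ⟨z, hz⟩ := mem_range_of_exists_le_of_exists_ge (c := min (b / 2) V) hcont
    (hex.imp fun z hz => hz.trans (le_min (by positivity) hpos.le)) ⟨x, min_le_right _ _⟩
  simp only at hz
  have hz0 : 0 < ψ z w := hz ▸ lt_min (by positivity) hpos
  have hzb : ψ z w < b := by
    rw [hz]; exact (min_le_left _ _).trans_lt (by linarith)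
  have h1 := (H.rpow_le hw hz0).trans
    (mul_le_mul_of_nonneg_left (A.bounded_gradX z w hw) hμ.le)
  have h2 := Real.rpow_lt_rpow_of_neg hz0 hzb hr
  rw [← Real.rpow_mul (by positivity), one_div_mul_cancel hr.ne, Real.rpow_one] at h2
  linarith

end LojasiewiczRegularity

/-! ### Decay of perturbed recursions -/

theorem rpow_neg_sub_le {m p : ℝ} (hm : 1 ≤ m) (hp : 0 < p) (hp1 : p ≤ 1) :
    m ^ (-p) * (1 - p / m) ≤ (m + 1) ^ (-p) := by
  have hm0 : 0 < m := by linarith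
  have h1 : (1 + 1 / m) ^ p ≤ 1 + p * (1 / m) :=
    rpow_one_add_le_one_add_mul_self ((by norm_num : (-1 : ℝ) ≤ 0).trans (by positivity)) hp.le hp1
  have e : m + 1 = m * (1 + 1 / m) := by field_simp
  rw [e, Real.mul_rpow hm0.le (by positivity)]
  refine mul_le_mul_of_nonneg_left ?_ (by positivity)
  rw [Real.rpow_neg (by positivity)]
  have hpos : 0 < (1 + 1 / m) ^ p := by positivity
  rw [inv_eq_one_div, le_div_iff₀ hpos]
  have hpm : p / m ≤ 1 := (div_le_one hm0).2 (by linarith)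
  have h2 : 0 ≤ p / m := by positivity
  rw [mul_one_div] at h1
  nlinarith [mul_le_mul_of_nonneg_left h1 (sub_nonneg.2 hpm)]

/-- One step of the induction behind `exists_decay`: the bound `B m ^ (-p)` on `z` is passed on. In
the second alternative of `h` the decrease `c m ^ (-(1 + ω)) v ^ σ` is effective only when `z` is at
least half of its bound; otherwise there is room for the perturbation. -/
theorem decay_step {σ c C B p ω η m z z' v : ℝ} (hm : 2 ≤ m) (hσ0 : 0 ≤ σ) (hσ1 : σ < 1)
    (hc : 0 < c) (hC : 0 ≤ C) (hB : 1 ≤ B) (hp : 0 < p) (hp3 : p ≤ 1 / 3) (hω : 0 < ω)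
    (hη : 4 * η * m ≤ B) (hI : p * B ^ (1 - σ) * m ^ (ω - p * (1 - σ)) ≤ c / 8)
    (hII : C * m ^ (-(2 / 3 : ℝ)) ≤ c / 8) (hIII : 3 * C ≤ m) (hz : z ≤ B * m ^ (-p))
    (h : z' ≤ η ∨ (0 < v ∧ z - η ≤ v ∧
      z' ≤ z - c * m ^ (-(1 + ω)) * v ^ σ + C * (m ^ (-(1 + ω))) ^ 2)) :
    z' ≤ B * (m + 1) ^ (-p) := by
  have hm0 : 0 < m := by linarith
  have hm1 : 1 ≤ m := by linarith
  set b := B * m ^ (-p) with hb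
  have hb0 : 0 < b := by positivity
  have hbm : B / m ≤ b := by
    rw [hb, div_eq_mul_inv, ← Real.rpow_neg_one]
    exact mul_le_mul_of_nonneg_left (Real.rpow_le_rpow_of_exponent_le hm1 (by linarith))
      (by linarith)
  have hb' : b * (1 - p / m) ≤ B * (m + 1) ^ (-p) := by
    rw [hb, mul_assoc]
    exact mul_le_mul_of_nonneg_left (rpow_neg_sub_le hm1 hp (by linarith)) (by linarith)
  have hηb : η ≤ b / 4 := by
    have : η ≤ B / m / 4 := by
      rw [div_div, le_div_iff₀ (by positivity)]; linarith
    linarith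
  have hpm : p / m ≤ 1 / 6 := by
    rw [div_le_iff₀ hm0]; linarith
  have h56 : 5 / 6 * b ≤ B * (m + 1) ^ (-p) := by nlinarith
  set β := m ^ (-(1 + ω)) with hβ
  have hβ0 : 0 < β := by positivity
  have hβm : β ≤ 1 / m := by
    rw [hβ, one_div, ← Real.rpow_neg_one]
    exact Real.rpow_le_rpow_of_exponent_le hm1 (by linarith)
  rcases h with h | ⟨hv, hzv, h⟩
  · linarith
  · have hvσ : 0 < v ^ σ := by positivity
    rcases lt_or_ge z (b / 2) with hlt | hge
    · have h1 : C * β ^ 2 ≤ b / 3 := by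
        have h2 : β ^ 2 ≤ (1 / m) ^ 2 := by gcongr
        have h3 : C * (1 / m) ^ 2 ≤ 1 / 3 * (1 / m) := by
          rw [sq, ← mul_assoc]
          refine mul_le_mul_of_nonneg_right ?_ (by positivity)
          rw [mul_one_div, div_le_iff₀ hm0]; linarith
        have h4 : 1 / m ≤ B / m := by gcongr
        nlinarith [mul_le_mul_of_nonneg_left h2 hC]
      have h5 : 0 ≤ c * β * v ^ σ := by positivity
      linarith
    · have h1 : b / 4 ≤ v := by linarith
      have h2 : b ^ σ / 4 ≤ v ^ σ := by
        refine le_trans ?_ (Real.rpow_le_rpow (by positivity) h1 hσ0)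
        rw [Real.div_rpow hb0.le (by norm_num)]
        have h4 : (4 : ℝ) ^ σ ≤ 4 := by
          simpa using Real.rpow_le_rpow_of_exponent_le (by norm_num : (1 : ℝ) ≤ 4) hσ1.le
        have : 0 < b ^ σ := by positivity
        gcongr
      have hbσ : 0 < b ^ σ := by positivity
      -- the bound itself decreases by at most half of the guaranteed decrease
      have h3 : p / m * b ≤ c / 8 * β * b ^ σ := by
        have e1 : b = b ^ (1 - σ) * b ^ σ := by
          rw [← Real.rpow_add hb0]; simp
        have e2 : b ^ (1 - σ) = B ^ (1 - σ) * m ^ (-(p * (1 - σ))) := by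
          rw [hb, Real.mul_rpow (by linarith) (by positivity), ← Real.rpow_mul hm0.le, neg_mul]
        have e3 : m ^ (ω - p * (1 - σ)) * β = m ^ (-(p * (1 - σ))) / m := by
          rw [hβ, ← Real.rpow_add hm0, ← Real.rpow_sub_one hm0.ne']; congr 1; ring
        have h4 := mul_le_mul_of_nonneg_right hI hβ0.le
        rw [mul_assoc, e3] at h4
        calc p / m * b = p * B ^ (1 - σ) * (m ^ (-(p * (1 - σ))) / m) * b ^ σ := by
              conv_lhs => rw [e1, e2]
              ring
          _ ≤ c / 8 * β * b ^ σ := mul_le_mul_of_nonneg_right h4 hbσ.le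
      -- and the perturbation is at most the other half
      have h4 : C * β ≤ c / 8 * b ^ σ := by
        have e1 : m ^ (-(1 / 3) : ℝ) ≤ b ^ σ := by
          calc m ^ (-(1 / 3) : ℝ) ≤ m ^ (-p * σ) :=
                Real.rpow_le_rpow_of_exponent_le hm1 (by nlinarith)
            _ = (m ^ (-p)) ^ σ := Real.rpow_mul hm0.le _ _
            _ ≤ b ^ σ := Real.rpow_le_rpow (by positivity)
                (by rw [hb]; nlinarith [Real.rpow_pos_of_pos hm0 (-p)]) hσ0
        have e2 : 1 / m = m ^ (-(2 / 3) : ℝ) * m ^ (-(1 / 3) : ℝ) := by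
          rw [← Real.rpow_add hm0, one_div, ← Real.rpow_neg_one]; norm_num
        calc C * β ≤ C * (1 / m) := mul_le_mul_of_nonneg_left hβm hC
          _ = C * m ^ (-(2 / 3) : ℝ) * m ^ (-(1 / 3) : ℝ) := by rw [e2]; ring
          _ ≤ c / 8 * b ^ σ := mul_le_mul hII e1 (by positivity) (by positivity)
      have h5 : c * β * (b ^ σ / 4) ≤ c * β * v ^ σ :=
        mul_le_mul_of_nonneg_left h2 (by positivity)
      nlinarith [mul_le_mul_of_nonneg_right h4 hβ0.le]

set_option maxHeartbeats 1000000 in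
/-- A recursion with decrease `c k ^ (-(1 + ω)) z ^ σ`, `0 ≤ σ < 1`, and perturbation
`C k ^ (-2 (1 + ω))` decays like `k ^ (-1/3)` if `ω` is small in terms of the other constants.
Without perturbations `z` would vanish once the sum of the weights exceeds a multiple of
`z₀ ^ (1 - σ)`; that sum is of order `1 / ω`, whence the smallness of `ω`. Two power bounds are
propagated: `B₁ k ^ (-p)` with a small exponent `p`, valid from an early time `K₁` on, and, from a
time `K₂` at which it makes `z` small enough, the bound with exponent `1 / 3`. All constants are
independent of the horizon `T`. The first alternative in the recursion and the slack `η` allow for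
the inexact evaluation of `z`. -/
theorem exists_decay {σ c C Z H G : ℝ} (hσ0 : 0 ≤ σ) (hσ1 : σ < 1) (hc : 0 < c) (hC : 0 ≤ C)
    (hZ : 0 ≤ Z) (hH : 0 ≤ H) (hG : 0 ≤ G) :
    ∃ ω₀ > 0, ∀ ω : ℝ, 0 < ω → ω < ω₀ → ∃ B > 0, ∀ (T : ℕ) (z v : ℕ → ℝ) (η : ℝ),
      η ≤ G / T → z 0 ≤ Z → (∀ k < T, z (k + 1) ≤ z k + H) →
      (∀ k, 1 ≤ k → k < T → z (k + 1) ≤ η ∨ (0 < v k ∧ z k - η ≤ v k ∧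
        z (k + 1) ≤ z k - c * ((k : ℝ) + 2) ^ (-(1 + ω)) * v k ^ σ +
          C * (((k : ℝ) + 2) ^ (-(1 + ω))) ^ 2)) →
      ∀ k ≤ T, z k ≤ B * ((k : ℝ) + 2) ^ (-(1 / 3) : ℝ) := by
  have hev : ∀ᶠ m : ℝ in Filter.atTop, C * m ^ (-(2 / 3 : ℝ)) ≤ c / 8 ∧ 3 * C ≤ m := by
    have h1 := (tendsto_rpow_neg_atTop (by norm_num : (0 : ℝ) < 2 / 3)).const_mul C
    rw [mul_zero] at h1
    exact (h1.eventually_le_const (by positivity)).and (Filter.eventually_ge_atTop _)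
  obtain ⟨M, hM⟩ := Filter.eventually_atTop.1 hev
  obtain ⟨K₁, hK₁⟩ := exists_nat_ge (max M 1)
  have hK₁M : M ≤ K₁ := (le_max_left _ _).trans hK₁
  have hK₁1 : 1 ≤ K₁ := by exact_mod_cast (le_max_right _ _).trans hK₁
  set B₁ := 2 * (Z + K₁ * H) + 1 + 8 * G with hB₁
  have hB₁1 : 1 ≤ B₁ := by
    have : 0 ≤ K₁ * H := by positivity
    linarith
  set p := min (1 / 3) (min (1 / ((K₁ : ℝ) + 1)) (c / (8 * B₁))) with hp
  have hp0 : 0 < p := by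
    refine lt_min (by norm_num) (lt_min ?_ ?_) <;> positivity
  have hp3 : p ≤ 1 / 3 := min_le_left _ _
  have hpK : p ≤ 1 / ((K₁ : ℝ) + 1) := (min_le_right _ _).trans (min_le_left _ _)
  have hpB : p ≤ c / (8 * B₁) := (min_le_right _ _).trans (min_le_right _ _)
  have hσ : 0 < 1 - σ := by linarith
  have hB₁σ : B₁ ^ (1 - σ) ≤ B₁ := by
    simpa using Real.rpow_le_rpow_of_exponent_le hB₁1 (by linarith : 1 - σ ≤ 1)
  have hB₁σ0 : 0 < B₁ ^ (1 - σ) := by positivity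
  refine ⟨p * (1 - σ) / 2, by positivity, fun ω hω hω₀ => ?_⟩
  have hpσ : 0 < p * (1 - σ) := by positivity
  have hexp : 0 < p * (1 - σ) - ω := by linarith
  -- the time from which the exponent `1/3` can be used
  have hev₂ : ∀ᶠ m : ℝ in Filter.atTop, B₁ * m ^ (-(p * (1 - σ) - ω)) ≤ c / 8 := by
    have h1 := (tendsto_rpow_neg_atTop hexp).const_mul B₁
    rw [mul_zero] at h1
    exact h1.eventually_le_const (by positivity)
  obtain ⟨M₂, hM₂⟩ := Filter.eventually_atTop.1 hev₂
  obtain ⟨K₂, hK₂⟩ := exists_nat_ge (max M₂ K₁)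
  have hK₂M : M₂ ≤ K₂ := (le_max_left _ _).trans hK₂
  have hK₁₂ : K₁ ≤ K₂ := by exact_mod_cast (le_max_right _ _).trans hK₂
  set B₂ := B₁ * ((K₂ : ℝ) + 2) ^ (1 / 3 - p) with hB₂
  have hB₁₂ : B₁ ≤ B₂ := by
    have : 1 ≤ ((K₂ : ℝ) + 2) ^ (1 / 3 - p) :=
      Real.one_le_rpow (by linarith [K₂.cast_nonneg (α := ℝ)]) (by linarith)
    exact le_mul_of_one_le_right (by linarith) this
  have hcor : 0 ≤ (Z + K₂ * H) * ((K₂ : ℝ) + 2) := by positivity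
  refine ⟨B₂ + (Z + K₂ * H) * ((K₂ : ℝ) + 2), by linarith, ?_⟩
  intro T z v η hη hz0 hH' hrec k hkT
  have htriv : ∀ k ≤ T, z k ≤ Z + k * H := by
    intro k
    induction k with
    | zero => intro _; simpa using hz0
    | succ k ih => intro hk; push_cast; linarith [ih (by omega), hH' k (by omega)]
  have hηm : ∀ k, 1 ≤ k → k < T → 4 * η * ((k : ℝ) + 2) ≤ B₁ := by
    intro k hk hkT
    have hT0 : (0 : ℝ) < T := by exact_mod_cast (by omega : 0 < T)
    have hk2 : (k : ℝ) + 2 ≤ 2 * T := by exact_mod_cast (by omega : k + 2 ≤ 2 * T)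
    have h1 : η * ((k : ℝ) + 2) ≤ 2 * G := by
      refine (mul_le_mul_of_nonneg_right hη (by positivity)).trans ?_
      rw [div_mul_eq_mul_div, div_le_iff₀ hT0]
      linarith [mul_le_mul_of_nonneg_left hk2 hG]
    have : 0 ≤ K₁ * H := by positivity
    linarith
  -- the first bound, with exponent `p`
  have hstage₁ : ∀ k, K₁ ≤ k → k ≤ T → z k ≤ B₁ * ((k : ℝ) + 2) ^ (-p) := by
    intro k hk
    induction k, hk using Nat.le_induction with
    | base =>
      intro hT
      have h1 : ((K₁ : ℝ) + 2) ^ p ≤ 2 := by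
        have h2 := rpow_one_add_le_one_add_mul_self (s := (K₁ : ℝ) + 1) (p := p)
          (by linarith [K₁.cast_nonneg (α := ℝ)]) hp0.le (by linarith)
        rw [le_div_iff₀ (by positivity)] at hpK
        rw [show (K₁ : ℝ) + 2 = 1 + (K₁ + 1) by ring]
        linarith
      have h3 : (1 : ℝ) / 2 ≤ ((K₁ : ℝ) + 2) ^ (-p) := by
        rw [Real.rpow_neg (by positivity), ← one_div]
        exact one_div_le_one_div_of_le (by positivity) h1
      have h4 := htriv K₁ hT
      have h5 := mul_le_mul_of_nonneg_left h3 (zero_le_one.trans hB₁1)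
      linarith
    | succ k hk ih =>
      intro hT
      have hk1 : 1 ≤ k := hK₁1.trans hk
      have hKk : (K₁ : ℝ) ≤ k := by exact_mod_cast hk
      have hmM := hM ((k : ℝ) + 2) (by linarith)
      have hm2 : (2 : ℝ) ≤ (k : ℝ) + 2 := by linarith [k.cast_nonneg (α := ℝ)]
      have hI : p * B₁ ^ (1 - σ) * ((k : ℝ) + 2) ^ (ω - p * (1 - σ)) ≤ c / 8 := by
        have h1 : ((k : ℝ) + 2) ^ (ω - p * (1 - σ)) ≤ 1 :=
          Real.rpow_le_one_of_one_le_of_nonpos (by linarith) (by linarith)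
        have h2 : p * B₁ ≤ c / 8 := by
          rw [le_div_iff₀ (by positivity)] at hpB; linarith
        exact (mul_le_of_le_one_right (by positivity) h1).trans
          ((mul_le_mul_of_nonneg_left hB₁σ hp0.le).trans h2)
      have := decay_step hm2 hσ0 hσ1 hc hC hB₁1 hp0 hp3 hω (hηm k hk1 (by omega)) hI hmM.1 hmM.2
        (ih (by omega)) (hrec k hk1 (by omega))
      rw [show ((k + 1 : ℕ) : ℝ) + 2 = (k : ℝ) + 2 + 1 by push_cast; ring]
      exact this
  have hstage₂ : ∀ k, K₂ ≤ k → k ≤ T → z k ≤ B₂ * ((k : ℝ) + 2) ^ (-(1 / 3) : ℝ) := by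
    intro k hk
    induction k, hk using Nat.le_induction with
    | base =>
      intro hT
      refine (hstage₁ K₂ hK₁₂ hT).trans (le_of_eq ?_)
      rw [hB₂, mul_assoc, ← Real.rpow_add (by positivity)]
      congr 2; ring
    | succ k hk ih =>
      intro hT
      have hk1 : 1 ≤ k := hK₁1.trans (hK₁₂.trans hk)
      have hKk : (K₁ : ℝ) ≤ k := by exact_mod_cast hK₁₂.trans hk
      have hKk2 : (K₂ : ℝ) ≤ k := by exact_mod_cast hk
      have hmM := hM ((k : ℝ) + 2) (by linarith)
      have hm2 : (2 : ℝ) ≤ (k : ℝ) + 2 := by linarith [k.cast_nonneg (α := ℝ)]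
      have hm0 : (0 : ℝ) < (k : ℝ) + 2 := by positivity
      have hI : 1 / 3 * B₂ ^ (1 - σ) * ((k : ℝ) + 2) ^ (ω - 1 / 3 * (1 - σ)) ≤ c / 8 := by
        have h1 : B₂ ≤ B₁ * ((k : ℝ) + 2) ^ (1 / 3 - p) := by
          rw [hB₂]
          have : ((K₂ : ℝ) + 2) ^ (1 / 3 - p) ≤ ((k : ℝ) + 2) ^ (1 / 3 - p) :=
            Real.rpow_le_rpow (by positivity) (by linarith) (by linarith)
          exact mul_le_mul_of_nonneg_left this (by linarith)
        have h2 : B₂ ^ (1 - σ) ≤ B₁ * ((k : ℝ) + 2) ^ ((1 / 3 - p) * (1 - σ)) := by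
          refine (Real.rpow_le_rpow (by linarith) h1 hσ.le).trans ?_
          rw [Real.mul_rpow (by linarith) (by positivity), ← Real.rpow_mul hm0.le]
          exact mul_le_mul_of_nonneg_right hB₁σ (by positivity)
        have h3 : B₂ ^ (1 - σ) * ((k : ℝ) + 2) ^ (ω - 1 / 3 * (1 - σ)) ≤
            B₁ * ((k : ℝ) + 2) ^ (-(p * (1 - σ) - ω)) := by
          refine (mul_le_mul_of_nonneg_right h2 (by positivity)).trans (le_of_eq ?_)
          rw [mul_assoc, ← Real.rpow_add hm0]
          congr 2; ring
        have h4 := hM₂ ((k : ℝ) + 2) (by linarith)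
        have h5 : 0 ≤ B₂ ^ (1 - σ) * ((k : ℝ) + 2) ^ (ω - 1 / 3 * (1 - σ)) :=
          mul_nonneg (Real.rpow_nonneg (by linarith) _) (by positivity)
        linarith
      have := decay_step hm2 hσ0 hσ1 hc hC (hB₁1.trans hB₁₂) (by norm_num) le_rfl hω
        ((hηm k hk1 (by omega)).trans hB₁₂) hI hmM.1 hmM.2 (ih (by omega)) (hrec k hk1 (by omega))
      rw [show ((k + 1 : ℕ) : ℝ) + 2 = (k : ℝ) + 2 + 1 by push_cast; ring]
      exact this
  have hpow : 0 < ((k : ℝ) + 2) ^ (-(1 / 3) : ℝ) := by positivity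
  rcases le_or_gt K₂ k with hk | hk
  · rw [add_mul]
    exact (hstage₂ k hk hkT).trans (le_add_of_nonneg_right (mul_nonneg hcor hpow.le))
  · have hkK : (k : ℝ) ≤ K₂ := by exact_mod_cast hk.le
    have h1 : z k ≤ Z + K₂ * H :=
      (htriv k hkT).trans (by linarith [mul_le_mul_of_nonneg_right hkK hH])
    have h2 : 1 ≤ ((K₂ : ℝ) + 2) * ((k : ℝ) + 2) ^ (-(1 / 3) : ℝ) := by
      have h3 : ((k : ℝ) + 2) ^ (-1 : ℝ) ≤ ((k : ℝ) + 2) ^ (-(1 / 3) : ℝ) :=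
        Real.rpow_le_rpow_of_exponent_le (by linarith [k.cast_nonneg (α := ℝ)]) (by norm_num)
      rw [Real.rpow_neg_one] at h3
      calc (1 : ℝ) = ((k : ℝ) + 2) * ((k : ℝ) + 2)⁻¹ := by field_simp
        _ ≤ _ := mul_le_mul (by linarith) h3 (by positivity) (by positivity)
    have h4 : 0 ≤ Z + K₂ * H := by positivity
    have h5 : 0 ≤ B₂ * ((k : ℝ) + 2) ^ (-(1 / 3) : ℝ) := mul_nonneg (by linarith) hpow.le
    rw [add_mul, mul_assoc]
    linarith [mul_le_mul_of_nonneg_left h2 h4]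

/-! ### Control of the inexactness along a run -/

theorem ValueRegularity.mono {n m : ℕ} {h : E n → E m → ℝ} {U : Set (E m)} {L L' : ℝ}
    (R : ValueRegularity h U L) (hL : L ≤ L') : ValueRegularity h U L' where
  L_pos := R.L_pos.trans_le hL
  gap_nonneg := R.gap_nonneg
  hasGradientAt := R.hasGradientAt
  lipschitz x x' := (R.lipschitz x x').trans (by gcongr)
  gradient_error x u hu := (R.gradient_error x u hu).trans (by gcongr)
  sqrt_gap_le x x' u hu := (R.sqrt_gap_le x x' u hu).trans (by gcongr)

/-- What the analysis of the method uses about the problem and the inner solvers, with common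
constants for `φ` and `ψ`: a gradient bound `C`, the regularity constant `L` of the value
functions, and the linear rate `ρ` of the inner solvers. -/
structure MethodData {n m l : ℕ} (φ : E n → E m → ℝ) (ψ : E n → E l → ℝ) (Y : Set (E m))
    (W : Set (E l)) (ay aw : AscentMethod) (sy sw ηφ ηψ μ θ C L ρ : ℝ) : Prop where
  C_pos : 0 < C
  ρ_pos : 0 < ρ
  ρ_lt_one : ρ < 1
  valφ : ValueRegularity φ Y L
  valψ : ValueRegularity ψ W L
  norm_gradX_le : ∀ x, ∀ y ∈ Y, ‖gradX φ x y‖ ≤ C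
  maxValue_le : ∀ x x', maxValue ψ W x' ≤ maxValue ψ W x + C * ‖x' - x‖
  runφ : ∀ (N : ℕ) (x : E n), ∀ u ∈ Y, ay.run φ Y sy ηφ N x u ∈ Y ∧
    gap φ Y x (ay.run φ Y sy ηφ N x u) ≤ 2 * ρ ^ N * gap φ Y x u
  runψ : ∀ (N : ℕ) (x : E n), ∀ u ∈ W, aw.run ψ W sw ηψ N x u ∈ W ∧
    gap ψ W x (aw.run ψ W sw ηψ N x u) ≤ 2 * ρ ^ N * gap ψ W x u
  reg : LojasiewiczRegularity ψ W μ θ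
  nonpos : θ < 1 / 2 → ∀ x, ∀ w ∈ W, ψ x w ≤ 0

/-- The factor of the logarithmic numbers of inner steps. The constant `11` makes `ρ ^ N ≤ t⁻¹¹`
for `N ≥ rateFactor ρ * log t`, hence `2 ρ ^ N ≤ t⁻⁸ / 4` for `t ≥ 2`. -/
noncomputable def rateFactor (ρ : ℝ) : ℝ := 11 / (-Real.log ρ)

theorem rateFactor_pos {ρ : ℝ} (h0 : 0 < ρ) (h1 : ρ < 1) : 0 < rateFactor ρ :=
  div_pos (by norm_num) (neg_pos.2 (Real.log_neg h0 h1))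

theorem pow_le_of_rateFactor {ρ : ℝ} (h0 : 0 < ρ) (h1 : ρ < 1) {t : ℝ} (ht : 0 < t) {N : ℕ}
    (hN : rateFactor ρ * Real.log t ≤ N) : ρ ^ N * t ^ 11 ≤ 1 := by
  have hlog := Real.log_neg h0 h1
  rw [← Real.log_nonpos_iff (by positivity), Real.log_mul (by positivity) (by positivity),
    Real.log_pow, Real.log_pow]
  unfold rateFactor at hN
  rw [div_mul_eq_mul_div, div_le_iff₀ (by linarith)] at hN
  push_cast
  linarith

theorem two_mul_pow_le {ρ : ℝ} (h0 : 0 < ρ) (h1 : ρ < 1) {t : ℝ} (ht : 2 ≤ t) {N : ℕ}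
    (hN : rateFactor ρ * Real.log t ≤ N) : 2 * ρ ^ N ≤ (1 / 2 / t ^ 4) ^ 2 := by
  have ht0 : 0 < t := by linarith
  have h := pow_le_of_rateFactor h0 h1 ht0 hN
  have h8 : (8 : ℝ) ≤ t ^ 3 := by
    calc (8 : ℝ) = 2 ^ 3 := by norm_num
      _ ≤ t ^ 3 := by gcongr
  have e : (1 / 2 / t ^ 4) ^ 2 = 1 / (4 * t ^ 8) := by field_simp; norm_num
  rw [e, le_div_iff₀ (by positivity)]
  have h3 : 0 ≤ ρ ^ N * t ^ 8 := by positivity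
  have e2 : ρ ^ N * t ^ 11 = ρ ^ N * t ^ 8 * t ^ 3 := by ring
  nlinarith [mul_le_mul_of_nonneg_left h8 h3]

/-- Warm-started inner solves reduce the error by a power of `t` after `O(log t)` steps. -/
theorem sqrt_gap_run_le {n m : ℕ} {h : E n → E m → ℝ} {U : Set (E m)} {L ρ G t : ℝ}
    (R : ValueRegularity h U L) {run : ℕ → E n → E m → E m} (h0 : 0 < ρ) (h1 : ρ < 1)
    (hrun : ∀ (N : ℕ) (x : E n), ∀ u ∈ U, run N x u ∈ U ∧
      gap h U x (run N x u) ≤ 2 * ρ ^ N * gap h U x u)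
    (ht : 2 ≤ t) {N : ℕ} (hN : rateFactor ρ * Real.log t ≤ N) {x x' : E n} {u : E m} (hu : u ∈ U)
    (hG : √(gap h U x u) ≤ G) (hx : L * ‖x' - x‖ ≤ G) :
    √(gap h U x' (run N x' u)) ≤ G / t ^ 4 := by
  have ht0 : 0 < t := by linarith
  have h2 : √(gap h U x' u) ≤ 2 * G := (R.sqrt_gap_le x x' u hu).trans (by linarith)
  have h3 := (hrun N x' u hu).2.trans
    (mul_le_mul_of_nonneg_right (two_mul_pow_le h0 h1 ht hN) (R.gap_nonneg x' u hu))
  have h4 := Real.sqrt_le_sqrt h3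
  rw [Real.sqrt_mul (sq_nonneg _), Real.sqrt_sq (by positivity)] at h4
  refine h4.trans ((mul_le_mul_of_nonneg_left h2 (by positivity)).trans (le_of_eq ?_))
  ring

section MethodData

variable {n m l : ℕ} {φ : E n → E m → ℝ} {ψ : E n → E l → ℝ} {Y : Set (E m)} {W : Set (E l)}
  {ay aw : AscentMethod} {sy sw ηφ ηψ μ θ C L ρ : ℝ}

theorem log_le_ascentBudget {T : ℕ} {x : E n} {w : E l} :
    max 1 (1 / (2 * θ)) * Real.log T ≤ ascentBudget ψ θ T x w := by
  unfold ascentBudget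
  split_ifs
  · exact le_max_left _ _
  · exact le_rfl

theorem log_natCast_le_ascentBudget {T : ℕ} {x : E n} {w : E l} :
    Real.log T ≤ ascentBudget ψ θ T x w := by
  refine le_trans ?_ log_le_ascentBudget
  exact le_mul_of_one_le_left (Real.log_natCast_nonneg T) (le_max_left _ _)

namespace MethodData

theorem rateFactor_mul_log_le (D : MethodData φ ψ Y W ay aw sy sw ηφ ηψ μ θ C L ρ) {T M : ℕ}
    {x : E n} {w : E l} (hM : rateFactor ρ * ascentBudget ψ θ T x w ≤ M) :
    rateFactor ρ * Real.log T ≤ M :=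
  (mul_le_mul_of_nonneg_left log_natCast_le_ascentBudget (rateFactor_pos D.ρ_pos D.ρ_lt_one).le).trans hM

/-- The part of the budget that depends on the residual keeps the error small relative to the
multiplier, which may grow like `[ψ]₊ ^ (1 - 2 θ)`. -/
theorem rpow_mul_sqrt_gap_le (D : MethodData φ ψ Y W ay aw sy sw ηφ ηψ μ θ C L ρ) {T M : ℕ}
    (hT : 1 ≤ T) {G : ℝ} {x x' : E n} {w w' : E l} (hw : w ∈ W)
    (hw' : w' = aw.run ψ W sw ηψ M x' w)
    (hM : rateFactor ρ * ascentBudget ψ θ T x' w' ≤ M) (hG : √(gap ψ W x w) ≤ G)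
    (hx : L * ‖x' - x‖ ≤ G) (hpos : 0 < ψ x' w') :
    ψ x' w' ^ (1 - 2 * θ) * √(gap ψ W x' w') ≤ 3 * G / (T : ℝ) ^ (1 / 3 : ℝ) := by
  have hT0 : (0 : ℝ) < T := by exact_mod_cast hT
  have hT1 : (1 : ℝ) ≤ T := by exact_mod_cast hT
  have hw'W : w' ∈ W := hw' ▸ (D.runψ M x' w hw).1
  have hG0 : 0 ≤ G := (Real.sqrt_nonneg _).trans hG
  have h2 : √(gap ψ W x' w) ≤ 2 * G := (D.valψ.sqrt_gap_le x x' w hw).trans (by linarith)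
  have h3 : gap ψ W x' w ≤ (2 * G) ^ 2 := by
    rw [← Real.sq_sqrt (D.valψ.gap_nonneg x' w hw)]
    exact pow_le_pow_left₀ (Real.sqrt_nonneg _) h2 2
  have hrf := rateFactor_pos D.ρ_pos D.ρ_lt_one
  have hρ := D.ρ_pos
  set Q := (T : ℝ) * ψ x' w' ^ (2 - 4 * θ) with hQ
  have hQ0 : 0 < Q := by positivity
  have hlogQ : Real.log Q ≤ ascentBudget ψ θ T x' w' := by
    unfold ascentBudget
    rw [if_pos ((D.reg.zeta_pos_iff hw'W).2 hpos), max_eq_left hpos.le]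
    exact le_max_right _ _
  have h4 : ρ ^ M * Q ≤ 1 := by
    rcases le_total Q 1 with hQ1 | hQ1
    · exact mul_le_one₀ (pow_le_one₀ hρ.le D.ρ_lt_one.le) hQ0.le hQ1
    · have := pow_le_of_rateFactor hρ D.ρ_lt_one hQ0
        ((mul_le_mul_of_nonneg_left hlogQ hrf.le).trans hM)
      refine le_trans (mul_le_mul_of_nonneg_left ?_ (by positivity)) this
      exact le_self_pow₀ hQ1 (by norm_num)
  have h5 : gap ψ W x' w' ≤ 2 * ρ ^ M * (2 * G) ^ 2 := by
    rw [hw']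
    exact (D.runψ M x' w hw).2.trans (mul_le_mul_of_nonneg_left h3 (by positivity))
  refine abs_le_of_sq_le_sq' ?_ (by positivity) |>.2
  rw [mul_pow, Real.sq_sqrt (D.valψ.gap_nonneg x' w' hw'W), ← Real.rpow_natCast (_ ^ _),
    ← Real.rpow_mul hpos.le, div_pow, ← Real.rpow_natCast (_ ^ (1 / 3 : ℝ)),
    ← Real.rpow_mul hT0.le]
  have e1 : (1 - 2 * θ) * ((2 : ℕ) : ℝ) = 2 - 4 * θ := by push_cast; ring
  rw [e1]
  have h6 : (T : ℝ) ^ (1 / 3 * ((2 : ℕ) : ℝ) : ℝ) ≤ T := by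
    simpa using Real.rpow_le_rpow_of_exponent_le hT1 (by norm_num : 1 / 3 * ((2 : ℕ) : ℝ) ≤ 1)
  have h7 : ψ x' w' ^ (2 - 4 * θ) * gap ψ W x' w' ≤ (3 * G) ^ 2 / T := by
    rw [le_div_iff₀ hT0]
    calc ψ x' w' ^ (2 - 4 * θ) * gap ψ W x' w' * T = Q * gap ψ W x' w' := by rw [hQ]; ring
      _ ≤ Q * (2 * ρ ^ M * (2 * G) ^ 2) := mul_le_mul_of_nonneg_left h5 hQ0.le
      _ = (ρ ^ M * Q) * (8 * G ^ 2) := by ring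
      _ ≤ 1 * (8 * G ^ 2) := mul_le_mul_of_nonneg_right h4 (by positivity)
      _ ≤ (3 * G) ^ 2 := by nlinarith [sq_nonneg G]
  refine h7.trans ?_
  gcongr

/-- Division of `multiplier_mul_norm_le` by the lower bound `ψ ^ (2 θ - 1) / μ` on the gradient. -/
theorem multiplier_le (D : MethodData φ ψ Y W ay aw sy sw ηφ ηψ μ θ C L ρ) {a : ℝ} (ha : 0 ≤ a)
    {x : E n} {y : E m} {w : E l} (hy : y ∈ Y) (hw : w ∈ W) (hpos : 0 < ψ x w) :
    multiplier φ ψ a x y w ≤ μ * (C + a) * ψ x w ^ (1 - 2 * θ) := by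
  have h1 := D.reg.rpow_le hw hpos
  have h2 := (multiplier_mul_norm_le (φ := φ) (ψ := ψ) (x := x) (y := y) (w := w) ha).trans
    (add_le_add_left (D.norm_gradX_le x y hy) a)
  have h3 : multiplier φ ψ a x y w * ψ x w ^ (2 * θ - 1) ≤ μ * (C + a) := by
    refine (mul_le_mul_of_nonneg_left h1 multiplier_nonneg).trans ?_
    nlinarith [mul_le_mul_of_nonneg_left h2 D.reg.μ_pos.le]
  have h4 := mul_le_mul_of_nonneg_right h3 (Real.rpow_nonneg hpos.le (1 - 2 * θ))
  rwa [mul_assoc, ← Real.rpow_add hpos, show 2 * θ - 1 + (1 - 2 * θ) = 0 by ring, Real.rpow_zero,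
    mul_one] at h4

end MethodData

theorem weight_nonneg {ω : ℝ} {T k : ℕ} : 0 ≤ weight ω T k := by
  unfold weight; positivity

theorem weight_eq {ω : ℝ} {T k : ℕ} :
    weight ω T k = (T : ℝ) ^ (1 / 3 : ℝ) * ((k : ℝ) + 2) ^ (-(1 + ω)) := by
  unfold weight
  rw [Real.rpow_neg (by positivity), div_eq_mul_inv]

theorem one_le_rpow_third {T : ℕ} (hT : 1 ≤ T) : 1 ≤ (T : ℝ) ^ (1 / 3 : ℝ) :=
  Real.one_le_rpow (by exact_mod_cast hT) (by norm_num)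

theorem rpow_neg_le_one {k : ℕ} {ω : ℝ} (hω : 0 < ω) : ((k : ℝ) + 2) ^ (-(1 + ω)) ≤ 1 :=
  Real.rpow_le_one_of_one_le_of_nonpos (by linarith [k.cast_nonneg (α := ℝ)]) (by linarith)

/-- Steps of the outer iteration have bounded length. -/
theorem MethodData.step_le (D : MethodData φ ψ Y W ay aw sy sw ηφ ηψ μ θ C L ρ) {ω c₂ γ : ℝ}
    (hω : 0 < ω) {T k : ℕ} (hT : 1 ≤ T) (hγ0 : 0 ≤ γ) (hγ : γ * (T : ℝ) ^ (1 / 3 : ℝ) ≤ c₂)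
    {x : E n} {y : E m} {w : E l} (hy : y ∈ Y) :
    γ * ‖direction φ ψ (weight ω T k) x y w‖ ≤ c₂ * (2 * C + 1) := by
  have hτ := one_le_rpow_third hT
  have h1 := (norm_direction_le (φ := φ) (ψ := ψ) (x := x) (y := y) (w := w)
    (weight_nonneg (ω := ω) (T := T) (k := k)))
  have h2 := D.norm_gradX_le x y hy
  have h3 : γ ≤ c₂ := (le_mul_of_one_le_right hγ0 hτ).trans hγ
  have h4 : γ * weight ω T k ≤ c₂ := by
    rw [weight_eq, ← mul_assoc]
    exact (mul_le_of_le_one_right (by positivity) (rpow_neg_le_one hω)).trans hγ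
  have h5 := mul_le_mul_of_nonneg_left h1 hγ0
  nlinarith [mul_le_mul_of_nonneg_left h2 hγ0, D.C_pos]

/-- An outer iteration with controlled errors of the inner solutions. The bounds on the error for
`ψ` are not available at the starting point, unless it is the only iterate. -/
structure ControlledRun (φ : E n → E m → ℝ) (ψ : E n → E l → ℝ) (Y : Set (E m)) (W : Set (E l))
    (θ ω c₁ c₂ S G : ℝ) (x₀ : E n) (T : ℕ) (γ : ℝ) (x : ℕ → E n) (y : ℕ → E m) (w : ℕ → E l) :
    Prop where
  T_pos : 1 ≤ T
  γ_pos : 0 < γ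
  le_γ : c₁ ≤ γ * (T : ℝ) ^ (1 / 3 : ℝ)
  γ_le : γ * (T : ℝ) ^ (1 / 3 : ℝ) ≤ c₂
  x_zero : x 0 = x₀
  y_mem : ∀ k < T, y k ∈ Y
  w_mem : ∀ k < T, w k ∈ W
  x_succ : ∀ k < T, x (k + 1) = x k + γ • direction φ ψ (weight ω T k) (x k) (y k) (w k)
  step_le : ∀ k < T, γ * ‖direction φ ψ (weight ω T k) (x k) (y k) (w k)‖ ≤ S
  gapφ_le : ∀ k < T, √(gap φ Y (x k) (y k)) ≤ G / ((k : ℝ) + 1) ^ 4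
  gapψ_le : ∀ k < T, 1 ≤ k ∨ T = 1 → √(gap ψ W (x k) (w k)) ≤ G / (T : ℝ) ^ 4
  rpow_mul_gapψ_le : ∀ k < T, 1 ≤ k ∨ T = 1 → 0 < ψ (x k) (w k) →
    ψ (x k) (w k) ^ (1 - 2 * θ) * √(gap ψ W (x k) (w k)) ≤ 3 * G / (T : ℝ) ^ (1 / 3 : ℝ)

/-- A run that meets the budgets is controlled. The smallness of the errors is proved by induction
on the iterates: a step of the outer iteration at most doubles the bound `G` on the square root of
the gap, and the inner solver more than undoes this. -/
theorem MethodData.controlledRun (D : MethodData φ ψ Y W ay aw sy sw ηφ ηψ μ θ C L ρ)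
    {ω c₁ c₂ G γ : ℝ} {T : ℕ} {N M : ℕ → ℕ} {x₀ : E n} {y₀ : E m} {w₀ : E l} (hω : 0 < ω)
    (hT : 1 ≤ T) (hγ0 : 0 < γ) (hγ1 : c₁ ≤ γ * (T : ℝ) ^ (1 / 3 : ℝ))
    (hγ2 : γ * (T : ℝ) ^ (1 / 3 : ℝ) ≤ c₂) (hy₀ : y₀ ∈ Y) (hw₀ : w₀ ∈ W)
    (hGφ : √(gap φ Y x₀ y₀) ≤ G) (hGψ : √(gap ψ W x₀ w₀) ≤ G)
    (hGψ' : ψ x₀ w₀ ^ (1 - 2 * θ) * √(gap ψ W x₀ w₀) ≤ 3 * G)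
    (hGS : L * (c₂ * (2 * C + 1)) ≤ G) {x : ℕ → E n} {y : ℕ → E m} {w : ℕ → E l}
    (hrun : IsRun φ ψ Y W ay aw sy sw ηφ ηψ (weight ω T) γ T N M x₀ y₀ w₀ x y w)
    (hN : ∀ k, 1 ≤ k → k < T → rateFactor ρ * Real.log (k + 1) ≤ N k)
    (hM : ∀ k, 1 ≤ k → k < T → rateFactor ρ * ascentBudget ψ θ T (x k) (w k) ≤ M k) :
    ControlledRun φ ψ Y W θ ω c₁ c₂ (c₂ * (2 * C + 1)) G x₀ T γ x y w := by
  have hG0 : 0 ≤ G := (Real.sqrt_nonneg _).trans hGφ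
  have hT0 : (0 : ℝ) < T := by exact_mod_cast hT
  have hT1 : (1 : ℝ) ≤ T := by exact_mod_cast hT
  have hymem : ∀ k ≤ T, y k ∈ Y := by
    intro k
    induction k with
    | zero => intro _; rw [hrun.y_zero]; exact hy₀
    | succ k ih => intro hk; rw [hrun.y_succ k hk]; exact (D.runφ _ _ _ (ih (by omega))).1
  have hwmem : ∀ k ≤ T, w k ∈ W := by
    intro k
    induction k with
    | zero => intro _; rw [hrun.w_zero]; exact hw₀
    | succ k ih => intro hk; rw [hrun.w_succ k hk]; exact (D.runψ _ _ _ (ih (by omega))).1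
  have hstep : ∀ k < T, γ * ‖direction φ ψ (weight ω T k) (x k) (y k) (w k)‖ ≤
      c₂ * (2 * C + 1) := fun k hk => D.step_le hω hT hγ0.le hγ2 (hymem k hk.le)
  have hLx : ∀ k < T, L * ‖x (k + 1) - x k‖ ≤ G := by
    intro k hk
    rw [hrun.x_succ k hk, add_sub_cancel_left, norm_smul, Real.norm_of_nonneg hγ0.le]
    exact (mul_le_mul_of_nonneg_left (hstep k hk) D.valφ.L_pos.le).trans hGS
  have hφ : ∀ k < T, √(gap φ Y (x k) (y k)) ≤ G / ((k : ℝ) + 1) ^ 4 := by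
    intro k
    induction k with
    | zero => intro _; rw [hrun.x_zero, hrun.y_zero]; simpa using hGφ
    | succ k ih =>
      intro hk
      have h1 := ih (by omega)
      have h2 : G / ((k : ℝ) + 1) ^ 4 ≤ G :=
        div_le_self hG0 (one_le_pow₀ (by linarith [k.cast_nonneg (α := ℝ)]))
      rw [hrun.y_succ k (by omega)]
      refine sqrt_gap_run_le D.valφ D.ρ_pos D.ρ_lt_one (run := ay.run φ Y sy ηφ) D.runφ ?_
        (hN _ (by omega) hk) (hymem k (by omega)) (h1.trans h2) (hLx k (by omega))
      push_cast; linarith [k.cast_nonneg (α := ℝ)]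
  have hψ : ∀ k < T, √(gap ψ W (x k) (w k)) ≤ G ∧
      (1 ≤ k → √(gap ψ W (x k) (w k)) ≤ G / (T : ℝ) ^ 4) := by
    intro k
    induction k with
    | zero =>
      intro _
      rw [hrun.x_zero, hrun.w_zero]
      exact ⟨hGψ, fun h => absurd h (by norm_num)⟩
    | succ k ih =>
      intro hk
      have h1 := (ih (by omega)).1
      have h2 : G / (T : ℝ) ^ 4 ≤ G := div_le_self hG0 (one_le_pow₀ hT1)
      have h3 : √(gap ψ W (x (k + 1)) (w (k + 1))) ≤ G / (T : ℝ) ^ 4 := by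
        have h4 := D.rateFactor_mul_log_le (hM (k + 1) (by omega) hk)
        rw [hrun.w_succ k (by omega)]
        refine sqrt_gap_run_le D.valψ D.ρ_pos D.ρ_lt_one (run := aw.run ψ W sw ηψ) D.runψ ?_
          h4 (hwmem k (by omega)) h1 (hLx k (by omega))
        exact_mod_cast (by omega : 2 ≤ T)
      exact ⟨h3.trans h2, fun _ => h3⟩
  refine ⟨hT, hγ0, hγ1, hγ2, hrun.x_zero, fun k hk => hymem k hk.le, fun k hk => hwmem k hk.le,
    hrun.x_succ, hstep, hφ, fun k hk hk' => ?_, fun k hk hk' hpos => ?_⟩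
  · rcases hk' with hk' | hk'
    · exact (hψ k hk).2 hk'
    · rw [hk']; simpa using (hψ k hk).1
  · cases k with
    | zero =>
      have hT' : T = 1 := by omega
      rw [hrun.x_zero, hrun.w_zero, hT']
      simpa using hGψ'
    | succ k =>
      exact D.rpow_mul_sqrt_gap_le hT (hwmem k (by omega)) (hrun.w_succ k (by omega))
        (hM (k + 1) (by omega) hk) (hψ k (by omega)).1 (hLx k (by omega)) hpos

end MethodData

section Analysis

variable {n m l : ℕ} {φ : E n → E m → ℝ} {ψ : E n → E l → ℝ} {Y : Set (E m)} {W : Set (E l)}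
  {ay aw : AscentMethod} {sy sw ηφ ηψ μ θ C L ρ : ℝ}

/-! ### Decrease of the objective -/

/-- The squared length of the search direction in excess of the barrier weight; it measures the
stationarity that is not due to the barrier. -/
noncomputable def excess (φ : E n → E m → ℝ) (ψ : E n → E l → ℝ) (a : ℝ) (x : E n) (y : E m)
    (w : E l) : ℝ :=
  max (‖direction φ ψ a x y w‖ ^ 2 - a ^ 2) 0

theorem excess_nonneg {a : ℝ} {x : E n} {y : E m} {w : E l} : 0 ≤ excess φ ψ a x y w :=
  le_max_right _ _

theorem norm_direction_sq_le {a : ℝ} {x : E n} {y : E m} {w : E l} :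
    ‖direction φ ψ a x y w‖ ^ 2 ≤ excess φ ψ a x y w + a ^ 2 := by
  have := le_max_left (‖direction φ ψ a x y w‖ ^ 2 - a ^ 2) 0
  unfold excess; linarith

theorem excess_le {a : ℝ} {x : E n} {y : E m} {w : E l} :
    excess φ ψ a x y w ≤ ‖direction φ ψ a x y w‖ ^ 2 :=
  max_le (by linarith [sq_nonneg a]) (sq_nonneg _)

namespace ControlledRun

variable {ω c₁ c₂ S G γ : ℝ} {x₀ : E n} {T : ℕ} {x : ℕ → E n} {y : ℕ → E m} {w : ℕ → E l}

theorem weight_le (R : ControlledRun φ ψ Y W θ ω c₁ c₂ S G x₀ T γ x y w) (k : ℕ) :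
    γ * weight ω T k ≤ c₂ * ((k : ℝ) + 2) ^ (-(1 + ω)) := by
  rw [weight_eq, ← mul_assoc]
  exact mul_le_mul_of_nonneg_right R.γ_le (by positivity)

theorem le_weight (R : ControlledRun φ ψ Y W θ ω c₁ c₂ S G x₀ T γ x y w) (k : ℕ) :
    c₁ * ((k : ℝ) + 2) ^ (-(1 + ω)) ≤ γ * weight ω T k := by
  rw [weight_eq, ← mul_assoc]
  exact mul_le_mul_of_nonneg_right R.le_γ (by positivity)

theorem c₂_pos (R : ControlledRun φ ψ Y W θ ω c₁ c₂ S G x₀ T γ x y w) : 0 < c₂ :=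
  (mul_pos R.γ_pos (zero_lt_one.trans_le (one_le_rpow_third R.T_pos))).trans_le R.γ_le

theorem γ_le_div (R : ControlledRun φ ψ Y W θ ω c₁ c₂ S G x₀ T γ x y w) :
    γ ≤ c₂ / (T : ℝ) ^ (1 / 3 : ℝ) := by
  rw [le_div_iff₀ (zero_lt_one.trans_le (one_le_rpow_third R.T_pos))]
  exact R.γ_le

theorem S_nonneg (R : ControlledRun φ ψ Y W θ ω c₁ c₂ S G x₀ T γ x y w) : 0 ≤ S :=
  (mul_nonneg R.γ_pos.le (norm_nonneg _)).trans (R.step_le 0 R.T_pos)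

theorem sq_mul_norm_sq_le (R : ControlledRun φ ψ Y W θ ω c₁ c₂ S G x₀ T γ x y w) (k : ℕ) :
    γ ^ 2 * ‖direction φ ψ (weight ω T k) (x k) (y k) (w k)‖ ^ 2 ≤
      γ * (γ * excess φ ψ (weight ω T k) (x k) (y k) (w k)) +
        c₂ ^ 2 * (((k : ℝ) + 2) ^ (-(1 + ω))) ^ 2 := by
  have h1 := mul_le_mul_of_nonneg_left (norm_direction_sq_le (φ := φ) (ψ := ψ)
    (a := weight ω T k) (x := x k) (y := y k) (w := w k)) (sq_nonneg γ)
  have h2 : (γ * weight ω T k) ^ 2 ≤ (c₂ * ((k : ℝ) + 2) ^ (-(1 + ω))) ^ 2 :=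
    pow_le_pow_left₀ (mul_nonneg R.γ_pos.le weight_nonneg) (R.weight_le k) 2
  rw [mul_pow, mul_pow] at h2
  linarith

theorem norm_sub_eq (R : ControlledRun φ ψ Y W θ ω c₁ c₂ S G x₀ T γ x y w) {k : ℕ} (hk : k < T) :
    ‖x (k + 1) - x k‖ = γ * ‖direction φ ψ (weight ω T k) (x k) (y k) (w k)‖ := by
  rw [R.x_succ k hk, add_sub_cancel_left, norm_smul, Real.norm_of_nonneg R.γ_pos.le]

/-- Descent of a value function along one step, up to the inexactness of the partial gradient. -/
theorem descent_le (R : ControlledRun φ ψ Y W θ ω c₁ c₂ S G x₀ T γ x y w) {p : ℕ}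
    {h : E n → E p → ℝ} {U : Set (E p)} (V : ValueRegularity h U L) {k : ℕ} (hk : k < T) {u : E p}
    (hu : u ∈ U) :
    maxValue h U (x (k + 1)) ≤ maxValue h U (x k) +
      γ * ⟪gradX h (x k) u, direction φ ψ (weight ω T k) (x k) (y k) (w k)⟫ +
      L * √(gap h U (x k) u) * S +
      L / 2 * (γ * (γ * excess φ ψ (weight ω T k) (x k) (y k) (w k))) +
        L / 2 * (c₂ ^ 2 * (((k : ℝ) + 2) ^ (-(1 + ω))) ^ 2) := by
  have hL := V.L_pos
  have h1 := V.descent (x k) (x (k + 1))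
  rw [R.norm_sub_eq hk, R.x_succ k hk, add_sub_cancel_left, inner_smul_right, mul_pow,
    ← R.x_succ k hk] at h1
  have h2 := mul_le_mul_of_nonneg_left (R.sq_mul_norm_sq_le k) (by positivity : 0 ≤ L / 2)
  set d := direction φ ψ (weight ω T k) (x k) (y k) (w k) with hd
  have h3 := real_inner_le_norm (gradient (maxValue h U) (x k) - gradX h (x k) u) d
  rw [inner_sub_left] at h3
  have h4 : γ * (‖gradient (maxValue h U) (x k) - gradX h (x k) u‖ * ‖d‖) ≤
      L * √(gap h U (x k) u) * S := by
    rw [mul_left_comm]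
    exact mul_le_mul (V.gradient_error (x k) u hu) (R.step_le k hk)
      (mul_nonneg R.γ_pos.le (norm_nonneg _)) (by positivity)
  have h5 := mul_le_mul_of_nonneg_left h3 R.γ_pos.le
  linarith

end ControlledRun

theorem summable_rpow_neg_add_inv_pow {ω : ℝ} (hω : 0 < ω) :
    Summable fun k : ℕ => ((k : ℝ) + 2) ^ (-(1 + ω)) + 1 / ((k : ℝ) + 1) ^ 4 := by
  have h1 : Summable fun k : ℕ => ((k : ℝ) + 2) ^ (-(1 + ω)) := by
    have := (summable_nat_add_iff 2).2 (Real.summable_nat_rpow.2 (by linarith : -(1 + ω) < -1))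
    simpa using this
  have h2 : Summable fun k : ℕ => 1 / ((k : ℝ) + 1) ^ 4 := by
    have := (summable_nat_add_iff 1).2 (Real.summable_one_div_nat_pow.2 (by norm_num : 1 < 4))
    simpa using this
  exact h1.add h2

/-- The total excess is bounded independently of the horizon: the barrier, and the inexactness,
have summable effects on the objective, which is bounded below. -/
theorem MethodData.exists_sum_excess_le
    (D : MethodData φ ψ Y W ay aw sy sw ηφ ηψ μ θ C L ρ)
    (hbdd : BddBelow (Set.range (maxValue φ Y))) {ω : ℝ} (hω : 0 < ω) (c₁ c₂ S G : ℝ)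
    (x₀ : E n) : ∃ K > 0, ∀ (T : ℕ) (γ : ℝ) (x : ℕ → E n) (y : ℕ → E m) (w : ℕ → E l),
      ControlledRun φ ψ Y W θ ω c₁ c₂ S G x₀ T γ x y w → ∀ k ≤ T,
      ∑ j ∈ Finset.range k, γ * excess φ ψ (weight ω T j) (x j) (y j) (w j) ≤ K := by
  obtain ⟨b, hb⟩ := hbdd
  have hb' : ∀ z, b ≤ maxValue φ Y z := fun z => hb ⟨z, rfl⟩
  have hL := D.valφ.L_pos
  have hC := D.C_pos
  have hsum := summable_rpow_neg_add_inv_pow hω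
  set A₀ := ∑' k : ℕ, (((k : ℝ) + 2) ^ (-(1 + ω)) + 1 / ((k : ℝ) + 1) ^ 4) with hA₀
  set K₁ := |C * c₂ + L / 2 * c₂ ^ 2| + |L * G * S| with hK₁
  have hK₁0 : 0 ≤ K₁ := by positivity
  have hA₀0 : 0 ≤ A₀ := tsum_nonneg fun k => by positivity
  refine ⟨2 * (maxValue φ Y x₀ - b + K₁ * A₀) + |(L * c₂) ^ 3 * (S ^ 2 * L)| + 1, ?_, ?_⟩
  · have := hb' x₀
    have : 0 ≤ K₁ * A₀ := by positivity
    have : 0 ≤ |(L * c₂) ^ 3 * (S ^ 2 * L)| := abs_nonneg _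
    linarith
  intro T γ x y w R k hkT
  have hτ := one_le_rpow_third R.T_pos
  have hγ := R.γ_pos
  rcases le_or_gt (L * γ) 1 with hs | hs
  · have hstep : ∀ j < T, 1 / 2 * (γ * excess φ ψ (weight ω T j) (x j) (y j) (w j)) ≤
        maxValue φ Y (x j) - maxValue φ Y (x (j + 1)) +
          K₁ * (((j : ℝ) + 2) ^ (-(1 + ω)) + 1 / ((j : ℝ) + 1) ^ 4) := by
      intro j hj
      have h1 := R.descent_le D.valφ hj (R.y_mem j hj)
      have h2 := mul_le_mul_of_nonneg_left (inner_gradX_objective_direction_le (φ := φ) (ψ := ψ)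
        (x := x j) (y := y j) (w := w j) (weight_nonneg (ω := ω) (T := T) (k := j))) hγ.le
      change _ ≤ γ * (-excess φ ψ (weight ω T j) (x j) (y j) (w j) + _) at h2
      have h3 : γ * (‖gradX φ (x j) (y j)‖ * weight ω T j) ≤
          C * (c₂ * ((j : ℝ) + 2) ^ (-(1 + ω))) := by
        rw [mul_left_comm]
        exact mul_le_mul (D.norm_gradX_le _ _ (R.y_mem j hj)) (R.weight_le j)
          (mul_nonneg hγ.le weight_nonneg) hC.le
      set β := ((j : ℝ) + 2) ^ (-(1 + ω)) with hβ
      have hβ0 : 0 < β := by positivity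
      have hβ1 : β ≤ 1 := rpow_neg_le_one hω
      have h4 : L * √(gap φ Y (x j) (y j)) * S ≤ L * G * S * (1 / ((j : ℝ) + 1) ^ 4) := by
        have := mul_le_mul_of_nonneg_right (mul_le_mul_of_nonneg_left (R.gapφ_le j hj) hL.le)
          R.S_nonneg
        refine this.trans (le_of_eq ?_); ring
      have h5 : L / 2 * (γ * (γ * excess φ ψ (weight ω T j) (x j) (y j) (w j))) ≤
          1 / 2 * (γ * excess φ ψ (weight ω T j) (x j) (y j) (w j)) := by
        have := mul_le_mul_of_nonneg_right hs
          (mul_nonneg hγ.le (excess_nonneg (φ := φ) (ψ := ψ) (a := weight ω T j) (x := x j)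
            (y := y j) (w := w j)))
        linarith
      have h6 : β ^ 2 ≤ β := by nlinarith
      have h7 : L / 2 * (c₂ ^ 2 * β ^ 2) ≤ L / 2 * (c₂ ^ 2 * β) := by gcongr
      have h8 : (C * c₂ + L / 2 * c₂ ^ 2) * β ≤ K₁ * β :=
        mul_le_mul_of_nonneg_right
          ((le_abs_self _).trans (le_add_of_nonneg_right (abs_nonneg _))) hβ0.le
      have h9 : L * G * S * (1 / ((j : ℝ) + 1) ^ 4) ≤ K₁ * (1 / ((j : ℝ) + 1) ^ 4) :=
        mul_le_mul_of_nonneg_right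
          ((le_abs_self _).trans (le_add_of_nonneg_left (abs_nonneg _))) (by positivity)
      rw [mul_add K₁]
      linarith
    have h1 : ∑ j ∈ Finset.range k, 1 / 2 * (γ * excess φ ψ (weight ω T j) (x j) (y j) (w j)) ≤
        ∑ j ∈ Finset.range k, (maxValue φ Y (x j) - maxValue φ Y (x (j + 1)) +
          K₁ * (((j : ℝ) + 2) ^ (-(1 + ω)) + 1 / ((j : ℝ) + 1) ^ 4)) :=
      Finset.sum_le_sum fun j hj => hstep j (by have := Finset.mem_range.1 hj; omega)
    rw [← Finset.mul_sum, Finset.sum_add_distrib, Finset.sum_range_sub', ← Finset.mul_sum,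
      ← Finset.mul_sum, R.x_zero] at h1
    have h2 := mul_le_mul_of_nonneg_left
      (hsum.sum_le_tsum (Finset.range k) fun j _ => by positivity) hK₁0
    change _ ≤ K₁ * A₀ at h2
    rw [← Finset.mul_sum]
    have h3 := hb' (x k)
    have h4 := abs_nonneg ((L * c₂) ^ 3 * (S ^ 2 * L))
    linarith
  · -- a long step size occurs only for boundedly many horizons
    have hT : (T : ℝ) = ((T : ℝ) ^ (1 / 3 : ℝ)) ^ 3 := by
      rw [← Real.rpow_natCast, ← Real.rpow_mul (by positivity)]; norm_num
    have hτc : (T : ℝ) ^ (1 / 3 : ℝ) ≤ L * c₂ := by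
      nlinarith [mul_le_mul_of_nonneg_left R.γ_le hL.le]
    have hj : ∀ j ∈ Finset.range k,
        γ * excess φ ψ (weight ω T j) (x j) (y j) (w j) ≤ S ^ 2 * L := by
      intro j hj
      have hjT : j < T := by have := Finset.mem_range.1 hj; omega
      have h1 := pow_le_pow_left₀ (mul_nonneg hγ.le (norm_nonneg _)) (R.step_le j hjT) 2
      rw [mul_pow] at h1
      have h2 := mul_le_mul_of_nonneg_left (excess_le (φ := φ) (ψ := ψ) (a := weight ω T j)
        (x := x j) (y := y j) (w := w j)) (mul_nonneg hγ.le (mul_nonneg hL.le hγ.le))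
      have h3 : 0 ≤ γ * excess φ ψ (weight ω T j) (x j) (y j) (w j) :=
        mul_nonneg hγ.le excess_nonneg
      nlinarith [mul_le_mul_of_nonneg_left h1 hL.le]
    have h1 := Finset.sum_le_card_nsmul _ _ _ hj
    rw [Finset.card_range, nsmul_eq_mul] at h1
    have h2 : (k : ℝ) ≤ (L * c₂) ^ 3 := by
      have : (k : ℝ) ≤ T := by exact_mod_cast hkT
      rw [hT] at this
      exact this.trans (pow_le_pow_left₀ (by positivity) hτc 3)
    have h3 : (k : ℝ) * (S ^ 2 * L) ≤ |(L * c₂) ^ 3 * (S ^ 2 * L)| :=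
      (mul_le_mul_of_nonneg_right h2 (by positivity)).trans (le_abs_self _)
    have h4 := hb' x₀
    have h5 : 0 ≤ K₁ * A₀ := by positivity
    linarith

/-! ### Decrease of the infeasibility -/

/-- Infeasibility decays like `k ^ (-1/3)`, up to `O(T ^ (-1/3))`, once `ω` is small. -/
theorem MethodData.exists_maxValue_le
    (D : MethodData φ ψ Y W ay aw sy sw ηφ ηψ μ θ C L ρ)
    (hbdd : BddBelow (Set.range (maxValue φ Y))) (hθ : 1 / 2 ≤ θ) {c₁ c₂ S G : ℝ}
    (hc₁ : 0 < c₁) (hS : 0 ≤ S) (hG : 0 ≤ G) (x₀ : E n) :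
    ∃ ω₀ > 0, ∀ ω : ℝ, 0 < ω → ω < ω₀ → ∃ K > 0, ∀ (T : ℕ) (γ : ℝ) (x : ℕ → E n)
      (y : ℕ → E m) (w : ℕ → E l), ControlledRun φ ψ Y W θ ω c₁ c₂ S G x₀ T γ x y w →
      ∀ k ≤ T, maxValue ψ W (x k) ≤
        K * (((k : ℝ) + 2) ^ (-(1 / 3) : ℝ) + 1 / (T : ℝ) ^ (1 / 3 : ℝ)) := by
  have hL := D.valφ.L_pos
  have hC := D.C_pos
  have hμ := D.reg.μ_pos
  have hθ1 := D.reg.θ_lt_one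
  obtain ⟨ω₀, hω₀, H⟩ := exists_decay (σ := 2 * θ - 1) (c := c₁ / μ)
    (C := L / 2 * c₂ ^ 2 + 16 * (L * G * S)) (Z := max (maxValue ψ W x₀) 0) (H := C * S)
    (G := G ^ 2) (by linarith) (by linarith) (by positivity) (by positivity) (le_max_right _ _)
    (by positivity) (by positivity)
  refine ⟨min ω₀ 1, lt_min hω₀ one_pos, fun ω hω hω' => ?_⟩
  obtain ⟨B, hB, H⟩ := H ω hω (hω'.trans_le (min_le_left _ _))
  have hω1 : ω ≤ 1 := (hω'.trans_le (min_le_right _ _)).le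
  obtain ⟨K, hK, hsum⟩ := D.exists_sum_excess_le hbdd hω c₁ c₂ S G x₀
  refine ⟨B + |L / 2 * c₂ * K + C * C * c₂|, by positivity, ?_⟩
  intro T γ x y w R k hkT
  have hT0 : (0 : ℝ) < T := by exact_mod_cast R.T_pos
  have hT1 : (1 : ℝ) ≤ T := by exact_mod_cast R.T_pos
  have hτ := one_le_rpow_third R.T_pos
  have hγ := R.γ_pos
  have hc₂ := R.c₂_pos
  have hγτ := R.γ_le_div
  set τ := (T : ℝ) ^ (1 / 3 : ℝ)
  have hτ0 : 0 < τ := by linarith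
  let e : ℕ → ℝ := fun j => L / 2 * (γ * (γ * excess φ ψ (weight ω T j) (x j) (y j) (w j)))
  have he : ∀ j, 0 ≤ e j := fun j =>
    mul_nonneg (by positivity) (mul_nonneg hγ.le (mul_nonneg hγ.le excess_nonneg))
  -- the infeasibility, corrected by the accumulated excess and by the drift at inactive iterates
  let z : ℕ → ℝ := fun j =>
    maxValue ψ W (x j) - ∑ i ∈ Finset.range j, e i - C * C * c₂ / τ
  have hdrift : 0 ≤ C * C * c₂ / τ := by positivity
  have hes : ∀ j, 0 ≤ ∑ i ∈ Finset.range j, e i := fun j => Finset.sum_nonneg fun i _ => he i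
  have hz := H T z (fun j => ψ (x j) (w j)) (G ^ 2 / (T : ℝ) ^ 8) ?_ ?_ ?_ ?_ k hkT
  · have h1 : ∑ i ∈ Finset.range k, e i ≤ L / 2 * (c₂ / τ * K) := by
      simp only [e]
      rw [← Finset.mul_sum, ← Finset.mul_sum]
      refine mul_le_mul_of_nonneg_left ?_ (by positivity)
      exact mul_le_mul hγτ (hsum T γ x y w R k hkT)
        (Finset.sum_nonneg fun i _ => mul_nonneg hγ.le excess_nonneg) (by positivity)
    have h2 : L / 2 * (c₂ / τ * K) + C * C * c₂ / τ =
        (L / 2 * c₂ * K + C * C * c₂) * (1 / τ) := by ring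
    have h3 : (L / 2 * c₂ * K + C * C * c₂) * (1 / τ) ≤
        |L / 2 * c₂ * K + C * C * c₂| * (1 / τ) :=
      mul_le_mul_of_nonneg_right (le_abs_self _) (by positivity)
    have h4 : 0 ≤ B * (1 / τ) := by positivity
    have h5 : 0 ≤ |L / 2 * c₂ * K + C * C * c₂| * ((k : ℝ) + 2) ^ (-(1 / 3) : ℝ) := by
      positivity
    simp only [z] at hz
    rw [add_mul, mul_add, mul_add]
    linarith
  · refine div_le_div_of_nonneg_left (by positivity) hT0 ?_
    exact le_self_pow₀ hT1 (by norm_num)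
  · simp only [z, R.x_zero, Finset.range_zero, Finset.sum_empty, sub_zero]
    linarith [le_max_left (maxValue ψ W x₀) 0]
  · intro j hj
    simp only [z]
    rw [Finset.sum_range_succ]
    have h1 := D.maxValue_le (x j) (x (j + 1))
    rw [R.norm_sub_eq hj] at h1
    have h2 := mul_le_mul_of_nonneg_left (R.step_le j hj) hC.le
    linarith [he j]
  · intro j hj1 hj
    have hgapη : gap ψ W (x j) (w j) ≤ G ^ 2 / (T : ℝ) ^ 8 := by
      have h1 := pow_le_pow_left₀ (Real.sqrt_nonneg _) (R.gapψ_le j hj (Or.inl hj1)) 2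
      rw [Real.sq_sqrt (D.valψ.gap_nonneg _ _ (R.w_mem j hj)), div_pow, ← pow_mul] at h1
      exact h1
    by_cases hpos : 0 < ψ (x j) (w j)
    · right
      refine ⟨hpos, ?_, ?_⟩
      · simp only [z]
        have : maxValue ψ W (x j) - ψ (x j) (w j) ≤ G ^ 2 / (T : ℝ) ^ 8 := hgapη
        linarith [hes j]
      · have h1 := R.descent_le D.valψ hj (R.w_mem j hj)
        have hζ := (D.reg.zeta_pos_iff (R.w_mem j hj)).2 hpos
        have h2 := mul_le_mul_of_nonneg_left (inner_gradX_direction_le (φ := φ) (y := y j)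
          (a := weight ω T j) hζ) hγ.le
        have h3 := D.reg.rpow_le (R.w_mem j hj) hpos
        have h4 := R.le_weight j
        have h5 := R.gapψ_le j hj (Or.inl hj1)
        set β := ((j : ℝ) + 2) ^ (-(1 + ω)) with hβ
        have hβ0 : 0 < β := by positivity
        have h6 : c₁ / μ * β * ψ (x j) (w j) ^ (2 * θ - 1) ≤
            γ * (weight ω T j * ‖gradX ψ (x j) (w j)‖) := by
          rw [← mul_assoc]
          have h7 : ψ (x j) (w j) ^ (2 * θ - 1) / μ ≤ ‖gradX ψ (x j) (w j)‖ := by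
            rw [div_le_iff₀ hμ]; linarith
          calc c₁ / μ * β * ψ (x j) (w j) ^ (2 * θ - 1) =
                c₁ * β * (ψ (x j) (w j) ^ (2 * θ - 1) / μ) := by ring
            _ ≤ _ := mul_le_mul h4 h7 (by positivity) (mul_nonneg hγ.le weight_nonneg)
        -- the inexactness is dominated by `β ^ 2 ≥ (j + 2) ^ (-4)`
        have h8 : 1 / (T : ℝ) ^ 4 ≤ 16 * β ^ 2 := by
          have hj2 : (j : ℝ) + 2 ≤ 2 * T := by exact_mod_cast (by omega : j + 2 ≤ 2 * T)
          have h9 : ((j : ℝ) + 2) ^ (-2 : ℝ) ≤ β :=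
            Real.rpow_le_rpow_of_exponent_le (by linarith [j.cast_nonneg (α := ℝ)]) (by linarith)
          have h10 : 1 / (2 * (T : ℝ)) ^ 2 ≤ β := by
            refine le_trans ?_ h9
            rw [Real.rpow_neg (by positivity), Real.rpow_two, ← one_div]
            gcongr
          have h11 := pow_le_pow_left₀ (by positivity) h10 2
          calc 1 / (T : ℝ) ^ 4 = 16 * (1 / (2 * (T : ℝ)) ^ 2) ^ 2 := by field_simp; norm_num
            _ ≤ 16 * β ^ 2 := by linarith
        have h9 : L * √(gap ψ W (x j) (w j)) * S ≤ 16 * (L * G * S) * β ^ 2 := by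
          calc L * √(gap ψ W (x j) (w j)) * S ≤ L * (G / (T : ℝ) ^ 4) * S := by gcongr
            _ = L * G * S * (1 / (T : ℝ) ^ 4) := by ring
            _ ≤ L * G * S * (16 * β ^ 2) := by gcongr
            _ = _ := by ring
        simp only [z]
        rw [Finset.sum_range_succ]
        change _ - (_ + L / 2 * (γ * (γ * excess φ ψ (weight ω T j) (x j) (y j) (w j)))) - _ ≤ _
        rw [add_mul]
        linarith
    · -- at an inactive iterate the method takes a gradient step on the objective
      left
      have hlam : multiplier φ ψ (weight ω T j) (x j) (y j) (w j) = 0 :=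
        multiplier_of_zeta_nonpos (by rwa [D.reg.zeta_pos_iff (R.w_mem j hj)])
      have hd : ‖direction φ ψ (weight ω T j) (x j) (y j) (w j)‖ ≤ C := by
        unfold direction
        rw [hlam, zero_smul, sub_zero, norm_neg]
        exact D.norm_gradX_le _ _ (R.y_mem j hj)
      have h1 := D.maxValue_le (x j) (x (j + 1))
      rw [R.norm_sub_eq hj] at h1
      have h2 : γ * ‖direction φ ψ (weight ω T j) (x j) (y j) (w j)‖ ≤ c₂ / τ * C :=
        mul_le_mul hγτ hd (norm_nonneg _) (by positivity)
      have h3 : maxValue ψ W (x j) ≤ G ^ 2 / (T : ℝ) ^ 8 := by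
        unfold gap at hgapη; linarith
      have h4 := mul_le_mul_of_nonneg_left h2 hC.le
      have h5 : C * (c₂ / τ * C) = C * C * c₂ / τ := by ring
      simp only [z]
      linarith [hes (j + 1)]

end Analysis

/-! ### The best late iterate -/

set_option maxHeartbeats 1000000 in
/-- In the second half of the run the weights are `O(T ^ (-2/3))`, so the iterate of least excess
there is nearly stationary; feasibility holds at all late iterates, and complementary slackness
follows from it because the multiplier is at most of order `ψ ^ (1 - 2 θ)`. -/
theorem MethodData.exists_good_iterate {n m l : ℕ} {φ : E n → E m → ℝ} {ψ : E n → E l → ℝ}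
    {Y : Set (E m)} {W : Set (E l)} {ay aw : AscentMethod} {sy sw ηφ ηψ μ θ C L ρ : ℝ}
    (D : MethodData φ ψ Y W ay aw sy sw ηφ ηψ μ θ C L ρ)
    (hbdd : BddBelow (Set.range (maxValue φ Y))) {c₁ c₂ S G : ℝ}
    (hc₁ : 0 < c₁) (hS : 0 ≤ S) (hG : 0 ≤ G) (x₀ : E n) :
    ∃ ω₀ > 0, ∀ ω : ℝ, 0 < ω → ω < ω₀ → ∃ K > 0, ∀ (T : ℕ) (γ : ℝ) (x : ℕ → E n)
      (y : ℕ → E m) (w : ℕ → E l), ControlledRun φ ψ Y W θ ω c₁ c₂ S G x₀ T γ x y w →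
      ∃ t < T,
        ‖gradient (maxValue φ Y) (x t) + multiplier φ ψ (weight ω T t) (x t) (y t) (w t) •
          gradient (maxValue ψ W) (x t)‖ ≤ K * (T : ℝ) ^ (-(1 / 3) : ℝ) ∧
        max (maxValue ψ W (x t)) 0 ≤ K * (T : ℝ) ^ (-(1 / (6 * θ))) ∧
        |multiplier φ ψ (weight ω T t) (x t) (y t) (w t) * maxValue ψ W (x t)| ≤
          K * (T : ℝ) ^ (-((1 - θ) / (3 * θ))) := by
  have hL := D.valφ.L_pos
  have hC := D.C_pos
  have hμ := D.reg.μ_pos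
  have hθ0 := D.reg.θ_pos
  have hθ1 := D.reg.θ_lt_one
  -- for `θ < 1/2` the constraint is never violated
  have hfeas : ∃ ω₀ > 0, ∀ ω : ℝ, 0 < ω → ω < ω₀ → ∃ K > 0, 1 / 2 ≤ θ → ∀ (T : ℕ) (γ : ℝ)
      (x : ℕ → E n) (y : ℕ → E m) (w : ℕ → E l),
      ControlledRun φ ψ Y W θ ω c₁ c₂ S G x₀ T γ x y w → ∀ k ≤ T, maxValue ψ W (x k) ≤
        K * (((k : ℝ) + 2) ^ (-(1 / 3) : ℝ) + 1 / (T : ℝ) ^ (1 / 3 : ℝ)) := by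
    by_cases hθ : 1 / 2 ≤ θ
    · obtain ⟨ω₀, h0, H⟩ := D.exists_maxValue_le hbdd hθ (c₂ := c₂) hc₁ hS hG x₀
      refine ⟨ω₀, h0, fun ω h1 h2 => ?_⟩
      obtain ⟨K, hK, H⟩ := H ω h1 h2
      exact ⟨K, hK, fun _ => H⟩
    · exact ⟨1, one_pos, fun ω _ _ => ⟨1, one_pos, fun h => absurd h hθ⟩⟩
  obtain ⟨ω₀, hω₀, H⟩ := hfeas
  refine ⟨ω₀, hω₀, fun ω hω hω' => ?_⟩
  obtain ⟨K₁, hK₁, H⟩ := H ω hω hω'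
  obtain ⟨K₂, hK₂, hsum⟩ := D.exists_sum_excess_le hbdd hω c₁ c₂ S G x₀
  set Ks := √(2 * K₂ / c₁ + 4) + 2 * (L * G) + L * (μ * (C + 2) * (3 * G)) with hKs
  set Kc := μ * (C + 2) * (3 * K₁ + 1) + μ * (C + 2) * (3 * G) * G with hKc
  have hKs0 : 0 ≤ Ks := by positivity
  have hKc0 : 0 ≤ Kc := by positivity
  refine ⟨Ks + 3 * K₁ + Kc, by positivity, ?_⟩
  intro T γ x y w R
  have hT0 : (0 : ℝ) < T := by exact_mod_cast R.T_pos
  have hT1 : (1 : ℝ) ≤ T := by exact_mod_cast R.T_pos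
  have hγ := R.γ_pos
  have hτ1 := one_le_rpow_third R.T_pos
  have hle := R.le_γ
  have hτinv : (T : ℝ) ^ (-(1 / 3) : ℝ) = 1 / (T : ℝ) ^ (1 / 3 : ℝ) := by
    rw [Real.rpow_neg hT0.le, inv_eq_one_div]
  have hT3 : (T : ℝ) = ((T : ℝ) ^ (1 / 3 : ℝ)) ^ 3 := by
    rw [← Real.rpow_natCast, ← Real.rpow_mul (by positivity)]; norm_num
  set τ := (T : ℝ) ^ (1 / 3 : ℝ) with hτ
  have hτ0 : 0 < τ := by linarith
  have hTpos := R.T_pos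
  obtain ⟨t, htmem, htmin⟩ := Finset.exists_min_image (Finset.Ico (T / 2) T)
    (fun j => γ * excess φ ψ (weight ω T j) (x j) (y j) (w j))
    ⟨T / 2, Finset.mem_Ico.2 ⟨le_rfl, by omega⟩⟩
  obtain ⟨ht1, htT⟩ := Finset.mem_Ico.1 htmem
  have ht2 : (T : ℝ) ≤ 2 * ((t : ℝ) + 1) := by exact_mod_cast (by omega : T ≤ 2 * (t + 1))
  have hlate : 1 ≤ t ∨ T = 1 := by omega
  have hexc : excess φ ψ (weight ω T t) (x t) (y t) (w t) ≤ 2 * K₂ / c₁ / τ ^ 2 := by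
    have h1 := Finset.card_nsmul_le_sum _ _ _ htmin
    rw [Nat.card_Ico, nsmul_eq_mul] at h1
    have h2 : ∑ j ∈ Finset.Ico (T / 2) T, γ * excess φ ψ (weight ω T j) (x j) (y j) (w j) ≤
        ∑ j ∈ Finset.range T, γ * excess φ ψ (weight ω T j) (x j) (y j) (w j) :=
      Finset.sum_le_sum_of_subset_of_nonneg
        (fun j hj => Finset.mem_range.2 (Finset.mem_Ico.1 hj).2)
        fun j _ _ => mul_nonneg hγ.le excess_nonneg
    have h3 := (h1.trans h2).trans (hsum T γ x y w R T le_rfl)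
    have h4 : (T : ℝ) / 2 ≤ ((T - T / 2 : ℕ) : ℝ) := by
      rw [div_le_iff₀ two_pos]; exact_mod_cast (by omega : T ≤ (T - T / 2) * 2)
    set e := excess φ ψ (weight ω T t) (x t) (y t) (w t)
    have he : 0 ≤ e := excess_nonneg
    have h5 : (T : ℝ) / 2 * (γ * e) ≤ K₂ :=
      (mul_le_mul_of_nonneg_right h4 (mul_nonneg hγ.le he)).trans h3
    rw [div_div, le_div_iff₀ (by positivity)]
    have h6 : c₁ * (τ ^ 2 * e) ≤ γ * τ * (τ ^ 2 * e) :=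
      mul_le_mul_of_nonneg_right hle (by positivity)
    have h7 : γ * τ * (τ ^ 2 * e) = T * (γ * e) := by
      calc γ * τ * (τ ^ 2 * e) = τ ^ 3 * (γ * e) := by ring
        _ = T * (γ * e) := by rw [← hT3]
    linarith
  have ha0 : 0 ≤ weight ω T t := weight_nonneg
  have ha : weight ω T t ≤ 2 / τ ^ 2 := by
    rw [weight_eq]
    have h1 : ((t : ℝ) + 2) ^ (-(1 + ω)) ≤ 2 / T := by
      have h2 : ((t : ℝ) + 2) ^ (-(1 + ω)) ≤ ((t : ℝ) + 2) ^ (-1 : ℝ) :=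
        Real.rpow_le_rpow_of_exponent_le (by linarith [t.cast_nonneg (α := ℝ)]) (by linarith)
      refine h2.trans ?_
      rw [Real.rpow_neg_one, inv_eq_one_div, div_le_div_iff₀ (by positivity) hT0]
      linarith
    refine (mul_le_mul_of_nonneg_left h1 hτ0.le).trans (le_of_eq ?_)
    conv_lhs => rw [hT3]
    field_simp
  have hτsq : 1 ≤ τ ^ 2 := one_le_pow₀ hτ1
  have ha2 : weight ω T t ≤ 2 := ha.trans (div_le_self (by norm_num) hτsq)
  have hy := R.y_mem t htT
  have hw := R.w_mem t htT
  have hd : ‖direction φ ψ (weight ω T t) (x t) (y t) (w t)‖ ≤ √(2 * K₂ / c₁ + 4) / τ := by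
    refine abs_le_of_sq_le_sq' ?_ (by positivity) |>.2
    rw [div_pow, Real.sq_sqrt (by positivity), add_div]
    refine norm_direction_sq_le.trans (add_le_add hexc ?_)
    have h1 := pow_le_pow_left₀ ha0 ha 2
    refine h1.trans ?_
    rw [div_pow]
    have : τ ^ 2 ≤ (τ ^ 2) ^ 2 := le_self_pow₀ hτsq (by norm_num)
    calc (2 : ℝ) ^ 2 / (τ ^ 2) ^ 2 ≤ 2 ^ 2 / τ ^ 2 := by gcongr
      _ = 4 / τ ^ 2 := by norm_num
  set lam := multiplier φ ψ (weight ω T t) (x t) (y t) (w t) with hlam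
  have hlam0 : 0 ≤ lam := multiplier_nonneg
  have hlamz : ¬ 0 < ψ (x t) (w t) → lam = 0 := fun h =>
    multiplier_of_zeta_nonpos (by rwa [D.reg.zeta_pos_iff hw])
  have hlampos : 0 < ψ (x t) (w t) → lam ≤ μ * (C + 2) * ψ (x t) (w t) ^ (1 - 2 * θ) :=
    fun h => (D.multiplier_le ha0 hy hw h).trans (by gcongr)
  have hlamgap : lam * √(gap ψ W (x t) (w t)) ≤ μ * (C + 2) * (3 * G) / τ := by
    by_cases h : 0 < ψ (x t) (w t)
    · have h1 := R.rpow_mul_gapψ_le t htT hlate h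
      calc lam * √(gap ψ W (x t) (w t)) ≤
            μ * (C + 2) * ψ (x t) (w t) ^ (1 - 2 * θ) * √(gap ψ W (x t) (w t)) :=
              mul_le_mul_of_nonneg_right (hlampos h) (Real.sqrt_nonneg _)
        _ = μ * (C + 2) * (ψ (x t) (w t) ^ (1 - 2 * θ) * √(gap ψ W (x t) (w t))) := by ring
        _ ≤ μ * (C + 2) * (3 * G / τ) := mul_le_mul_of_nonneg_left h1 (by positivity)
        _ = _ := by ring
    · rw [hlamz h, zero_mul]; positivity
  have hfe : max (maxValue ψ W (x t)) 0 ≤ 3 * K₁ / τ ∧ (¬ 1 / 2 ≤ θ → maxValue ψ W (x t) ≤ 0) := by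
    by_cases hθ : 1 / 2 ≤ θ
    · refine ⟨max_le ?_ (by positivity), fun h => absurd hθ h⟩
      have h1 := H hθ T γ x y w R t htT.le
      have h2 : ((t : ℝ) + 2) ^ (-(1 / 3) : ℝ) ≤ 2 / τ := by
        have h3 : ((t : ℝ) + 2) ^ (-(1 / 3) : ℝ) ≤ ((T : ℝ) / 2) ^ (-(1 / 3) : ℝ) :=
          Real.rpow_le_rpow_of_nonpos (by positivity) (by linarith) (by norm_num)
        have h4 : (2 : ℝ) ^ (1 / 3 : ℝ) ≤ 2 := by
          simpa using Real.rpow_le_rpow_of_exponent_le (by norm_num : (1 : ℝ) ≤ 2)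
            (by norm_num : (1 / 3 : ℝ) ≤ 1)
        refine h3.trans ?_
        rw [Real.div_rpow hT0.le (by norm_num), hτinv, Real.rpow_neg (by norm_num), div_inv_eq_mul,
          div_mul_eq_mul_div, one_mul]
        gcongr
      refine h1.trans ?_
      calc K₁ * (((t : ℝ) + 2) ^ (-(1 / 3) : ℝ) + 1 / τ) ≤ K₁ * (2 / τ + 1 / τ) := by gcongr
        _ = 3 * K₁ / τ := by ring
    · have h0 : maxValue ψ W (x t) ≤ 0 := Real.sSup_nonpos (by
        rintro _ ⟨w', hw', rfl⟩
        exact D.nonpos (not_le.1 hθ) _ w' hw')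
      exact ⟨max_le (h0.trans (by positivity)) (by positivity), fun _ => h0⟩
  refine ⟨t, htT, ?_, ?_, ?_⟩
  · have e1 : gradient (maxValue φ Y) (x t) + lam • gradient (maxValue ψ W) (x t) =
        -direction φ ψ (weight ω T t) (x t) (y t) (w t) +
          (gradient (maxValue φ Y) (x t) - gradX φ (x t) (y t)) +
          lam • (gradient (maxValue ψ W) (x t) - gradX ψ (x t) (w t)) := by
      unfold direction; rw [← hlam]; module
    have h1 := D.valφ.gradient_error (x t) (y t) hy
    have h2 := D.valψ.gradient_error (x t) (w t) hw
    have h3 := R.gapφ_le t htT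
    have h4 : G / ((t : ℝ) + 1) ^ 4 ≤ 2 * G / τ := by
      have h5 : (t : ℝ) + 1 ≤ ((t : ℝ) + 1) ^ 4 :=
        le_self_pow₀ (by linarith [t.cast_nonneg (α := ℝ)]) (by norm_num)
      have h6 : τ ≤ T := by
        rw [hT3]; exact le_self_pow₀ hτ1 (by norm_num)
      rw [div_le_div_iff₀ (by positivity) hτ0]
      nlinarith
    have h5 : ‖lam • (gradient (maxValue ψ W) (x t) - gradX ψ (x t) (w t))‖ ≤
        L * (μ * (C + 2) * (3 * G) / τ) := by
      rw [norm_smul, Real.norm_of_nonneg hlam0]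
      calc lam * ‖gradient (maxValue ψ W) (x t) - gradX ψ (x t) (w t)‖ ≤
            lam * (L * √(gap ψ W (x t) (w t))) := mul_le_mul_of_nonneg_left h2 hlam0
        _ = L * (lam * √(gap ψ W (x t) (w t))) := by ring
        _ ≤ _ := mul_le_mul_of_nonneg_left hlamgap hL.le
    rw [e1]
    refine (norm_add₃_le).trans ?_
    rw [norm_neg]
    have h6 : Ks / τ ≤ (Ks + 3 * K₁ + Kc) * (T : ℝ) ^ (-(1 / 3) : ℝ) := by
      rw [hτinv, mul_one_div]; gcongr; linarith
    have h7 : Ks / τ = √(2 * K₂ / c₁ + 4) / τ + L * (2 * G / τ) +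
        L * (μ * (C + 2) * (3 * G) / τ) := by
      rw [hKs]; ring
    have h8 := mul_le_mul_of_nonneg_left (h3.trans h4) hL.le
    linarith
  · by_cases hθ : 1 / 2 ≤ θ
    · have h1 : 1 / τ ≤ (T : ℝ) ^ (-(1 / (6 * θ))) := by
        rw [← hτinv]
        refine Real.rpow_le_rpow_of_exponent_le hT1 (neg_le_neg ?_)
        rw [div_le_div_iff₀ (by positivity) (by norm_num)]; linarith
      calc max (maxValue ψ W (x t)) 0 ≤ 3 * K₁ * (1 / τ) := by rw [mul_one_div]; exact hfe.1
        _ ≤ _ := mul_le_mul (by linarith) h1 (by positivity) (by positivity)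
    · rw [max_eq_right (hfe.2 hθ)]; positivity
  · rw [← hlam]
    by_cases hpos : 0 < ψ (x t) (w t)
    · have hθ : 1 / 2 ≤ θ := by
        by_contra! h
        exact absurd hpos (not_lt.2 (D.nonpos h _ _ hw))
      have hg : maxValue ψ W (x t) = ψ (x t) (w t) + gap ψ W (x t) (w t) := by
        unfold gap; ring
      have hgap0 := D.valψ.gap_nonneg (x t) (w t) hw
      rw [abs_of_nonneg (mul_nonneg hlam0 (by linarith)), hg, mul_add]
      have hexp : (T : ℝ) ^ (-(1 / 3) : ℝ) ≤ (T : ℝ) ^ (-((1 - θ) / (3 * θ))) := by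
        refine Real.rpow_le_rpow_of_exponent_le hT1 (neg_le_neg ?_)
        rw [div_le_div_iff₀ (by positivity) (by norm_num)]; linarith
      have h1 : lam * ψ (x t) (w t) ≤ μ * (C + 2) * (3 * K₁ + 1) *
          (T : ℝ) ^ (-((1 - θ) / (3 * θ))) := by
        have h2 : ψ (x t) (w t) ≤ (3 * K₁ + 1) / τ := by
          have h3 : ψ (x t) (w t) ≤ max (maxValue ψ W (x t)) 0 :=
            (by linarith : ψ (x t) (w t) ≤ maxValue ψ W (x t)).trans (le_max_left _ _)
          refine (h3.trans hfe.1).trans ?_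
          gcongr; linarith
        have h4 : ψ (x t) (w t) ^ (2 - 2 * θ) ≤
            (3 * K₁ + 1) * (T : ℝ) ^ (-((1 - θ) / (3 * θ))) := by
          calc ψ (x t) (w t) ^ (2 - 2 * θ) ≤ ((3 * K₁ + 1) / τ) ^ (2 - 2 * θ) :=
                Real.rpow_le_rpow hpos.le h2 (by linarith)
            _ = (3 * K₁ + 1) ^ (2 - 2 * θ) * (T : ℝ) ^ (-(1 / 3) * (2 - 2 * θ)) := by
                rw [div_eq_mul_one_div, ← hτinv, Real.mul_rpow (by positivity) (by positivity),
                  ← Real.rpow_mul hT0.le]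
            _ ≤ (3 * K₁ + 1) * (T : ℝ) ^ (-((1 - θ) / (3 * θ))) := by
                refine mul_le_mul ?_ ?_ (by positivity) (by positivity)
                · simpa using Real.rpow_le_rpow_of_exponent_le
                    (by linarith : (1 : ℝ) ≤ 3 * K₁ + 1) (by linarith : 2 - 2 * θ ≤ 1)
                · refine Real.rpow_le_rpow_of_exponent_le hT1 ?_
                  rw [neg_mul, neg_le_neg_iff, div_le_iff₀ (by positivity)]
                  nlinarith
        calc lam * ψ (x t) (w t) ≤
              μ * (C + 2) * ψ (x t) (w t) ^ (1 - 2 * θ) * ψ (x t) (w t) :=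
                mul_le_mul_of_nonneg_right (hlampos hpos) hpos.le
          _ = μ * (C + 2) * ψ (x t) (w t) ^ (2 - 2 * θ) := by
                rw [mul_assoc, ← Real.rpow_add_one hpos.ne']; congr 2; ring
          _ ≤ μ * (C + 2) * ((3 * K₁ + 1) * (T : ℝ) ^ (-((1 - θ) / (3 * θ)))) :=
                mul_le_mul_of_nonneg_left h4 (by positivity)
          _ = _ := by ring
      have h2 : lam * gap ψ W (x t) (w t) ≤ μ * (C + 2) * (3 * G) * G *
          (T : ℝ) ^ (-((1 - θ) / (3 * θ))) := by
        have h3 : √(gap ψ W (x t) (w t)) ≤ G :=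
          (R.gapψ_le t htT hlate).trans (div_le_self hG (one_le_pow₀ hT1))
        calc lam * gap ψ W (x t) (w t) =
              lam * √(gap ψ W (x t) (w t)) * √(gap ψ W (x t) (w t)) := by
                rw [mul_assoc, Real.mul_self_sqrt hgap0]
          _ ≤ μ * (C + 2) * (3 * G) / τ * G :=
                mul_le_mul hlamgap h3 (Real.sqrt_nonneg _) (by positivity)
          _ = μ * (C + 2) * (3 * G) * G * (T : ℝ) ^ (-(1 / 3) : ℝ) := by rw [hτinv]; ring
          _ ≤ _ := mul_le_mul_of_nonneg_left hexp (by positivity)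
      have h3 : (0 : ℝ) ≤ (T : ℝ) ^ (-((1 - θ) / (3 * θ))) := by positivity
      have h4 : 0 ≤ (Ks + 3 * K₁) * (T : ℝ) ^ (-((1 - θ) / (3 * θ))) := by positivity
      rw [add_mul, hKc, add_mul]
      linarith
    · rw [hlamz hpos, zero_mul, abs_zero]; positivity

/-! ### Existence of runs -/

section Existence

variable {n m l : ℕ} {φ : E n → E m → ℝ} {ψ : E n → E l → ℝ} {Y : Set (E m)} {W : Set (E l)}
  {ay aw : AscentMethod} {sy sw ηφ ηψ μ θ C L ρ : ℝ}

theorem exists_nat_between {K X b : ℝ} (hX : 0 ≤ X) (hb : X + 2 ≤ K * (1 + b)) :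
    ∃ M : ℕ, 1 ≤ M ∧ X ≤ M ∧ (M : ℝ) ≤ K * (1 + b) := by
  refine ⟨⌈X⌉₊ + 1, by omega, ?_, ?_⟩
  · push_cast; linarith [Nat.le_ceil X]
  · push_cast; linarith [Nat.ceil_lt_add_one hX]

theorem ascentBudget_of_nonpos {T : ℕ} {x : E n} {w : E l} (h : ψ x w ≤ 0) :
    ascentBudget ψ θ T x w = max 1 (1 / (2 * θ)) * Real.log T := by
  have : ¬ 0 < zeta ψ x w := by
    rw [zeta, max_eq_right h, zero_mul]; exact lt_irrefl _
  unfold ascentBudget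
  rw [if_neg this]

/-- The number of inner steps for `w` can be chosen of the order of the budget, although the budget
depends on the point that is reached. If `δ = max_{w ∈ W} ψ (x', w) > 0`, then after
`O(1 + log T + log⁺ (1 / δ))` steps the residual lies in `[δ / 2, δ]`, and this determines the budget
up to a constant factor. -/
theorem MethodData.exists_inner_steps (D : MethodData φ ψ Y W ay aw sy sw ηφ ηψ μ θ C L ρ)
    (G : ℝ) : ∃ K > 0, ∀ T : ℕ, ∀ (x' : E n) (w : E l), w ∈ W →
      √(gap ψ W x' w) ≤ G → ∃ M : ℕ, 1 ≤ M ∧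
        rateFactor ρ * ascentBudget ψ θ T x' (aw.run ψ W sw ηψ M x' w) ≤ M ∧
        (M : ℝ) ≤ K * (1 + ascentBudget ψ θ T x' (aw.run ψ W sw ηψ M x' w)) := by
  have hc := rateFactor_pos D.ρ_pos D.ρ_lt_one
  have hθ0 := D.reg.θ_pos
  have hlogρ : 0 < -Real.log ρ := neg_pos.2 (Real.log_neg D.ρ_pos D.ρ_lt_one)
  set c := rateFactor ρ
  set A := Real.log (16 * G ^ 2 + 1)
  have hA : 0 ≤ A := Real.log_nonneg (by nlinarith [sq_nonneg G])
  set e := 4 * θ - 2 with he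
  set K := c + 2 + |2 * c + c * (e * Real.log 2) + (1 / e + A) / (-Real.log ρ) + 2| with hK
  have hKc : c + 2 ≤ K := le_add_of_nonneg_right (abs_nonneg _)
  refine ⟨K, by linarith, fun T x' w hw hG => ?_⟩
  have hT : 0 ≤ Real.log T := Real.log_natCast_nonneg T
  set b₀ := max 1 (1 / (2 * θ)) * Real.log T with hb₀
  have hb₀T : Real.log T ≤ b₀ := le_mul_of_one_le_left hT (le_max_left _ _)
  have hb₀0 : 0 ≤ b₀ := hT.trans hb₀T
  by_cases hall : ∀ w' ∈ W, ascentBudget ψ θ T x' w' = b₀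
  · obtain ⟨M, hM1, hM2, hM3⟩ := exists_nat_between (K := K) (X := c * b₀) (b := b₀)
      (by positivity) (by nlinarith)
    refine ⟨M, hM1, ?_, ?_⟩ <;> rwa [hall _ (D.runψ M x' w hw).1]
  have hθ : 1 / 2 < θ := by
    by_contra! hθ
    refine hall fun w' hw' => ?_
    rcases hθ.lt_or_eq with h | h
    · exact ascentBudget_of_nonpos (D.nonpos h x' w' hw')
    · unfold ascentBudget
      rw [show 2 - 4 * θ = 0 by rw [h]; norm_num, Real.rpow_zero, mul_one, ← hb₀,
        max_eq_left hb₀T, ite_self]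
  have he0 : 0 < e := by rw [he]; linarith
  set δ := maxValue ψ W x' with hδ
  have hδ0 : 0 < δ := by
    by_contra! h
    refine hall fun w' hw' => ascentBudget_of_nonpos ?_
    have := D.valψ.gap_nonneg x' w' hw'
    unfold gap at this
    linarith
  set ℓ := max (-Real.log δ) 0 with hℓ
  have hℓ0 : 0 ≤ ℓ := le_max_right _ _
  have hℓδ : -Real.log δ ≤ ℓ := le_max_left _ _
  have hlog2 : 0 < Real.log 2 := Real.log_pos one_lt_two
  have hT1 : T ≠ 0 := by
    rintro rfl
    refine hall fun w' hw' => ?_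
    unfold ascentBudget
    simp [b₀]
  set X := c * (b₀ + e * ℓ + e * Real.log 2) + (ℓ + A) / (-Real.log ρ) with hX
  have hX0 : 0 ≤ X := by positivity
  obtain ⟨M, hM1, hM2, hM3⟩ := exists_nat_between (K := 1) (X := X) (b := X + 1)
    hX0 (by linarith)
  have hrun := D.runψ M x' w hw
  refine ⟨M, hM1, ?_⟩
  set w' := aw.run ψ W sw ηψ M x' w
  have hρM : ρ ^ M * (16 * G ^ 2 + 1) ≤ δ := by
    rw [← Real.log_le_log_iff (by have := D.ρ_pos; positivity) hδ0,
      Real.log_mul (pow_pos D.ρ_pos M).ne' (by positivity), Real.log_pow]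
    have h1 : (ℓ + A) / (-Real.log ρ) ≤ M := by
      have : 0 ≤ c * (b₀ + e * ℓ + e * Real.log 2) := by positivity
      linarith
    rw [div_le_iff₀ hlogρ] at h1
    linarith
  have hgap : gap ψ W x' w' ≤ δ / 2 := by
    have h1 : gap ψ W x' w ≤ G ^ 2 := by
      rw [← Real.sq_sqrt (D.valψ.gap_nonneg x' w hw)]
      exact pow_le_pow_left₀ (Real.sqrt_nonneg _) hG 2
    have h2 := D.ρ_pos
    have h3 : 2 * ρ ^ M * gap ψ W x' w ≤ 2 * ρ ^ M * G ^ 2 := by gcongr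
    have h4 : 0 < ρ ^ M := by positivity
    have h5 : 0 ≤ ρ ^ M * G ^ 2 := by positivity
    linarith [hrun.2]
  have hψ1 : δ / 2 ≤ ψ x' w' := by unfold gap at hgap; linarith
  have hψ2 : ψ x' w' ≤ δ := sub_nonneg.1 (D.valψ.gap_nonneg x' w' hrun.1)
  have hψ0 : 0 < ψ x' w' := by linarith
  have hbud : ascentBudget ψ θ T x' w' = max b₀ (Real.log T - e * Real.log (ψ x' w')) := by
    unfold ascentBudget
    rw [if_pos ((D.reg.zeta_pos_iff hrun.1).2 hψ0), max_eq_left hψ0.le,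
      Real.log_mul (by exact_mod_cast hT1) (Real.rpow_pos_of_pos hψ0 _).ne', Real.log_rpow hψ0,
      ← hb₀]
    congr 1; rw [he]; ring
  have hlog1 : Real.log δ - Real.log 2 ≤ Real.log (ψ x' w') := by
    rw [← Real.log_div hδ0.ne' two_ne_zero]
    exact Real.log_le_log (by positivity) hψ1
  have hlog2' : Real.log (ψ x' w') ≤ Real.log δ := Real.log_le_log hψ0 hψ2
  rw [hbud]
  set b := max b₀ (Real.log T - e * Real.log (ψ x' w')) with hb
  have hbb₀ : b₀ ≤ b := le_max_left _ _
  have hub : b ≤ b₀ + e * ℓ + e * Real.log 2 := by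
    have h1 : 0 ≤ e * ℓ := by positivity
    have h2 : 0 ≤ e * Real.log 2 := by positivity
    refine max_le (by linarith) ?_
    have := mul_le_mul_of_nonneg_left (by linarith : -Real.log (ψ x' w') ≤ ℓ + Real.log 2) he0.le
    linarith
  have hlb : e * ℓ ≤ b := by
    rw [hℓ, mul_max_of_nonneg _ _ he0.le, mul_zero]
    refine max_le (le_trans ?_ (le_max_right _ _)) (hb₀0.trans hbb₀)
    have := mul_le_mul_of_nonneg_left hlog2' he0.le
    linarith
  have hb0 : 0 ≤ b := hb₀0.trans hbb₀
  refine ⟨?_, ?_⟩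
  · have h1 : 0 ≤ (ℓ + A) / (-Real.log ρ) := by positivity
    have h2 := mul_le_mul_of_nonneg_left hub hc.le
    linarith
  · have h1 : ℓ ≤ 1 / e * b := by rw [one_div_mul_eq_div, le_div_iff₀ he0]; linarith
    have h2 : X ≤ c * (b + b + e * Real.log 2) + (1 / e * b + A) / (-Real.log ρ) := by
      rw [hX]; gcongr
    have h3 : c * (b + b + e * Real.log 2) + (1 / e * b + A) / (-Real.log ρ) + 2 ≤
        (2 * c + c * (e * Real.log 2) + (1 / e + A) / (-Real.log ρ) + 2) * (1 + b) := by
      have e1 : (2 * c + c * (e * Real.log 2) + (1 / e + A) / (-Real.log ρ) + 2) * (1 + b) =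
          c * (b + b + e * Real.log 2) + (1 / e * b + A) / (-Real.log ρ) + 2 +
          (2 * c + c * (e * Real.log 2) * b + 1 / e / (-Real.log ρ) + A / (-Real.log ρ) * b +
            2 * b) := by ring
      rw [e1]
      exact le_add_of_nonneg_right (by positivity)
    have h4 : (2 * c + c * (e * Real.log 2) + (1 / e + A) / (-Real.log ρ) + 2) * (1 + b) ≤
        K * (1 + b) :=
      mul_le_mul_of_nonneg_right
        ((le_abs_self _).trans (le_add_of_nonneg_left (by positivity))) (by positivity)
    linarith

/-- Runs that meet the budgets with logarithmically many inner steps exist: the numbers of inner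
steps are chosen along the recursion, which keeps the inner error below `G`. -/
theorem MethodData.exists_run (D : MethodData φ ψ Y W ay aw sy sw ηφ ηψ μ θ C L ρ)
    {ω c₂ G : ℝ} (hω : 0 < ω) {x₀ : E n} {y₀ : E m} {w₀ : E l} (hy₀ : y₀ ∈ Y) (hw₀ : w₀ ∈ W)
    (hGψ : √(gap ψ W x₀ w₀) ≤ G) (hGS : L * (c₂ * (2 * C + 1)) ≤ G) :
    ∃ K > 0, ∀ (T : ℕ) (γ : ℝ), 1 ≤ T → 0 ≤ γ → γ * (T : ℝ) ^ (1 / 3 : ℝ) ≤ c₂ →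
      ∃ (N M : ℕ → ℕ) (x : ℕ → E n) (y : ℕ → E m) (w : ℕ → E l),
        IsRun φ ψ Y W ay aw sy sw ηφ ηψ (weight ω T) γ T N M x₀ y₀ w₀ x y w ∧
        ∀ k : ℕ, 1 ≤ k → k ≤ T →
          (1 ≤ N k ∧ rateFactor ρ * Real.log (k + 1) ≤ N k ∧
            (N k : ℝ) ≤ K * (1 + Real.log (k + 1))) ∧
          (1 ≤ M k ∧ rateFactor ρ * ascentBudget ψ θ T (x k) (w k) ≤ M k ∧
            (M k : ℝ) ≤ K * (1 + ascentBudget ψ θ T (x k) (w k))) := by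
  have hc := rateFactor_pos D.ρ_pos D.ρ_lt_one
  have hG0 : 0 ≤ G := (Real.sqrt_nonneg _).trans hGψ
  obtain ⟨K, hK, hsteps⟩ := D.exists_inner_steps (2 * G)
  refine ⟨K + (rateFactor ρ + 2), by positivity, fun T γ hT hγ0 hγ => ?_⟩
  have hT1 : (1 : ℝ) ≤ T := by exact_mod_cast hT
  have hNex : ∀ k : ℕ, ∃ N : ℕ, 1 ≤ N ∧ rateFactor ρ * Real.log (k + 1) ≤ N ∧
      (N : ℝ) ≤ (rateFactor ρ + 2) * (1 + Real.log (k + 1)) := by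
    intro k
    have hlog : 0 ≤ Real.log ((k : ℝ) + 1) :=
      Real.log_nonneg (by linarith [k.cast_nonneg (α := ℝ)])
    exact exists_nat_between (by positivity) (by nlinarith)
  choose N hN1 hN2 hN3 using hNex
  have hMex : ∀ (x' : E n) (w : E l), ∃ M : ℕ, w ∈ W → √(gap ψ W x' w) ≤ 2 * G → 1 ≤ M ∧
      rateFactor ρ * ascentBudget ψ θ T x' (aw.run ψ W sw ηψ M x' w) ≤ M ∧
      (M : ℝ) ≤ K * (1 + ascentBudget ψ θ T x' (aw.run ψ W sw ηψ M x' w)) := by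
    intro x' w
    by_cases h : w ∈ W ∧ √(gap ψ W x' w) ≤ 2 * G
    · obtain ⟨M, hM⟩ := hsteps T x' w h.1 h.2
      exact ⟨M, fun _ _ => hM⟩
    · exact ⟨0, fun h1 h2 => absurd ⟨h1, h2⟩ h⟩
  choose Mf hMf using hMex
  -- the states `(x, y, w)` of the run
  let next : ℕ → E n × E m × E l → E n × E m × E l := fun k s =>
    (s.1 + γ • direction φ ψ (weight ω T k) s.1 s.2.1 s.2.2,
      ay.run φ Y sy ηφ (N (k + 1))
        (s.1 + γ • direction φ ψ (weight ω T k) s.1 s.2.1 s.2.2) s.2.1,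
      aw.run ψ W sw ηψ (Mf (s.1 + γ • direction φ ψ (weight ω T k) s.1 s.2.1 s.2.2) s.2.2)
        (s.1 + γ • direction φ ψ (weight ω T k) s.1 s.2.1 s.2.2) s.2.2)
  let s : ℕ → E n × E m × E l := fun k => Nat.rec (x₀, y₀, w₀) next k
  let x : ℕ → E n := fun k => (s k).1
  let y : ℕ → E m := fun k => (s k).2.1
  let w : ℕ → E l := fun k => (s k).2.2
  let M : ℕ → ℕ := fun k => Mf (x k) (w (k - 1))
  have hrun : IsRun φ ψ Y W ay aw sy sw ηφ ηψ (weight ω T) γ T N M x₀ y₀ w₀ x y w :=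
    ⟨rfl, rfl, rfl, fun k _ => rfl, fun k _ => rfl, fun k _ => rfl⟩
  have hymem : ∀ k ≤ T, y k ∈ Y := by
    intro k
    induction k with
    | zero => intro _; rw [hrun.y_zero]; exact hy₀
    | succ k ih => intro hk; rw [hrun.y_succ k hk]; exact (D.runφ _ _ _ (ih (by omega))).1
  have hwmem : ∀ k ≤ T, w k ∈ W := by
    intro k
    induction k with
    | zero => intro _; rw [hrun.w_zero]; exact hw₀
    | succ k ih => intro hk; rw [hrun.w_succ k hk]; exact (D.runψ _ _ _ (ih (by omega))).1
  have hLx : ∀ k < T, L * ‖x (k + 1) - x k‖ ≤ G := by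
    intro k hk
    rw [hrun.x_succ k hk, add_sub_cancel_left, norm_smul, Real.norm_of_nonneg hγ0]
    exact (mul_le_mul_of_nonneg_left (D.step_le hω hT hγ0 hγ (hymem k hk.le))
      D.valφ.L_pos.le).trans hGS
  have hMk : ∀ k < T, √(gap ψ W (x k) (w k)) ≤ G → 1 ≤ M (k + 1) ∧
      rateFactor ρ * ascentBudget ψ θ T (x (k + 1)) (w (k + 1)) ≤ M (k + 1) ∧
      (M (k + 1) : ℝ) ≤ K * (1 + ascentBudget ψ θ T (x (k + 1)) (w (k + 1))) := by
    intro k hk hgap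
    refine hMf (x (k + 1)) (w k) (hwmem k hk.le) ?_
    have := D.valψ.sqrt_gap_le (x k) (x (k + 1)) (w k) (hwmem k hk.le)
    linarith [hLx k hk]
  have hgap : ∀ k < T, √(gap ψ W (x k) (w k)) ≤ G := by
    intro k
    induction k with
    | zero => intro _; exact hGψ
    | succ k ih =>
      intro hk
      have h1 := ih (by omega)
      have h2 := D.rateFactor_mul_log_le (hMk k (by omega) h1).2.1
      rw [hrun.w_succ k (by omega)]
      refine (sqrt_gap_run_le D.valψ D.ρ_pos D.ρ_lt_one (run := aw.run ψ W sw ηψ) D.runψ ?_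
        h2 (hwmem k (by omega)) h1 (hLx k (by omega))).trans
        (div_le_self hG0 (one_le_pow₀ hT1))
      exact_mod_cast (by omega : 2 ≤ T)
  refine ⟨N, M, x, y, w, hrun, fun k hk1 hkT => ?_⟩
  obtain ⟨k, rfl⟩ : ∃ j, k = j + 1 := ⟨k - 1, by omega⟩
  obtain ⟨h1, h2, h3⟩ := hMk k (by omega) (hgap k (by omega))
  refine ⟨⟨hN1 _, hN2 _, (hN3 _).trans ?_⟩, h1, h2, h3.trans ?_⟩
  · refine mul_le_mul_of_nonneg_right (by linarith) ?_
    have : 0 ≤ Real.log (((k + 1 : ℕ) : ℝ) + 1) :=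
      Real.log_nonneg (by linarith [(k + 1).cast_nonneg (α := ℝ)])
    linarith
  · refine mul_le_mul_of_nonneg_right (by linarith) ?_
    have := (Real.log_natCast_nonneg T).trans
      (log_natCast_le_ascentBudget (ψ := ψ) (θ := θ) (x := x (k + 1)) (w := w (k + 1)))
    linarith

end Existence

/-! ### Complexity -/

/-- The translation of a rate `T ^ (-1 / a)` into a complexity `ε ^ (-a)`. -/
theorem le_of_rate {K X ε a C : ℝ} {T : ℕ} (hK : 0 < K) (hε : 0 < ε) (ha : 0 < a) (hT : 1 ≤ T)
    (hX : X ≤ K * (T : ℝ) ^ (-(1 / a))) (hC : K ^ a ≤ C) (h : C * ε ^ (-a) ≤ T) : X ≤ ε := by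
  have hT0 : (0 : ℝ) < T := by exact_mod_cast hT
  have h1 : (K / ε) ^ a ≤ T := by
    rw [Real.div_rpow hK.le hε.le, div_eq_mul_inv, ← Real.rpow_neg hε.le]
    exact (mul_le_mul_of_nonneg_right hC (by positivity)).trans h
  have h2 : K / ε ≤ (T : ℝ) ^ (1 / a) := by
    rw [one_div]
    exact (Real.le_rpow_inv_iff_of_pos (by positivity) hT0.le ha).2 h1
  rw [div_le_iff₀ hε] at h2
  rw [Real.rpow_neg hT0.le, ← div_eq_mul_inv] at hX
  exact hX.trans ((div_le_iff₀ (by positivity)).2 (by linarith))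

theorem exists_methodData {n m l : ℕ} {φ : E n → E m → ℝ} {Y : Set (E m)} {ψ : E n → E l → ℝ}
    {W : Set (E l)} {Lφxx Lφxy Lφyy Cφ ηφ cφ Lψxx Lψxw Lψww Cψ ηψ cψ μ θ : ℝ}
    (hφ : CouplingAssumption φ Y Lφxx Lφxy Lφyy Cφ ηφ cφ)
    (hψ : CouplingAssumption ψ W Lψxx Lψxw Lψww Cψ ηψ cψ)
    (hreg : LojasiewiczRegularity ψ W μ θ) {ay aw : AscentMethod} {sy sw : ℝ}
    (hay : ay.Admissible φ Y Lφyy ηφ sy) (haw : aw.Admissible ψ W Lψww ηψ sw) :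
    ∃ C L ρ, MethodData φ ψ Y W ay aw sy sw ηφ ηψ μ θ C L ρ := by
  obtain ⟨L₁, R₁⟩ := hφ.exists_valueRegularity
  obtain ⟨L₂, R₂⟩ := hψ.exists_valueRegularity
  obtain ⟨ρ₁, h10, h11, H₁⟩ := hφ.exists_linear_rate hay
  obtain ⟨ρ₂, h20, h21, H₂⟩ := hψ.exists_linear_rate haw
  exact ⟨max Cφ Cψ, max L₁ L₂, max ρ₁ ρ₂,
    { C_pos := hφ.C_pos.trans_le (le_max_left _ _)
      ρ_pos := h10.trans_le (le_max_left _ _)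
      ρ_lt_one := max_lt h11 h21
      valφ := R₁.mono (le_max_left _ _)
      valψ := R₂.mono (le_max_right _ _)
      norm_gradX_le := fun x y hy => (hφ.bounded_gradX x y hy).trans (le_max_left _ _)
      maxValue_le := fun x x' => (hψ.maxValue_le x x').trans (by gcongr; exact le_max_right _ _)
      runφ := fun N x u hu => ⟨(H₁ N x u hu).1, (H₁ N x u hu).2.trans
        (mul_le_mul_of_nonneg_right (by gcongr; exact le_max_left _ _) (R₁.gap_nonneg x u hu))⟩
      runψ := fun N x u hu => ⟨(H₂ N x u hu).1, (H₂ N x u hu).2.trans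
        (mul_le_mul_of_nonneg_right (by gcongr; exact le_max_right _ _) (R₂.gap_nonneg x u hu))⟩
      reg := hreg
      nonpos := fun h x w hw => hreg.nonpos_of_theta_lt hψ h x hw }⟩

end SemiInfMinMax

theorem theorem2 {n m l : ℕ}
    (φ : SemiInfMinMax.E n → SemiInfMinMax.E m → ℝ) (Y : Set (SemiInfMinMax.E m))
    (ψ : SemiInfMinMax.E n → SemiInfMinMax.E l → ℝ) (W : Set (SemiInfMinMax.E l))
    (Lφxx Lφxy Lφyy Cφ ηφ cφ Lψxx Lψxw Lψww Cψ ηψ cψ μ θ : ℝ)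
    (hφ : SemiInfMinMax.CouplingAssumption φ Y Lφxx Lφxy Lφyy Cφ ηφ cφ)
    (hψ : SemiInfMinMax.CouplingAssumption ψ W Lψxx Lψxw Lψww Cψ ηψ cψ)
    (hreg : SemiInfMinMax.LojasiewiczRegularity ψ W μ θ)
    (hbdd : BddBelow (Set.range (SemiInfMinMax.maxValue φ Y)))
    (ay aw : SemiInfMinMax.AscentMethod) (sy sw : ℝ)
    (hay : ay.Admissible φ Y Lφyy ηφ sy) (haw : aw.Admissible ψ W Lψww ηψ sw) :
    -- the implicit problem: the maxima are attained and the value functions are `C¹`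
    (∀ x, IsGreatest (φ x '' Y) (SemiInfMinMax.maxValue φ Y x)) ∧
    (∀ x, IsGreatest (ψ x '' W) (SemiInfMinMax.maxValue ψ W x)) ∧
    ContDiff ℝ 1 (SemiInfMinMax.maxValue φ Y) ∧
    ContDiff ℝ 1 (SemiInfMinMax.maxValue ψ W) ∧
    ∃ cN > 0, ∃ cM > 0,
      ∀ x₀ : SemiInfMinMax.E n, ∀ y₀ ∈ Y, ∀ w₀ ∈ W, ∀ c₁ c₂ : ℝ, 0 < c₁ → c₁ ≤ c₂ →
      ∃ ω₀ > 0, ∀ ω : ℝ, 0 < ω → ω < ω₀ →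
      ∃ C > 0, ∀ T : ℕ, 1 ≤ T →
      ∀ γ : ℝ, c₁ / (T : ℝ) ^ (1 / 3 : ℝ) ≤ γ → γ ≤ c₂ / (T : ℝ) ^ (1 / 3 : ℝ) →
        -- runs with enough inner steps exist, with logarithmically many inner steps
        (∃ (N M : ℕ → ℕ) (x : ℕ → SemiInfMinMax.E n) (y : ℕ → SemiInfMinMax.E m)
            (w : ℕ → SemiInfMinMax.E l),
          SemiInfMinMax.IsRun φ ψ Y W ay aw sy sw ηφ ηψ (SemiInfMinMax.weight ω T) γ T N M
            x₀ y₀ w₀ x y w ∧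
          ∀ k : ℕ, 1 ≤ k → k ≤ T →
            (1 ≤ N k ∧ cN * Real.log (k + 1) ≤ N k ∧ (N k : ℝ) ≤ C * (1 + Real.log (k + 1))) ∧
            (1 ≤ M k ∧ cM * SemiInfMinMax.ascentBudget ψ θ T (x k) (w k) ≤ M k ∧
              (M k : ℝ) ≤ C * (1 + SemiInfMinMax.ascentBudget ψ θ T (x k) (w k)))) ∧
        -- every run with enough inner steps has the stated complexities, at one and the same `t`
        (∀ (N M : ℕ → ℕ) (x : ℕ → SemiInfMinMax.E n) (y : ℕ → SemiInfMinMax.E m)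
            (w : ℕ → SemiInfMinMax.E l),
          SemiInfMinMax.IsRun φ ψ Y W ay aw sy sw ηφ ηψ (SemiInfMinMax.weight ω T) γ T N M
            x₀ y₀ w₀ x y w →
          (∀ k : ℕ, 1 ≤ k → k ≤ T →
            (1 ≤ N k ∧ cN * Real.log (k + 1) ≤ N k) ∧
            (1 ≤ M k ∧ cM * SemiInfMinMax.ascentBudget ψ θ T (x k) (w k) ≤ M k)) →
          ∃ t < T, ∀ lam : ℝ,
            lam = SemiInfMinMax.multiplier φ ψ (SemiInfMinMax.weight ω T t) (x t) (y t) (w t) →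
            0 ≤ lam ∧
            ∀ ε : ℝ, 0 < ε →
              (C * ε ^ (-3 : ℝ) ≤ T →
                ‖gradient (SemiInfMinMax.maxValue φ Y) (x t) +
                  lam • gradient (SemiInfMinMax.maxValue ψ W) (x t)‖ ≤ ε) ∧
              (C * ε ^ (-(6 * θ)) ≤ T → max (SemiInfMinMax.maxValue ψ W (x t)) 0 ≤ ε) ∧
              (C * ε ^ (-(3 * θ / (1 - θ))) ≤ T →
                |lam * SemiInfMinMax.maxValue ψ W (x t)| ≤ ε)) := by
  obtain ⟨C, L, ρ, D⟩ := SemiInfMinMax.exists_methodData hφ hψ hreg hay haw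
  have hC := D.C_pos
  have hL := D.valφ.L_pos
  have hθ0 := hreg.θ_pos
  have hθ1 := hreg.θ_lt_one
  have hρ := SemiInfMinMax.rateFactor_pos D.ρ_pos D.ρ_lt_one
  refine ⟨hφ.isGreatest_maxValue, hψ.isGreatest_maxValue, D.valφ.contDiff, D.valψ.contDiff,
    SemiInfMinMax.rateFactor ρ, hρ, SemiInfMinMax.rateFactor ρ, hρ, ?_⟩
  intro x₀ y₀ hy₀ w₀ hw₀ c₁ c₂ hc₁ hc₁₂
  have hc₂ : 0 < c₂ := hc₁.trans_le hc₁₂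
  -- bounds for the initial errors and for the drift of the inner problems in one step
  set G := √(SemiInfMinMax.gap φ Y x₀ y₀) + √(SemiInfMinMax.gap ψ W x₀ w₀) +
    L * (c₂ * (2 * C + 1)) +
      |ψ x₀ w₀ ^ (1 - 2 * θ) * √(SemiInfMinMax.gap ψ W x₀ w₀)| with hG
  have hg1 : 0 ≤ √(SemiInfMinMax.gap φ Y x₀ y₀) := Real.sqrt_nonneg _
  have hg2 : 0 ≤ √(SemiInfMinMax.gap ψ W x₀ w₀) := Real.sqrt_nonneg _
  have hg3 : 0 ≤ L * (c₂ * (2 * C + 1)) := by positivity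
  have hg4 := abs_nonneg (ψ x₀ w₀ ^ (1 - 2 * θ) * √(SemiInfMinMax.gap ψ W x₀ w₀))
  have hg5 := le_abs_self (ψ x₀ w₀ ^ (1 - 2 * θ) * √(SemiInfMinMax.gap ψ W x₀ w₀))
  have hG0 : 0 ≤ G := by linarith
  obtain ⟨ω₀, hω₀, H⟩ := D.exists_good_iterate hbdd (c₂ := c₂) (S := c₂ * (2 * C + 1)) hc₁
    (by positivity) hG0 x₀
  refine ⟨ω₀, hω₀, fun ω hω hω' => ?_⟩
  obtain ⟨K, hK, H⟩ := H ω hω hω'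
  obtain ⟨K', hK', Hrun⟩ := D.exists_run (G := G) (c₂ := c₂) hω (x₀ := x₀) hy₀ hw₀
    (by linarith) (by linarith)
  have hK1 : 0 < K ^ (3 : ℝ) := by positivity
  have hK2 : 0 < K ^ (6 * θ) := by positivity
  have hK3 : 0 < K ^ (3 * θ / (1 - θ)) := by positivity
  set Cs := K' + K ^ (3 : ℝ) + K ^ (6 * θ) + K ^ (3 * θ / (1 - θ)) with hCs
  refine ⟨Cs, by positivity, fun T hT γ hγ1 hγ2 => ?_⟩
  have hτ0 : 0 < (T : ℝ) ^ (1 / 3 : ℝ) :=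
    zero_lt_one.trans_le (SemiInfMinMax.one_le_rpow_third hT)
  have hγ0 : 0 < γ := (by positivity : 0 < c₁ / (T : ℝ) ^ (1 / 3 : ℝ)).trans_le hγ1
  rw [div_le_iff₀ hτ0] at hγ1
  rw [le_div_iff₀ hτ0] at hγ2
  constructor
  · obtain ⟨N, M, x, y, w, hrun, hk⟩ := Hrun T γ hT hγ0.le hγ2
    refine ⟨N, M, x, y, w, hrun, fun k hk1 hkT => ?_⟩
    obtain ⟨⟨a1, a2, a3⟩, b1, b2, b3⟩ := hk k hk1 hkT
    have hCK : K' ≤ Cs := by linarith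
    refine ⟨⟨a1, a2, a3.trans (mul_le_mul_of_nonneg_right hCK ?_)⟩, b1, b2,
      b3.trans (mul_le_mul_of_nonneg_right hCK ?_)⟩
    · have : 0 ≤ Real.log ((k : ℝ) + 1) :=
        Real.log_nonneg (by linarith [k.cast_nonneg (α := ℝ)])
      linarith
    · have := (Real.log_natCast_nonneg T).trans
        (SemiInfMinMax.log_natCast_le_ascentBudget (ψ := ψ) (θ := θ) (x := x k) (w := w k))
      linarith
  · intro N M x y w hrun hk
    have R := D.controlledRun hω hT hγ0 hγ1 hγ2 hy₀ hw₀ (G := G) (by linarith) (by linarith)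
      (by linarith) (by linarith) hrun (fun k h1 h2 => (hk k h1 h2.le).1.2)
      (fun k h1 h2 => (hk k h1 h2.le).2.2)
    obtain ⟨t, htT, h1, h2, h3⟩ := H T γ x y w R
    refine ⟨t, htT, ?_⟩
    rintro lam rfl
    refine ⟨SemiInfMinMax.multiplier_nonneg, fun ε hε => ⟨fun h => ?_, fun h => ?_, fun h => ?_⟩⟩
    · exact SemiInfMinMax.le_of_rate hK hε (by norm_num : (0 : ℝ) < 3) hT h1 (by linarith) h
    · exact SemiInfMinMax.le_of_rate hK hε (by positivity : 0 < 6 * θ) hT h2 (by linarith) h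
    · have h1θ : 0 < 1 - θ := by linarith
      refine SemiInfMinMax.le_of_rate hK hε (by positivity : 0 < 3 * θ / (1 - θ)) hT ?_
        (by linarith) h
      rwa [one_div_div]
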